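/- An instance of load balancing on identical machines (in high-multiplicity encoding) consists of a number $m\ge 1$ of machines and of $d\ge 1$ job types, where type $j$ has a positive integral processing time $p_j$ and occurs $n_j\ge 1$ times; the processing times of different types are different, and $p_{\max}=\max_j p_j$. A schedule assigns every job to one machine, that is, it is a matrix $x\in\mathbb{Z}_{\ge 0}^{m\times d}$ with $\sum_{i=1}^m x_{i,j}=n_j$ for every $j$. The load of machine $i$ is $L_i=\sum_j p_j x_{i,j}$, and $C_{\max}=\max_i L_i$, $C_{\min}=\min_i L_i$, $C_{\mathrm{envy}}=C_{\max}-C_{\min}$. The problems $P||C_{\max}$, $P||C_{\min}$ and $P||C_{\mathrm{envy}}$ ask, respectively, to minimize $C_{\max}$, to maximize $C_{\min}$ and to minimize $C_{\mathrm{envy}}$; the optimal value is denoted by $\mathrm{OPT}$. Theorem. Each of the three problems $P||\{C_{\max},C_{\min},C_{\mathrm{envy}}\}$ has an additive approximation scheme with error at most $\varepsilon p_{\max}$ and running time $(m\,p_{\max})^{O(1/\varepsilon)}$. In detail: for each of the three objectives there are one word-RAM program and one constant $C$ such that, for every instance and every rational $\varepsilon\in(0,1]$ (given to the program, together with the instance,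 by its numerator and its denominator), the program halts after at most $C\,(m\,p_{\max})^{C/\varepsilon}$ steps and outputs a schedule with $C_{\max}\le \mathrm{OPT}+\varepsilon p_{\max}$, with $C_{\min}\ge \mathrm{OPT}-\varepsilon p_{\max}$, or with $C_{\mathrm{envy}}\le \mathrm{OPT}+\varepsilon p_{\max}$, respectively. Here reading or writing a word, adding, subtracting, multiplying or dividing (with rounding down) two words, and testing a word for zero take one step each, and no word ever holds a number larger than $C\,N^{C}(m\,p_{\max})^{C/\varepsilon}$, where $N$ is the sum of all the input numbers, so that a word has $O\bigl(\log N+\tfrac{1}{\varepsilon}\log (m\,p_{\max})\bigr)$ bits, up to an additive constant. -/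

import Mathlib

/-! ## Scheduling on identical machines, high-multiplicity encoding -/

namespace Scheduling

/-- An instance of load balancing on `m` identical machines: there are `d` job types, type `j` has
processing time `p j` and occurs `n j` times. Different types have different processing times, so
`d` is the number of different processing times. All numbers are positive integers. -/
structure Problem where
  d : ℕ
  m : ℕ
  p : Fin d → ℕ
  n : Fin d → ℕ
  d_pos : 0 < d
  m_pos : 0 < m
  p_pos : ∀ j, 0 < p j
  n_pos : ∀ j, 0 < n j
  p_injective : Function.Injective p

/-- The largest processing time. -/
def Problem.pmax (I : Problem) : ℕ := Finset.univ.sup I.p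

/-- The sum of all the numbers of the instance. -/
def Problem.total (I : Problem) : ℕ := I.d + I.m + ∑ j, I.p j + ∑ j, I.n j

/-- A schedule: `x i j` jobs of type `j` are put on machine `i`, and every job is put on exactly one
machine. -/
structure Problem.Schedule (I : Problem) where
  x : Fin I.m → Fin I.d → ℕ
  sum_eq : ∀ j, ∑ i, x i j = I.n j

theorem Problem.machines_nonempty (I : Problem) :
    (Finset.univ : Finset (Fin I.m)).Nonempty :=
  ⟨⟨0, I.m_pos⟩, Finset.mem_univ _⟩

namespace Problem.Schedule

/-- The load of a machine. -/
def load {I : Problem} (π : I.Schedule) (i : Fin I.m) : ℕ := ∑ j, π.x i j * I.p j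

/-- The makespan `C_max`, the largest load of a machine. -/
def cmax {I : Problem} (π : I.Schedule) : ℕ := Finset.univ.sup' I.machines_nonempty π.load

/-- `C_min`, the smallest load of a machine. -/
def cmin {I : Problem} (π : I.Schedule) : ℕ := Finset.univ.inf' I.machines_nonempty π.load

/-- `C_envy = C_max - C_min`; the subtraction never truncates, since `C_min ≤ C_max`. -/
def cenvy {I : Problem} (π : I.Schedule) : ℕ := π.cmax - π.cmin

end Problem.Schedule

/-- The three objectives: minimize `C_max`, maximize `C_min`, minimize `C_envy`. -/
inductive Objective where
  | cmax
  | cmin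
  | cenvy

/-- The optimal value of an instance. The set of schedules is finite and nonempty, so the infima and
the supremum are attained. -/
noncomputable def Problem.opt (I : Problem) : Objective → ℕ
  | .cmax => ⨅ π : I.Schedule, π.cmax
  | .cmin => ⨆ π : I.Schedule, π.cmin
  | .cenvy => ⨅ π : I.Schedule, π.cenvy

/-- The value of the schedule `π` differs from the optimum by at most `δ`. -/
def Problem.Schedule.HasAdditiveError {I : Problem} (π : I.Schedule) (obj : Objective) (δ : ℝ) :
    Prop :=
  match obj with
  | .cmax => (π.cmax : ℝ) ≤ I.opt .cmax + δ
  | .cmin => (I.opt .cmin : ℝ) - δ ≤ π.cmin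
  | .cenvy => (π.cenvy : ℝ) ≤ I.opt .cenvy + δ

end Scheduling

/-! ## A word RAM

Structured programs over registers and arrays that hold natural numbers. A program mentions finitely
many registers and arrays by name, array cells are addressed by computed values, all arithmetic
operations, reads, writes and jumps cost one step each, and no value that is computed or read may
exceed a bound `W` (words of about `log₂ W` bits). -/

namespace WordRAM

structure State where
  reg : ℕ → ℕ
  arr : ℕ → ℕ → ℕ

/-- `sub` is truncated subtraction; `div` is division with rounding down, and `x / 0 = 0`. -/
inductive Op where
  | add
  | sub
  | mul
  | div

def Op.eval : Op → ℕ → ℕ → ℕ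
  | .add, x, y => x + y
  | .sub, x, y => x - y
  | .mul, x, y => x * y
  | .div, x, y => x / y

/-- Constants, registers, array cells `get a i` (cell `i` of array `a`), arithmetic. -/
inductive Term where
  | const (c : ℕ)
  | reg (r : ℕ)
  | get (a : ℕ) (i : Term)
  | op (o : Op) (e f : Term)

namespace Term

def eval (s : State) : Term → ℕ
  | const c => c
  | reg r => s.reg r
  | get a i => s.arr a (i.eval s)
  | op o e f => o.eval (e.eval s) (f.eval s)

/-- The number of steps of the evaluation. -/
def cost : Term → ℕ
  | const _ => 1
  | reg _ => 1
  | get _ i => i.cost + 1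
  | op _ e f => e.cost + f.cost + 1

/-- No value that occurs in the evaluation exceeds `W`. -/
def Fits (W : ℕ) (s : State) : Term → Prop
  | const c => c ≤ W
  | reg r => s.reg r ≤ W
  | get a i => i.Fits W s ∧ s.arr a (i.eval s) ≤ W
  | op o e f => e.Fits W s ∧ f.Fits W s ∧ o.eval (e.eval s) (f.eval s) ≤ W

end Term

/-- Programs. `set r e` writes `e` to register `r`, and `put a i e` writes `e` to cell `i` of array
`a`. A test succeeds if its value is not zero. -/
inductive Program where
  | skip
  | set (r : ℕ) (e : Term)
  | put (a : ℕ) (i e : Term)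
  | seq (P Q : Program)
  | ite (e : Term) (P Q : Program)
  | loop (e : Term) (P : Program)

def State.setReg (s : State) (r v : ℕ) : State :=
  { s with reg := Function.update s.reg r v }

def State.setCell (s : State) (a i v : ℕ) : State :=
  { s with arr := Function.update s.arr a (Function.update (s.arr a) i v) }

/-- `Exec W P s t s'`: the program `P`, started in state `s`, halts in state `s'` after `t` steps,
and no value that occurs on the way exceeds `W`. -/
inductive Exec (W : ℕ) : Program → State → ℕ → State → Prop where
  | skip (s : State) : Exec W .skip s 1 s
  | set (s : State) (r : ℕ) (e : Term) (he : e.Fits W s) :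
      Exec W (.set r e) s (e.cost + 1) (s.setReg r (e.eval s))
  | put (s : State) (a : ℕ) (i e : Term) (hi : i.Fits W s) (he : e.Fits W s) :
      Exec W (.put a i e) s (i.cost + e.cost + 1) (s.setCell a (i.eval s) (e.eval s))
  | seq (P Q : Program) (s₁ s₂ s₃ : State) (t u : ℕ)
      (hP : Exec W P s₁ t s₂) (hQ : Exec W Q s₂ u s₃) :
      Exec W (.seq P Q) s₁ (t + u) s₃
  | ite_true (e : Term) (P Q : Program) (s s' : State) (t : ℕ)
      (he : e.Fits W s) (h : e.eval s ≠ 0) (hP : Exec W P s t s') :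
      Exec W (.ite e P Q) s (e.cost + 1 + t) s'
  | ite_false (e : Term) (P Q : Program) (s s' : State) (t : ℕ)
      (he : e.Fits W s) (h : e.eval s = 0) (hQ : Exec W Q s t s') :
      Exec W (.ite e P Q) s (e.cost + 1 + t) s'
  | loop_true (e : Term) (P : Program) (s₁ s₂ s₃ : State) (t u : ℕ)
      (he : e.Fits W s₁) (h : e.eval s₁ ≠ 0)
      (hP : Exec W P s₁ t s₂) (hL : Exec W (.loop e P) s₂ u s₃) :
      Exec W (.loop e P) s₁ (e.cost + 1 + t + u) s₃
  | loop_false (e : Term) (P : Program) (s : State) (he : e.Fits W s) (h : e.eval s = 0) :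
      Exec W (.loop e P) s (e.cost + 1) s

end WordRAM

/-! ## Input and output -/

namespace Scheduling

/-- The initial state for the instance `I` and the error parameter `ε`: registers 0, 1, 2, 3 hold
`d`, `m`, and the numerator and the denominator of `ε`; array 0 holds the processing times and
array 1 the multiplicities. All other registers and cells are zero. -/
def Problem.input (I : Problem) (ε : ℚ) : WordRAM.State where
  reg
    | 0 => I.d
    | 1 => I.m
    | 2 => ε.num.natAbs
    | 3 => ε.den
    | _ => 0
  arr
    | 0, k => if h : k < I.d then I.p ⟨k, h⟩ else 0
    | 1, k => if h : k < I.d then I.n ⟨k, h⟩ else 0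
    | _, _ => 0

/-- Array 2 of the state `s` holds the schedule `π`, as an `m × d` matrix, row by row. -/
def Problem.Schedule.IsOutput {I : Problem} (π : I.Schedule) (s : WordRAM.State) : Prop :=
  ∀ (i : Fin I.m) (j : Fin I.d), s.arr 2 (i * I.d + j) = π.x i j

end Scheduling

/-!
# An additive approximation scheme for load balancing

Let `w = ⌊ε pmax / 2⌋`, and divide the processing times into `K = O(1 / ε)` classes of sizes that
differ by at most `w`.

*Nearly uniform schedules.* Among the schedules whose loads lie in a given interval, take one with
the least sum of the squares of the loads, and among these one with the least sum of the squares of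
the numbers of jobs. Its loads differ by at most `pmax`, for otherwise a job could be moved; and the
numbers of jobs of a type on two machines differ by at most `pmax ^ 2`, for otherwise `p_b` jobs of
some type `a` could be exchanged for `p_a` jobs of some type `b` (`exists_nearly_uniform`). Hence
`n_j / m - pmax ^ 2` jobs of type `j` can be fixed on every machine. Less than `Q` jobs remain, for
a polynomial `Q` in `m` and `pmax`.

*Paths of codes.* The remaining jobs are described class by class, machine after machine: a code
holds the number of jobs of each class on the machines so far, their load, and the average size on
the last of these machines, where loads and averages are scaled by `Q` and rounded. A path of codes
(`IsPath`) has averages that increase in every class and that the sizes of the jobs of the class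
majorize. There are `(m pmax) ^ O(1 / ε)` codes, so the best path can be found with a table. Every
nearly uniform schedule yields a path with the same bounds on the loads (`exists_isPath`): among the
fractional redistributions of the jobs that keep the loads and the numbers of jobs of the classes,
take one that minimizes the sum over machines and classes of the squared load of the class divided
by its number of jobs (`Params.spread`). If the relation "the average of some class is smaller on `i`
than on `i'`" had a cycle, then the exchanges of jobs along the cycle, scaled so that each shifts the
same load, would add up to an improving direction. So the relation is acyclic
(`not_transGen_below`), and the machines can be sorted such that all the averages increase
(`exists_ordered`).

*From paths to schedules.* Distribute the jobs with the numbers of jobs of the classes that the path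
gives. If no exchange within a class shifts load from a set `R` of machines to the others, then `R`
holds the smallest jobs of every class, and majorization bounds the load of `R` by the load that the
path attributes to `R` (`load_le_virtual`). By this cut condition, a push-relabel method that
exchanges single jobs within a class, and so shifts at most `w` at a time, brings all the loads below
the upper bound of the path plus `w` (`wp_balance`, `balanceable_above`). With the sizes
complemented, it then brings them above the lower bound minus `w`, and no load rises above the larger
of its old value and the lower bound (`balanceable_below`). The error is at most `2 w ≤ ε pmax`.

The program is verified with a calculus of weakest preconditions (`WP`) that tells the bound `V` on
the stored values, which depends on the multiplicities, from the bound `N` on the number of rounds of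
a loop, which does not. The running time is polynomial in the number of codes, and the words are
polynomial in the number of codes and the input.
-/

/-! ### Verifying word-RAM programs -/

namespace WordRAM

instance : Add Term := ⟨Term.op .add⟩
instance : Sub Term := ⟨Term.op .sub⟩
instance : Mul Term := ⟨Term.op .mul⟩
instance : Div Term := ⟨Term.op .div⟩
instance (n : ℕ) : OfNat Term n := ⟨Term.const n⟩

infixr:30 ";;" => Program.seq
prefix:max "§" => Term.reg

section simpLemmas

variable (s : State) (e f : Term) (r x a b i v : ℕ)

@[simp] theorem Term.eval_add : (e + f).eval s = e.eval s + f.eval s := rfl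
@[simp] theorem Term.eval_sub : (e - f).eval s = e.eval s - f.eval s := rfl
@[simp] theorem Term.eval_mul : (e * f).eval s = e.eval s * f.eval s := rfl
@[simp] theorem Term.eval_div : (e / f).eval s = e.eval s / f.eval s := rfl
@[simp] theorem Term.eval_reg : (§r).eval s = s.reg r := rfl
@[simp] theorem Term.eval_get : (Term.get a e).eval s = s.arr a (e.eval s) := rfl
@[simp] theorem Term.eval_zero : (0 : Term).eval s = 0 := rfl
@[simp] theorem Term.eval_one : (1 : Term).eval s = 1 := rfl
@[simp] theorem State.setReg_reg : (s.setReg r v).reg x = if x = r then v else s.reg x := by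
  simp [State.setReg, Function.update_apply]
@[simp] theorem State.setReg_arr : (s.setReg r v).arr a = s.arr a := rfl
@[simp] theorem State.setCell_reg : (s.setCell a i v).reg x = s.reg x := rfl
@[simp] theorem State.setCell_arr :
    (s.setCell a i v).arr b = if b = a then Function.update (s.arr a) i v else s.arr b := by
  simp [State.setCell, Function.update_apply]

end simpLemmas

/-- An exponent such that every value in the evaluation of a term is at most `(V + 2) ^ deg`, if all
registers and cells hold at most `V`. -/
def Term.deg : Term → ℕ
  | const c => c + 1
  | reg _ => 1
  | get _ i => i.deg
  | op _ e f => e.deg + f.deg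

/-- The sum of the degrees of all the terms of a program. -/
def Program.deg : Program → ℕ
  | skip => 0
  | set _ e => e.deg
  | put _ i e => i.deg + e.deg
  | seq P Q => P.deg + Q.deg
  | ite e P Q => e.deg + P.deg + Q.deg
  | loop e P => e.deg + P.deg

/-- The number of steps that suffice if every loop is run through at most `N` times. -/
def Program.time (N : ℕ) : Program → ℕ
  | skip => 1
  | set _ e => e.cost + 1
  | put _ i e => i.cost + e.cost + 1
  | seq P Q => P.time N + Q.time N
  | ite e P Q => e.cost + 1 + (P.time N + Q.time N)
  | loop e P => (N + 1) * (e.cost + 1 + P.time N)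

/-- The registers that a program may write. -/
def Program.regs : Program → List ℕ
  | skip => []
  | set r _ => [r]
  | put _ _ _ => []
  | seq P Q => P.regs ++ Q.regs
  | ite _ P Q => P.regs ++ Q.regs
  | loop _ P => P.regs

/-- The arrays that a program may write. -/
def Program.arrs : Program → List ℕ
  | skip => []
  | set _ _ => []
  | put a _ _ => [a]
  | seq P Q => P.arrs ++ Q.arrs
  | ite _ P Q => P.arrs ++ Q.arrs
  | loop _ P => P.arrs

/-- Only the registers in `R` and the arrays in `A` differ. -/
structure Frame (R A : List ℕ) (s s' : State) : Prop where
  reg : ∀ r, r ∉ R → s'.reg r = s.reg r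
  arr : ∀ a, a ∉ A → s'.arr a = s.arr a

theorem Frame.refl (R A : List ℕ) (s : State) : Frame R A s s := ⟨fun _ _ => rfl, fun _ _ => rfl⟩

theorem Frame.trans {R A : List ℕ} {s s' s'' : State} (h : Frame R A s s') (h' : Frame R A s' s'') :
    Frame R A s s'' :=
  ⟨fun r hr => (h'.reg r hr).trans (h.reg r hr), fun a ha => (h'.arr a ha).trans (h.arr a ha)⟩

theorem Frame.mono {R A R' A' : List ℕ} {s s' : State} (h : Frame R A s s')
    (hR : R ⊆ R') (hA : A ⊆ A') : Frame R' A' s s' :=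
  ⟨fun r hr => h.reg r fun h => hr (hR h), fun a ha => h.arr a fun h => ha (hA h)⟩

theorem Frame.setReg {R A : List ℕ} {s s' : State} (h : Frame R A s s') {r v : ℕ}
    (hr : r ∈ R := by decide) : Frame R A s (s'.setReg r v) :=
  ⟨fun x hx => by rw [State.setReg_reg, if_neg (by rintro rfl; exact hx hr), h.reg x hx], h.arr⟩

theorem Exec.frame {W : ℕ} {P : Program} {s s' : State} {t : ℕ} (h : Exec W P s t s') :
    Frame P.regs P.arrs s s' := by
  induction h with
  | skip s => exact Frame.refl _ _ _
  | set s r e he =>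
    refine ⟨fun x hx => ?_, fun a _ => rfl⟩
    simp only [Program.regs, List.mem_singleton] at hx
    simp [hx]
  | put s a i e hi he =>
    refine ⟨fun _ _ => rfl, fun x hx => ?_⟩
    simp only [Program.arrs, List.mem_singleton] at hx
    simp [hx]
  | seq P Q s₁ s₂ s₃ t u hP hQ ihP ihQ =>
    exact (ihP.mono (List.subset_append_left _ _) (List.subset_append_left _ _)).trans
      (ihQ.mono (List.subset_append_right _ _) (List.subset_append_right _ _))
  | ite_true e P Q s s' t he h hP ih =>
    exact ih.mono (List.subset_append_left _ _) (List.subset_append_left _ _)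
  | ite_false e P Q s s' t he h hP ih =>
    exact ih.mono (List.subset_append_right _ _) (List.subset_append_right _ _)
  | loop_true e P s₁ s₂ s₃ t u he h hP hL ihP ihL => exact ihP.trans ihL
  | loop_false e P s he h => exact Frame.refl _ _ _

/-- No register and no cell holds more than `V`. -/
structure State.Bounded (V : ℕ) (s : State) : Prop where
  reg : ∀ r, s.reg r ≤ V
  arr : ∀ a i, s.arr a i ≤ V

theorem State.Bounded.setReg {V : ℕ} {s : State} (h : s.Bounded V) {r v : ℕ} (hv : v ≤ V) :
    (s.setReg r v).Bounded V := by
  refine ⟨fun x => ?_, h.arr⟩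
  rw [State.setReg_reg]
  split_ifs
  exacts [hv, h.reg x]

theorem State.Bounded.setCell {V : ℕ} {s : State} (h : s.Bounded V) {a i v : ℕ} (hv : v ≤ V) :
    (s.setCell a i v).Bounded V := by
  refine ⟨h.reg, fun b j => ?_⟩
  rw [State.setCell_arr]
  split_ifs
  · rw [Function.update_apply]
    split_ifs
    exacts [hv, h.arr a j]
  · exact h.arr b j

theorem Term.one_le_deg (e : Term) : 1 ≤ e.deg := by
  induction e with
  | const c => simp [deg]
  | reg r => simp [deg]
  | get a i ih => simpa [deg] using ih
  | op o e f ihe ihf => simp only [deg]; omega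

theorem add_le_pow_add {X a b x y : ℕ} (hX : 2 ≤ X) (ha : 1 ≤ a) (hb : 1 ≤ b)
    (hx : x ≤ X ^ a) (hy : y ≤ X ^ b) : x + y ≤ X ^ (a + b) := by
  have h1 : X ^ 1 ≤ X ^ a := Nat.pow_le_pow_right (by omega) ha
  have h2 : X ^ 1 ≤ X ^ b := Nat.pow_le_pow_right (by omega) hb
  rw [pow_add]
  nlinarith

theorem Term.eval_le {V : ℕ} {s : State} (h : s.Bounded V) (e : Term) :
    e.eval s ≤ (V + 2) ^ e.deg := by
  induction e with
  | const c =>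
    simp only [eval, deg]
    calc c ≤ 2 ^ c := Nat.lt_two_pow_self.le
      _ ≤ (V + 2) ^ c := Nat.pow_le_pow_left (by omega) c
      _ ≤ (V + 2) ^ (c + 1) := Nat.pow_le_pow_right (by omega) (by omega)
  | reg r => simpa [eval, deg] using (h.reg r).trans (by omega)
  | get a i ih =>
    calc s.arr a (i.eval s) ≤ V := h.arr _ _
      _ ≤ (V + 2) ^ 1 := by rw [pow_one]; omega
      _ ≤ (V + 2) ^ i.deg := Nat.pow_le_pow_right (by omega) i.one_le_deg
  | op o e f ihe ihf =>
    have key : (V + 2) ^ e.deg ≤ (V + 2) ^ (e.deg + f.deg) :=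
      Nat.pow_le_pow_right (by omega) (by omega)
    cases o with
    | add => exact add_le_pow_add (by omega) e.one_le_deg f.one_le_deg ihe ihf
    | sub => exact (Nat.sub_le _ _).trans (ihe.trans key)
    | mul => exact (Nat.mul_le_mul ihe ihf).trans (pow_add _ _ _).ge
    | div => exact (Nat.div_le_self _ _).trans (ihe.trans key)

theorem Term.fits_of_bounded {V W : ℕ} {s : State} (h : s.Bounded V) (e : Term)
    (hW : (V + 2) ^ e.deg ≤ W) : e.Fits W s := by
  induction e with
  | const c => exact (Term.eval_le h (const c)).trans hW
  | reg r => exact (Term.eval_le h (reg r)).trans hW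
  | get a i ih => exact ⟨ih hW, (Term.eval_le h (get a i)).trans hW⟩
  | op o e f ihe ihf =>
    refine ⟨ihe (le_trans ?_ hW), ihf (le_trans ?_ hW), (Term.eval_le h (op o e f)).trans hW⟩ <;>
    · simp only [deg]
      exact Nat.pow_le_pow_right (by omega) (by omega)

/-- Weakest precondition: if all values in `s` are at most `V`, then `P` halts, within the time for
loops of at most `N` rounds, with all values at most `V` again and in a state that satisfies `Q`;
only boundedly many powers of `V` occur on the way. -/
def WP (V N : ℕ) (P : Program) (Q : State → Prop) (s : State) : Prop :=
  N ≤ V → s.Bounded V → ∀ W, (V + 2) ^ P.deg ≤ W →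
    ∃ t s', Exec W P s t s' ∧ t ≤ P.time N ∧ s'.Bounded V ∧ Q s'

section rules

variable {V N : ℕ} {P P' : Program} {Q Q' : State → Prop} {s : State}

theorem WP.mono (h : WP V N P Q s) (hQ : ∀ s', Frame P.regs P.arrs s s' → Q s' → Q' s') :
    WP V N P Q' s := by
  intro hN hs W hW
  obtain ⟨t, s', h1, h2, h3, h4⟩ := h hN hs W hW
  exact ⟨t, s', h1, h2, h3, hQ s' h1.frame h4⟩

/-- The bounds may be used in the proof. -/
theorem WP.of_bounded (h : N ≤ V → s.Bounded V → WP V N P Q s) : WP V N P Q s :=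
  fun hN hs W hW => h hN hs hN hs W hW

theorem wp_skip (h : Q s) : WP V N .skip Q s :=
  fun _ hs _ _ => ⟨1, s, .skip s, le_rfl, hs, h⟩

theorem wp_set {r : ℕ} {e : Term} (hV : e.eval s ≤ V) (h : Q (s.setReg r (e.eval s))) :
    WP V N (.set r e) Q s :=
  fun _ hs _ hW => ⟨_, _, .set s r e (e.fits_of_bounded hs hW), le_rfl, hs.setReg hV, h⟩

theorem wp_put {a : ℕ} {i e : Term} (hV : e.eval s ≤ V)
    (h : Q (s.setCell a (i.eval s) (e.eval s))) : WP V N (.put a i e) Q s := by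
  intro _ hs W hW
  refine ⟨_, _, .put s a i e (i.fits_of_bounded hs (le_trans ?_ hW))
    (e.fits_of_bounded hs (le_trans ?_ hW)), le_rfl, hs.setCell hV, h⟩ <;>
  · simp only [Program.deg]
    exact Nat.pow_le_pow_right (by omega) (by omega)

/-- The second program may rely on what the first one cannot change. -/
theorem wp_seq (h : WP V N P (fun s' => Frame P.regs P.arrs s s' → WP V N P' Q s') s) :
    WP V N (P;;P') Q s := by
  intro hN hs W hW
  simp only [Program.deg] at hW
  obtain ⟨t, s', h1, h2, h3, h4⟩ := h hN hs W
    ((Nat.pow_le_pow_right (by omega) (by omega)).trans hW)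
  obtain ⟨t', s'', h1', h2', h3', h4'⟩ := h4 h1.frame hN h3 W
    ((Nat.pow_le_pow_right (by omega) (by omega)).trans hW)
  exact ⟨_, s'', .seq _ _ _ _ _ _ _ h1 h1', Nat.add_le_add h2 h2', h3', h4'⟩

theorem wp_seq_set {r : ℕ} {e : Term} (hV : e.eval s ≤ V)
    (h : WP V N P Q (s.setReg r (e.eval s))) : WP V N (.set r e;;P) Q s :=
  wp_seq (wp_set hV fun _ => h)

theorem wp_seq_set_eq {r : ℕ} {e : Term} (v : ℕ) (he : e.eval s = v) (hV : v ≤ V)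
    (h : WP V N P Q (s.setReg r v)) : WP V N (.set r e;;P) Q s :=
  wp_seq_set (he ▸ hV) (he ▸ h)

theorem wp_seq_put {a : ℕ} {i e : Term} (hV : e.eval s ≤ V)
    (h : WP V N P Q (s.setCell a (i.eval s) (e.eval s))) : WP V N (.put a i e;;P) Q s :=
  wp_seq (wp_put hV fun _ => h)

theorem wp_ite {e : Term} (h1 : e.eval s ≠ 0 → WP V N P Q s) (h2 : e.eval s = 0 → WP V N P' Q s) :
    WP V N (.ite e P P') Q s := by
  intro hN hs W hW
  simp only [Program.deg] at hW
  have he : e.Fits W s := e.fits_of_bounded hs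
    ((Nat.pow_le_pow_right (by omega) (by omega)).trans hW)
  by_cases h : e.eval s = 0
  · obtain ⟨t, s', h1, h2, h3, h4⟩ := h2 h hN hs W
      ((Nat.pow_le_pow_right (by omega) (by omega)).trans hW)
    exact ⟨_, s', .ite_false _ _ _ _ _ _ he h h1, by simp only [Program.time]; omega, h3, h4⟩
  · obtain ⟨t, s', h1, h2, h3, h4⟩ := h1 h hN hs W
      ((Nat.pow_le_pow_right (by omega) (by omega)).trans hW)
    exact ⟨_, s', .ite_true _ _ _ _ _ _ he h h1, by simp only [Program.time]; omega, h3, h4⟩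

end rules

/-- Run `P` for `r = 0, 1, …, e - 1`. -/
def Program.forLoop (r : ℕ) (e : Term) (P : Program) : Program :=
  .set r 0;;.loop (e - §r) (P;;.set r (§r + 1))

/-- The rule for counting loops, with an invariant `I k` that holds before round `k`. -/
theorem wp_for {V N : ℕ} {P : Program} {Q : State → Prop} {s : State} {r : ℕ} {e : Term}
    (n : ℕ) (I : ℕ → State → Prop) (hn : n ≤ N)
    (hr : r ∉ P.regs)
    (he : ∀ s', Frame (r :: P.regs) P.arrs s s' → e.eval s' = n)
    (h0 : I 0 (s.setReg r 0))
    (hstep : ∀ k s', k < n → Frame (r :: P.regs) P.arrs s s' → s'.reg r = k → I k s' →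
      WP V N P (fun s'' => s''.reg r = k → I (k + 1) (s''.setReg r (k + 1))) s')
    (hpost : ∀ s', Frame (r :: P.regs) P.arrs s s' → s'.reg r = n → I n s' → Q s') :
    WP V N (Program.forLoop r e P) Q s := by
  refine wp_seq_set (Nat.zero_le _) ?_
  simp only [Term.eval_zero]
  intro hN hs W hW
  simp only [Program.deg] at hW
  have hmono : ∀ {a b : ℕ}, a ≤ b → (V + 2) ^ a ≤ (V + 2) ^ b :=
    fun h => Nat.pow_le_pow_right (by omega) h
  set A := (e - §r).cost + 1 with hA
  -- Induction on the number of the rounds that are left.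
  have key : ∀ j k s', k + j = n → Frame (r :: P.regs) P.arrs s s' → s'.reg r = k → I k s' →
      s'.Bounded V → ∃ t s'', Exec W (.loop (e - §r) (P;;.set r (§r + 1))) s' t s'' ∧
        t ≤ (j + 1) * (A + (P;;.set r (§r + 1)).time N) ∧ s''.Bounded V ∧ Q s'' := by
    intro j
    induction j with
    | zero =>
      intro k s' hk hF hrk hI hb
      have hz : (e - §r).eval s' = 0 := by simp [he s' hF, hrk]; omega
      exact ⟨_, s', .loop_false _ _ _ (Term.fits_of_bounded hb _ ((hmono (by omega)).trans hW)) hz,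
        by simp only [← hA]; omega, hb, hpost s' hF (by omega) (by have : k = n := by omega
                                                                   exact this ▸ hI)⟩
    | succ j ih =>
      intro k s' hk hF hrk hI hb
      have hz : (e - §r).eval s' ≠ 0 := by simp [he s' hF, hrk]; omega
      have hbody : WP V N (P;;.set r (§r + 1))
          (fun s'' => s''.reg r = k + 1 ∧ I (k + 1) s'' ∧
            Frame (r :: P.regs) P.arrs s s'') s' := by
        refine wp_seq ((hstep k s' (by omega) hF hrk hI).mono fun s'' hF' hI' _ => ?_)
        have hrk' : s''.reg r = k := (hF'.reg r hr).trans hrk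
        refine wp_set (by simp [hrk']; omega) ?_
        simp only [Term.eval_add, Term.eval_reg, Term.eval_one, hrk']
        refine ⟨by simp, hI' hrk', (hF.trans (hF'.mono (List.subset_cons_self _ _)
          (List.Subset.refl _))).trans ⟨fun x hx => ?_, fun _ _ => rfl⟩⟩
        rw [List.mem_cons, not_or] at hx
        simp [hx.1]
      obtain ⟨t, s'', h1, h2, h3, h4, h5, h6⟩ := hbody hN hb W ((hmono (by
        simp only [Program.deg]; omega)).trans hW)
      obtain ⟨u, s₃, h1', h2', h3', h4'⟩ := ih (k + 1) s'' (by omega) h6 h4 h5 h3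
      refine ⟨_, s₃, .loop_true _ _ _ _ _ _ _
        (Term.fits_of_bounded hb _ ((hmono (by omega)).trans hW)) hz h1 h1', ?_, h3', h4'⟩
      rw [← hA]
      nlinarith
  have hF0 : Frame (r :: P.regs) P.arrs s (s.setReg r 0) := by
    refine ⟨fun x hx => ?_, fun _ _ => rfl⟩
    rw [List.mem_cons, not_or] at hx
    simp [hx.1]
  obtain ⟨t, s', h1, h2, h3, h4⟩ := key n 0 (s.setReg r 0) (by omega) hF0 (by simp) h0 hs
  refine ⟨t, s', h1, h2.trans ?_, h3, h4⟩
  simp only [Program.time, ← hA]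
  exact Nat.mul_le_mul_right _ (by omega)

/-- The time bound of a program is a polynomial in the bound on the number of rounds. -/
theorem Program.exists_time_le (P : Program) : ∃ C, ∀ N, P.time N ≤ C * (N + 1) ^ C := by
  have weaken : ∀ {C C' N : ℕ}, C ≤ C' → C * (N + 1) ^ C ≤ C' * (N + 1) ^ C' := fun h =>
    Nat.mul_le_mul h (Nat.pow_le_pow_right (by omega) h)
  have one_le : ∀ {C N : ℕ}, C ≤ C * (N + 1) ^ C := fun {C N} =>
    Nat.le_mul_of_pos_right C (by positivity)
  have add : ∀ {C C' N : ℕ}, C * (N + 1) ^ C + C' * (N + 1) ^ C' ≤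
      (C + C') * (N + 1) ^ (C + C') := by
    intro C C' N
    rw [add_mul]
    exact Nat.add_le_add (Nat.mul_le_mul_left _ (Nat.pow_le_pow_right (by omega) (by omega)))
      (Nat.mul_le_mul_left _ (Nat.pow_le_pow_right (by omega) (by omega)))
  induction P with
  | skip => exact ⟨1, fun N => one_le⟩
  | set r e => exact ⟨_, fun N => one_le⟩
  | put a i e => exact ⟨_, fun N => one_le⟩
  | seq P Q ihP ihQ =>
    obtain ⟨C, hC⟩ := ihP
    obtain ⟨C', hC'⟩ := ihQ
    exact ⟨C + C', fun N => (Nat.add_le_add (hC N) (hC' N)).trans add⟩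
  | ite e P Q ihP ihQ =>
    obtain ⟨C, hC⟩ := ihP
    obtain ⟨C', hC'⟩ := ihQ
    exact ⟨(e.cost + 1) + (C + C'), fun N => (Nat.add_le_add one_le
      ((Nat.add_le_add (hC N) (hC' N)).trans add)).trans add⟩
  | loop e P ih =>
    obtain ⟨C, hC⟩ := ih
    refine ⟨e.cost + 1 + C + 1, fun N => ?_⟩
    simp only [Program.time]
    calc (N + 1) * (e.cost + 1 + P.time N)
        ≤ (N + 1) * ((e.cost + 1 + C) * (N + 1) ^ (e.cost + 1 + C)) :=
          Nat.mul_le_mul_left _ ((Nat.add_le_add one_le (hC N)).trans add)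
      _ = (e.cost + 1 + C) * (N + 1) ^ (e.cost + 1 + C + 1) := by ring
      _ ≤ _ := Nat.mul_le_mul_right _ (by omega)

end WordRAM

/-! ### The program -/

namespace WordRAM

/-- A term for the remainder of a division. -/
def Term.mod (e f : Term) : Term := e - e / f * f

/-- A term that is zero if and only if `e` and `f` have the same value. -/
def Term.ne (e f : Term) : Term := (e - f) + (f - e)

@[simp] theorem Term.eval_mod (s : State) (e f : Term) :
    (e.mod f).eval s = e.eval s % f.eval s := by
  simp only [Term.mod, Term.eval_sub, Term.eval_mul, Term.eval_div]
  have := Nat.div_add_mod' (e.eval s) (f.eval s)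
  omega

@[simp] theorem Term.eval_ne (s : State) (e f : Term) :
    (e.ne f).eval s = (e.eval s - f.eval s) + (f.eval s - e.eval s) := rfl

end WordRAM

namespace Scheduling

open WordRAM

/-! The registers hold:
* the number of types, the number of machines, and numerator and denominator of `ε` (`rD`, `rM`,
  `rNum`, `rDen`);
* the largest processing time, the width `w` of the classes, the number of the classes, the distance
  between a nearly uniform schedule and the fixed jobs, the scale of loads, the base of the codes, and
  the number of codes (`rPmax`, `rWidth`, `rK`, `rDist`, `rQ`, `rB`, `rS`);
* loop counters for machines, types, classes or pairs, rounds, and thresholds (`ixI`, `ixJ`, `ixK`,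
  `ixT`, `ixTheta`);
* two codes, a flag for their test, and an accumulator (`rOld`, `rNew`, `rBad`, `rAcc`);
* what is left of two codes, and the old and new digits of a class (`rX`, `rY`, `rC`, `rCn`, `rSg`,
  `rSgn`, `rV`, `rVn`); in balancing, `rX` and `rY` hold types;
* a sum over types, the best code, its value, the threshold for loads, a flag for a successful
  exchange, and the machine that receives load (`rSum`, `rBest`, `rVal`, `rThr`, `rFound`, `rTo`).

The arrays hold processing times, multiplicities, numbers of jobs of the machines, numbers of fixed
and of remaining jobs, the table of codes, and loads, sizes and labels for balancing. -/

notation "rD" => (0 : ℕ)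
notation "rM" => (1 : ℕ)
notation "rNum" => (2 : ℕ)
notation "rDen" => (3 : ℕ)
notation "rPmax" => (4 : ℕ)
notation "rWidth" => (5 : ℕ)
notation "rK" => (6 : ℕ)
notation "rDist" => (7 : ℕ)
notation "rQ" => (8 : ℕ)
notation "rB" => (9 : ℕ)
notation "rS" => (10 : ℕ)
notation "ixI" => (11 : ℕ)
notation "ixJ" => (12 : ℕ)
notation "ixK" => (13 : ℕ)
notation "ixT" => (14 : ℕ)
notation "ixTheta" => (15 : ℕ)
notation "rOld" => (16 : ℕ)
notation "rNew" => (17 : ℕ)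
notation "rBad" => (18 : ℕ)
notation "rAcc" => (19 : ℕ)
notation "rX" => (20 : ℕ)
notation "rY" => (21 : ℕ)
notation "rC" => (22 : ℕ)
notation "rCn" => (23 : ℕ)
notation "rSg" => (24 : ℕ)
notation "rSgn" => (25 : ℕ)
notation "rV" => (26 : ℕ)
notation "rVn" => (27 : ℕ)
notation "rSum" => (28 : ℕ)
notation "rBest" => (29 : ℕ)
notation "rVal" => (30 : ℕ)
notation "rThr" => (31 : ℕ)
notation "rFound" => (32 : ℕ)
notation "rTo" => (33 : ℕ)
notation "aP" => (0 : ℕ)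
notation "aN" => (1 : ℕ)
notation "aX" => (2 : ℕ)
notation "aBase" => (3 : ℕ)
notation "aCnt" => (4 : ℕ)
notation "aTab" => (5 : ℕ)
notation "aLoad" => (6 : ℕ)
notation "aSize" => (7 : ℕ)
notation "aLabel" => (8 : ℕ)

/-- The class of the type `j`. -/
def clsT (j : Term) : Term := .get aP j / (§rWidth + 1)

/-- Set the flag `rBad` if `e` is not zero. -/
def flag (e : Term) : Program := .ite e (.set rBad 1) .skip

/-- Move the last digit of the register `x` to the register `r`. -/
def popDigit (r x : ℕ) : Program := .set r ((§x).mod (§rB));; .set x (§x / §rB)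

/-- Put the sum of `e` over the types `ixJ` of the class `ixK` into `rSum`. -/
def classSum (e : Term) : Program :=
  .set rSum 0;;
  .forLoop ixJ (§rD) (.ite ((clsT (§ixJ)).ne (§ixK)) .skip (.set rSum (§rSum + e)))

/-- The largest processing time, the parameters and the reduced multiplicities. -/
def setup : Program :=
  .set rPmax 0;;
  .forLoop ixJ (§rD) (.ite (.get aP (§ixJ) - §rPmax) (.set rPmax (.get aP (§ixJ))) .skip);;
  .set rWidth (§rNum * §rPmax / (2 * §rDen));;
  .set rK (§rPmax / (§rWidth + 1) + 1);;
  .set rDist (§rPmax * §rPmax);;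
  .forLoop ixJ (§rD) (
    .put aBase (§ixJ) (.get aN (§ixJ) / §rM - §rDist);;
    .put aCnt (§ixJ) (.get aN (§ixJ) - §rM * .get aBase (§ixJ)));;
  .set rQ (§rPmax * §rM * (§rDist + 1) + 1);;
  .set rB (§rQ * §rQ * §rPmax + 1);;
  .set rS (§rB * §rB);;
  .forLoop ixK (3 * §rK) (.set rS (§rS * §rB))

/-- Set `rBad` to 0 or 1, according to whether the codes in `rOld` and `rNew` are consecutive. -/
def checkStep : Program :=
  .set rBad 0;;
  .set rAcc 0;;
  .set rX (§rOld / (§rB * §rB));;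
  .set rY (§rNew / (§rB * §rB));;
  flag ((§rOld).mod (§rB * §rB) |>.ne ((§rNew).mod (§rB * §rB)));;
  .forLoop ixK (§rK) (
    popDigit rC rX;;
    popDigit rSg rX;;
    popDigit rV rX;;
    popDigit rCn rY;;
    popDigit rSgn rY;;
    popDigit rVn rY;;
    flag ((§rC - §rCn) + (§rV - §rVn) + (§rSgn).ne (§rSg + (§rCn - §rC) * §rVn));;
    .set rAcc (§rAcc + (§rSgn - §rSg));;
    .forLoop ixTheta (§rPmax + 1) (
      classSum (.get aCnt (§ixJ) * (§ixTheta - .get aP (§ixJ)));;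
      flag (§rQ * §ixTheta * §rCn - (§rSgn + §rQ * §rSum))));;
  flag ((§rQ * (§rNew).mod (§rB) - §rAcc) +
    (§rAcc + 1 - §rQ * ((§rNew / §rB).mod (§rB) + 1)))

/-- The table of the codes that can be reached by each number of machines; a nonzero entry is the
successor of the preceding code. -/
def fillTable : Program :=
  .forLoop rOld (§rB * §rB) (.put aTab (§rOld) 1);;
  .forLoop ixT (§rM) (.forLoop rOld (§rS) (.ite (.get aTab (§ixT * §rS + §rOld))
    (.forLoop rNew (§rS) (checkStep;;
      .ite (§rBad) .skip (.put aTab ((§ixT + 1) * §rS + §rNew) (§rOld + 1)))) .skip))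

/-- Set `rBad` to 0 or 1, according to whether the code in `rOld` distributes all the jobs. -/
def checkFinal : Program :=
  .set rBad 0;;
  .set rAcc 0;;
  .set rX (§rOld / (§rB * §rB));;
  .forLoop ixK (§rK) (
    popDigit rC rX;;
    popDigit rSg rX;; popDigit rV rX;;
    classSum (.get aCnt (§ixJ));;
    flag ((§rC).ne (§rSum));;
    .set rAcc (§rAcc + §rSg));;
  .set rSum 0;;
  .forLoop ixJ (§rD) (.set rSum (§rSum + .get aCnt (§ixJ) * .get aP (§ixJ)));;
  flag (§rAcc + 1 - §rQ * (§rSum + 1))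

/-- What a code in `rOld` is worth; less is better. -/
def valT : Objective → Term
  | .cmax => (§rOld / §rB).mod (§rB)
  | .cmin => §rB - (§rOld).mod (§rB)
  | .cenvy => (§rOld / §rB).mod (§rB) - (§rOld).mod (§rB)

/-- Put the best final code into `rBest`. -/
def choose (obj : Objective) : Program :=
  .set rBest 0;;
  .set rVal (§rB + 1);;
  .forLoop rOld (§rS) (.ite (.get aTab (§rM * §rS + §rOld)) (checkFinal;;
    .ite (§rBad) .skip (.ite (§rVal - valT obj) (.set rVal (valT obj);; .set rBest (§rOld)) .skip))
    .skip)

/-- The number of jobs of type `ixJ` among the first `c` jobs of its class, if the jobs of the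
preceding types of the class number `rSum`. -/
def partT (c : Term) : Term := (c - §rSum) - (c - §rSum - .get aCnt (§ixJ))

/-- Follow the table back from `rBest` and give every machine its numbers of jobs of the classes. -/
def assign : Program :=
  .set rNew (§rBest);;
  .forLoop ixT (§rM) (
    .set ixI (§rM - 1 - §ixT);;
    .set rOld (.get aTab ((§ixI + 1) * §rS + §rNew) - 1);;
    .set rX (§rOld / (§rB * §rB));;
    .set rY (§rNew / (§rB * §rB));;
    .forLoop ixK (§rK) (
      .set rC ((§rX).mod (§rB));; .set rX (§rX / (§rB * §rB * §rB));;
      .set rCn ((§rY).mod (§rB));; .set rY (§rY / (§rB * §rB * §rB));;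
      .set rSum 0;;
      .forLoop ixJ (§rD) (.ite ((clsT (§ixJ)).ne (§ixK)) .skip
        (.put aX (§ixI * §rD + §ixJ) (partT (§rCn) - partT (§rC));;
         .set rSum (§rSum + .get aCnt (§ixJ)))));;
    .set rNew (§rOld))

/-- Exchange a job of type `rX` on machine `ixI` for one of type `rY` on machine `rTo`. -/
def swap : Program :=
  .put aX (§ixI * §rD + §rX) (.get aX (§ixI * §rD + §rX) - 1);;
  .put aX (§rTo * §rD + §rX) (.get aX (§rTo * §rD + §rX) + 1);;
  .put aX (§ixI * §rD + §rY) (.get aX (§ixI * §rD + §rY) + 1);;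
  .put aX (§rTo * §rD + §rY) (.get aX (§rTo * §rD + §rY) - 1);;
  .put aLoad (§ixI) (.get aLoad (§ixI) - (.get aSize (§rX) - .get aSize (§rY)));;
  .put aLoad (§rTo) (.get aLoad (§rTo) + (.get aSize (§rX) - .get aSize (§rY)))

/-- One push or one relabelling of the machine `ixI`, if it is active. -/
def pushOrRelabel : Program :=
  .ite (§rThr + §rWidth - .get aLoad (§ixI)) .skip (
    .set rFound 0;;
    .forLoop ixK (§rM * §rD * §rD) (.ite (§rFound) .skip (
      .set rTo (§ixK / §rD / §rD);;
      .set rX ((§ixK / §rD).mod (§rD));;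
      .set rY ((§ixK).mod (§rD));;
      .ite ((Term.get aLabel (§ixI)).ne (.get aLabel (§rTo) + 1) + (clsT (§rX)).ne (clsT (§rY)) +
          (.get aSize (§rY) + 1 - .get aSize (§rX)) + (1 - .get aX (§ixI * §rD + §rX)) +
          (1 - .get aX (§rTo * §rD + §rY)))
        .skip (swap;; .set rFound 1)));;
    .ite (§rFound) .skip (.put aLabel (§ixI) (.get aLabel (§ixI) + 1)))

/-- Shift load from the machines above the threshold `rThr` to the others. -/
def balance : Program :=
  .forLoop ixT ((§rM * §rQ * §rPmax + 1) * §rM * §rM) (.forLoop ixI (§rM) pushOrRelabel)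

/-- The loads, and the labels and sizes for balancing from above. -/
def prepareAbove : Program :=
  .forLoop ixI (§rM) (
    .set rAcc 0;;
    .forLoop ixJ (§rD) (.set rAcc (§rAcc + .get aX (§ixI * §rD + §ixJ) * .get aP (§ixJ)));;
    .put aLoad (§ixI) (§rAcc);;
    .put aLabel (§ixI) 0);;
  .forLoop ixJ (§rD) (.put aSize (§ixJ) (.get aP (§ixJ)));;
  .set rThr ((§rBest / §rB).mod (§rB) + 1)

/-- The complemented loads and sizes for balancing from below. -/
def prepareBelow : Program :=
  .forLoop ixI (§rM) (
    .put aLoad (§ixI) (§rQ * §rPmax - .get aLoad (§ixI));;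
    .put aLabel (§ixI) 0);;
  .forLoop ixJ (§rD) (.put aSize (§ixJ) (§rPmax - .get aP (§ixJ)));;
  .set rThr (§rQ * §rPmax + 1 - (§rBest).mod (§rB))

/-- Add the jobs that were set aside. -/
def addBase : Program :=
  .forLoop ixK (§rM * §rD) (.put aX (§ixK) (.get aX (§ixK) + .get aBase ((§ixK).mod (§rD))))

/-- The program that solves the load balancing problem. -/
def solve (obj : Objective) : Program :=
  setup;; fillTable;; choose obj;; assign;; prepareAbove;; balance;; prepareBelow;; balance;; addBase

end Scheduling

namespace Scheduling

open WordRAM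

/-! ### Codes and their steps -/

/-- The numbers that the program works with once it has set up its parameters. -/
structure Params where
  /-- The number of types. -/
  d : ℕ
  /-- The number of machines. -/
  m : ℕ
  /-- The largest processing time. -/
  pm : ℕ
  /-- The largest difference of processing times in a class. -/
  w : ℕ
  /-- The number of classes. -/
  K : ℕ
  /-- The scale of loads and averages, more than the number of jobs to be distributed. -/
  Q : ℕ
  /-- The base of the codes. -/
  B : ℕ
  /-- The processing times. -/
  p : ℕ → ℕ
  /-- The numbers of jobs to be distributed. -/
  cnt : ℕ → ℕ
  /-- The numbers of jobs that are fixed on every machine. -/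
  base : ℕ → ℕ

namespace Params

variable (G : Params)

/-- The number of codes. -/
def S : ℕ := G.B ^ (3 * G.K + 2)

/-- The class of a type. -/
def cls (j : ℕ) : ℕ := G.p j / (G.w + 1)

/-- `∑ n_j (θ - p_j)⁺` over the types `j` of the class `k`. -/
def deficit (k θ : ℕ) : ℕ :=
  ∑ j ∈ Finset.range G.d, if G.cls j = k then G.cnt j * (θ - G.p j) else 0

/-- The number of jobs of the class `k`. -/
def size (k : ℕ) : ℕ := ∑ j ∈ Finset.range G.d, if G.cls j = k then G.cnt j else 0

/-- The total processing time. -/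
def work : ℕ := ∑ j ∈ Finset.range G.d, G.cnt j * G.p j

/-- The first digit of a code, a lower bound for the loads. -/
def lo (a : ℕ) : ℕ := a % G.B

/-- The second digit of a code, an upper bound for the loads. -/
def up (a : ℕ) : ℕ := a / G.B % G.B

/-- The number of jobs of class `k` on the machines so far. -/
def num (a k : ℕ) : ℕ := a / (G.B * G.B) / (G.B * G.B * G.B) ^ k % G.B

/-- The load by jobs of class `k` on the machines so far, scaled by `Q`. -/
def sum (a k : ℕ) : ℕ := a / (G.B * G.B) / (G.B * G.B * G.B) ^ k / G.B % G.B

/-- The average processing time of the jobs of class `k` on the last machine, scaled by `Q`. -/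
def slope (a k : ℕ) : ℕ := a / (G.B * G.B) / (G.B * G.B * G.B) ^ k / G.B / G.B % G.B

/-- The conditions on the class `k` for `b` to follow `a`. The last one says, with the best `θ`, that
the smallest `num b k` jobs of the class have total processing time at most `sum b k / Q`. -/
structure StepClass (a b k : ℕ) : Prop where
  num : G.num a k ≤ G.num b k
  slope : G.slope a k ≤ G.slope b k
  sum : G.sum b k = G.sum a k + (G.num b k - G.num a k) * G.slope b k
  major : ∀ θ < G.pm + 1, G.Q * θ * G.num b k ≤ G.sum b k + G.Q * G.deficit k θ

/-- The code `b` can follow `a`, with one more machine whose load is within the bounds. -/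
structure Step (a b : ℕ) : Prop where
  bounds : a % (G.B * G.B) = b % (G.B * G.B)
  cls : ∀ k < G.K, G.StepClass a b k
  lower : G.Q * G.lo b ≤ ∑ k ∈ Finset.range G.K, (G.sum b k - G.sum a k)
  upper : ∑ k ∈ Finset.range G.K, (G.sum b k - G.sum a k) < G.Q * (G.up b + 1)

/-- The code distributes all the jobs. -/
structure Final (a : ℕ) : Prop where
  num : ∀ k < G.K, G.num a k = G.size k
  sum : ∑ k ∈ Finset.range G.K, G.sum a k < G.Q * (G.work + 1)

/-- The relations between the parameters that the analysis needs. -/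
structure Good : Prop where
  d_pos : 0 < G.d
  m_pos : 0 < G.m
  d_le : G.d ≤ G.pm
  p_pos : ∀ j < G.d, 0 < G.p j
  p_le : ∀ j < G.d, G.p j ≤ G.pm
  K_eq : G.K = G.pm / (G.w + 1) + 1
  B_eq : G.B = G.Q * G.Q * G.pm + 1
  lt_Q : G.pm * G.m < G.Q
  cnt_lt : ∑ j ∈ Finset.range G.d, G.cnt j < G.Q

end Params

/-- The state holds the parameters. -/
structure Env (G : Params) (s : State) : Prop where
  d : s.reg rD = G.d
  m : s.reg rM = G.m
  pm : s.reg rPmax = G.pm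
  w : s.reg rWidth = G.w
  K : s.reg rK = G.K
  Q : s.reg rQ = G.Q
  B : s.reg rB = G.B
  S : s.reg rS = G.S
  p : ∀ j < G.d, s.arr aP j = G.p j
  cnt : ∀ j < G.d, s.arr aCnt j = G.cnt j
  base : ∀ j < G.d, s.arr aBase j = G.base j

theorem Env.frame {G : Params} {R A : List ℕ} {s s' : State} (h : Env G s) (hF : Frame R A s s')
    (hR : ∀ r ∈ [rD, rM, rPmax, rWidth, rK, rQ, rB, rS], r ∉ R := by decide)
    (hA : ∀ a ∈ [aP, aCnt, aBase], a ∉ A := by decide) : Env G s' := by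
  simp only [List.mem_cons, List.not_mem_nil, or_false, forall_eq_or_imp, forall_eq] at hR hA
  obtain ⟨h0, h1, h2, h3, h4, h5, h6, h7⟩ := hR
  obtain ⟨a0, a1, a2⟩ := hA
  constructor <;> simp only [hF.reg _ h0, hF.reg _ h1, hF.reg _ h2, hF.reg _ h3, hF.reg _ h4,
    hF.reg _ h5, hF.reg _ h6, hF.reg _ h7, hF.arr _ a0, hF.arr _ a1, hF.arr _ a2]
  exacts [h.d, h.m, h.pm, h.w, h.K, h.Q, h.B, h.S, h.p, h.cnt, h.base]

theorem wp_flag {V N : ℕ} {Q : State → Prop} {s : State} {e : Term} (hV : 1 ≤ V)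
    (h : ∀ s', Frame [rBad] [] s s' → s'.reg rBad = (if e.eval s = 0 then s.reg rBad else 1) →
      Q s') : WP V N (flag e) Q s := by
  refine wp_ite (fun he => wp_set hV (h _ ⟨fun x hx => ?_, fun _ _ => rfl⟩ ?_))
    (fun he => wp_skip (h _ (Frame.refl _ _ _) ?_))
  · rw [List.mem_singleton] at hx
    simp [hx]
  · simp [he]
  · simp [he]

theorem Env.eval_clsT {G : Params} {s : State} (hE : Env G s) {e : Term} (he : e.eval s < G.d) :
    (clsT e).eval s = G.cls (e.eval s) := by
  simp [clsT, hE.w, hE.p _ he, Params.cls]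

theorem sub_add_sub_eq_zero {x y : ℕ} : (x - y) + (y - x) = 0 ↔ x = y := by omega

theorem wp_classSum {V N : ℕ} {G : Params} {s : State} (hE : Env G s) (hd : G.d ≤ N) {e : Term}
    (F : ℕ → ℕ) (k : ℕ) (hk : s.reg ixK = k)
    (he : ∀ s', Frame [ixJ, rSum] [] s s' → s'.reg ixJ < G.d → e.eval s' = F (s'.reg ixJ))
    (hV : ∑ j ∈ Finset.range G.d, (if G.cls j = k then F j else 0) ≤ V) :
    WP V N (classSum e)
      (fun s' => s'.reg rSum = ∑ j ∈ Finset.range G.d, if G.cls j = k then F j else 0) s := by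
  refine wp_seq_set (Nat.zero_le _) ?_
  set s₁ := s.setReg rSum ((0 : Term).eval s) with hs₁
  have hF₁ : Frame [ixJ, rSum] [] s s₁ := ⟨fun x hx => by
    simp only [List.mem_cons, List.not_mem_nil, or_false, not_or] at hx
    simp [hs₁, hx], fun _ _ => rfl⟩
  refine wp_for G.d (fun j s' => s'.reg rSum =
      ∑ j ∈ Finset.range j, if G.cls j = k then F j else 0) hd (show ixJ ∉ [rSum] by decide)
    (fun s' hF => ?_) (by simp [hs₁]) (fun j s' hj hF hj' hI => ?_) (fun s' hF hr hI => hI)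
  · exact (hE.frame (hF₁.trans hF)).d
  · have hF' : Frame [ixJ, rSum] [] s s' := hF₁.trans hF
    have hE' := hE.frame hF'
    have hc : (clsT (§ixJ)).eval s' = G.cls j := by
      rw [hE'.eval_clsT (by simpa [hj'] using hj)]
      simp [hj']
    have hk' : s'.reg ixK = k := by rw [hF'.reg _ (by decide), hk]
    refine wp_ite (fun h => wp_skip fun _ => ?_) (fun h => wp_set ?_ fun _ => ?_)
    · rw [Term.eval_ne, hc, Term.eval_reg, hk', Ne, sub_add_sub_eq_zero] at h
      simp [hI, Finset.sum_range_succ, h]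
    all_goals rw [Term.eval_ne, hc, Term.eval_reg, hk', sub_add_sub_eq_zero] at h
    all_goals simp only [Term.eval_add, Term.eval_reg, hI, he s' hF' (by omega), hj']
    · refine le_trans (le_of_eq ?_) ((Finset.sum_le_sum_of_subset
        (Finset.range_mono (Nat.succ_le_of_lt hj))).trans hV)
      rw [Finset.sum_range_succ, if_pos h]
    · rw [Finset.sum_range_succ, if_pos h]
      simp

namespace Params

variable {G : Params}

namespace Good

variable (hG : G.Good)
include hG

theorem pm_pos : 0 < G.pm := hG.d_pos.trans_le hG.d_le

theorem m_lt : G.m < G.Q := (Nat.le_mul_of_pos_left _ hG.pm_pos).trans_lt hG.lt_Q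

theorem pm_lt : G.pm < G.Q := (Nat.le_mul_of_pos_right _ hG.m_pos).trans_lt hG.lt_Q

theorem Q_mul_Q_le : G.Q * G.Q ≤ G.Q * G.Q * G.pm := Nat.le_mul_of_pos_right _ hG.pm_pos

theorem Q_mul_Q_lt : G.Q * G.Q < G.B := by have := hG.Q_mul_Q_le; rw [hG.B_eq]; omega

theorem Q_le_mul : G.Q ≤ G.Q * G.Q := Nat.le_mul_of_pos_left _ (by have := hG.m_lt; omega)

theorem Q_lt : G.Q < G.B := hG.Q_le_mul.trans_lt hG.Q_mul_Q_lt

theorem B_pos : 0 < G.B := by have := hG.Q_lt; omega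

theorem K_le : G.K ≤ G.pm + 1 := by
  rw [hG.K_eq]
  exact Nat.succ_le_succ (Nat.div_le_self _ _)

theorem K_pos : 0 < G.K := by rw [hG.K_eq]; exact Nat.succ_pos _

theorem pow_le {n : ℕ} (hn : n ≤ 5) : G.B ^ n ≤ G.S :=
  Nat.pow_le_pow_right hG.B_pos (by have := hG.K_pos; omega)

theorem B_le : G.B ≤ G.S := by simpa using hG.pow_le (n := 1) (by omega)

theorem BB_le : G.B * G.B ≤ G.S := by simpa [pow_two] using hG.pow_le (n := 2) (by omega)

theorem KB_le : G.K * G.B ≤ G.S :=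
  (Nat.mul_le_mul_right _ (by have := hG.K_le; have := hG.pm_lt; have := hG.Q_lt; omega)).trans
    hG.BB_le

theorem deficit_le {k θ : ℕ} (hθ : θ < G.pm + 1) : G.deficit k θ ≤ G.S := by
  calc G.deficit k θ ≤ ∑ j ∈ Finset.range G.d, G.cnt j * G.pm := by
        refine Finset.sum_le_sum fun j _ => ?_
        split_ifs
        · exact Nat.mul_le_mul_left _ (by omega)
        · exact Nat.zero_le _
    _ = (∑ j ∈ Finset.range G.d, G.cnt j) * G.pm := by rw [Finset.sum_mul]
    _ ≤ G.Q * G.Q := Nat.mul_le_mul hG.cnt_lt.le hG.pm_lt.le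
    _ ≤ G.S := hG.Q_mul_Q_lt.le.trans hG.B_le

end Good

end Params

theorem wp_popDigit {V N B : ℕ} {P : Program} {Q : State → Prop} {s : State} {r x : ℕ}
    (hB : s.reg rB = B) (h : r ∉ [x, rB])
    (hQ : WP V N P Q ((s.setReg r (s.reg x % B)).setReg x (s.reg x / B))) :
    WP V N (popDigit r x;;P) Q s := by
  simp only [List.mem_cons, List.not_mem_nil, or_false, not_or] at h
  refine .of_bounded fun _ hb => wp_seq ?_
  refine wp_seq_set_eq (s.reg x % B) (by simp [hB]) ((Nat.mod_le _ _).trans (hb.reg x)) ?_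
  refine wp_set ?_ fun _ => ?_
  all_goals simp [Ne.symm h.1, Ne.symm h.2, hB]
  · exact (Nat.div_le_self _ _).trans (hb.reg x)
  · exact hQ

theorem wp_checkStep {V N : ℕ} {G : Params} {s : State} (hE : Env G s) (hG : G.Good)
    (hN : G.S ≤ N) : WP V N checkStep
      (fun s' => s'.reg rBad = 0 ↔ G.Step (s.reg rOld) (s.reg rNew)) s := by
  refine .of_bounded fun hNV hb => ?_
  have hSV : G.S ≤ V := hN.trans hNV
  have hV1 : 1 ≤ V := hG.B_pos.trans_le (hG.B_le.trans hSV)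
  have hKN : G.K ≤ N := (Nat.le_mul_of_pos_right _ hG.B_pos).trans (hG.KB_le.trans hN)
  have hpN : G.pm + 1 ≤ N := hG.pm_lt.trans (hG.Q_lt.trans_le (hG.B_le.trans hN))
  have ha := hb.reg rOld
  have hb' := hb.reg rNew
  obtain ⟨a, haa⟩ : ∃ a, s.reg rOld = a := ⟨_, rfl⟩
  obtain ⟨b, hbb⟩ : ∃ b, s.reg rNew = b := ⟨_, rfl⟩
  rw [haa] at ha ⊢
  rw [hbb] at hb' ⊢
  refine wp_seq_set_eq 0 rfl (Nat.zero_le _) (wp_seq_set_eq 0 rfl (Nat.zero_le _)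
    (wp_seq_set_eq (a / (G.B * G.B)) (by simp [hE.B, haa]) ((Nat.div_le_self _ _).trans ha)
    (wp_seq_set_eq (b / (G.B * G.B)) (by simp [hE.B, hbb]) ((Nat.div_le_self _ _).trans hb') ?_)))
  obtain ⟨s₁, hs₁⟩ : ∃ s₁, s₁ = (((s.setReg rBad 0).setReg rAcc 0).setReg rX (a / (G.B * G.B))).setReg
    rY (b / (G.B * G.B)) := ⟨_, rfl⟩
  have hF₁ : Frame [rBad, rAcc, rX, rY] [] s s₁ :=
    hs₁ ▸ (Frame.refl _ _ s).setReg.setReg.setReg.setReg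
  have hE₁ := hE.frame hF₁
  have h1 : s₁.reg rBad = 0 ∧ s₁.reg rAcc = 0 ∧ s₁.reg rX = a / (G.B * G.B) ∧
    s₁.reg rY = b / (G.B * G.B) ∧ s₁.reg rOld = a ∧ s₁.reg rNew = b := by simp [hs₁, haa, hbb]
  clear hF₁ hE
  rw [← hs₁]
  clear hs₁
  refine wp_seq (wp_flag hV1 fun s₂ hF₂ hbad₂ _ => ?_)
  have hE₂ := hE₁.frame hF₂
  have h2 : s₂.reg rAcc = 0 ∧ s₂.reg rX = a / (G.B * G.B) ∧
    s₂.reg rY = b / (G.B * G.B) ∧ s₂.reg rOld = a ∧ s₂.reg rNew = b := by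
    simpa only [hF₂.reg rAcc (by decide), hF₂.reg rX (by decide), hF₂.reg rY (by decide),
      hF₂.reg rOld (by decide), hF₂.reg rNew (by decide)] using h1.2
  have hbad : s₂.reg rBad = 0 ↔ a % (G.B * G.B) = b % (G.B * G.B) := by
    rw [hbad₂]
    simp [h1, hE₁.B]
    omega
  clear hF₂ hbad₂ h1 hE₁
  refine wp_seq (wp_for G.K (fun k s' =>
    s'.reg rX = a / (G.B * G.B) / (G.B * G.B * G.B) ^ k ∧
    s'.reg rY = b / (G.B * G.B) / (G.B * G.B * G.B) ^ k ∧
    s'.reg rAcc = ∑ k ∈ Finset.range k, (G.sum b k - G.sum a k) ∧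
    (s'.reg rBad = 0 ↔ a % (G.B * G.B) = b % (G.B * G.B) ∧ ∀ k' < k, G.StepClass a b k'))
    hKN (by decide) (fun s' hF => (hE₂.frame hF).K) (by simp [h2, hbad]) ?_ ?_)
  · intro k s' hk hF hrk ⟨hx, hy, hacc, hbad'⟩
    have hE' := hE₂.frame hF
    refine wp_popDigit hE'.B (by decide) (wp_popDigit (by simpa using hE'.B) (by decide)
      (wp_popDigit (by simpa using hE'.B) (by decide) (wp_popDigit (by simpa using hE'.B) (by decide)
      (wp_popDigit (by simpa using hE'.B) (by decide) (wp_popDigit (by simpa using hE'.B) (by decide)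
      ?_)))))
    simp only [State.setReg_reg, Nat.reduceEqDiff, if_true, if_false, hx, hy]
    rw [← Params.num, ← Params.num, ← Params.sum, ← Params.sum, ← Params.slope, ← Params.slope]
    generalize hs₃ : State.setReg _ _ _ = s₃
    have hF₃ : Frame [rX, rY, rC, rCn, rSg, rSgn, rV, rVn] [] s' s₃ := by
      rw [← hs₃]
      exact ((((((((((((Frame.refl _ _ _).setReg).setReg).setReg).setReg).setReg).setReg).setReg
        ).setReg).setReg).setReg).setReg).setReg
    have h3 : s₃.reg rX = a / (G.B * G.B) / (G.B * G.B * G.B) ^ (k + 1) ∧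
        s₃.reg rY = b / (G.B * G.B) / (G.B * G.B * G.B) ^ (k + 1) ∧
        s₃.reg rC = G.num a k ∧ s₃.reg rCn = G.num b k ∧ s₃.reg rSg = G.sum a k ∧
        s₃.reg rSgn = G.sum b k ∧ s₃.reg rV = G.slope a k ∧ s₃.reg rVn = G.slope b k := by
      rw [← hs₃]
      simp [Nat.div_div_eq_div_mul, pow_succ, mul_assoc]
    clear hs₃
    obtain ⟨hX, hY, hC, hCn, hSg, hSgn, hV, hVn⟩ := h3
    have hE₃ := hE'.frame hF₃
    have hacc₃ : s₃.reg rAcc = ∑ k ∈ Finset.range k, (G.sum b k - G.sum a k) :=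
      (hF₃.reg _ (by decide)).trans hacc
    have hbad₃ := hF₃.reg rBad (by decide)
    have hk₃ : s₃.reg ixK = k := (hF₃.reg _ (by decide)).trans hrk
    clear hx hy hacc hF hrk
    refine wp_seq (wp_flag hV1 fun s₄ hF₄ hbad₄ _ => ?_)
    have hE₄ := hE₃.frame hF₄
    have hnext : ∑ k ∈ Finset.range (k + 1), (G.sum b k - G.sum a k) ≤ G.S := by
      refine le_trans ?_ hG.KB_le
      calc _ ≤ ∑ _k ∈ Finset.range (k + 1), G.B := Finset.sum_le_sum fun k _ =>
            (Nat.sub_le _ _).trans (Nat.mod_lt _ hG.B_pos).le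
        _ ≤ G.K * G.B := by simpa using Nat.mul_le_mul_right _ hk
    refine wp_seq_set_eq (∑ k ∈ Finset.range (k + 1), (G.sum b k - G.sum a k)) ?_
      (hnext.trans hSV) ?_
    · simp [hF₄.reg rAcc (by decide), hF₄.reg rSg (by decide), hF₄.reg rSgn (by decide), hacc₃,
        hSg, hSgn, Finset.sum_range_succ]
    generalize hs₅ : State.setReg _ _ _ = s₅
    have hF₅ : Frame [rBad, rAcc] [] s₃ s₅ := by
      rw [← hs₅]
      exact (hF₄.mono (by decide) (by decide)).setReg
    have hE₅ := hE₃.frame hF₅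
    have hacc₅ : s₅.reg rAcc = ∑ k ∈ Finset.range (k + 1), (G.sum b k - G.sum a k) := by
      simp [← hs₅]
    have hbad₅ : s₅.reg rBad = 0 ↔ s'.reg rBad = 0 ∧ (G.num a k ≤ G.num b k ∧
        G.slope a k ≤ G.slope b k ∧
        G.sum b k = G.sum a k + (G.num b k - G.num a k) * G.slope b k) := by
      rw [← hs₅]
      simp only [State.setReg_reg, Nat.reduceEqDiff, if_false, hbad₄]
      simp [hC, hCn, hV, hVn, hSg, hSgn, hbad₃, and_assoc]
      simp only [Nat.sub_eq_zero_iff_le]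
      split_ifs with h
      · exact ⟨fun h0 => ⟨h0, h.1, h.2.1, le_antisymm h.2.2.1 h.2.2.2⟩, fun h0 => h0.1⟩
      · simp only [false_iff, not_and]
        exact fun _ h1 h2 h3 => h ⟨h1, h2, h3.le, h3.ge⟩
    clear hs₅ hbad₄ hF₄ hE₄ hbad₃ hE₃
    refine wp_for (G.pm + 1) (fun θ s₆ => s₆.reg rBad = 0 ↔ s₅.reg rBad = 0 ∧
      ∀ θ' < θ, G.Q * θ' * G.num b k ≤ G.sum b k + G.Q * G.deficit k θ') hpN (by decide)
      (fun s₆ hF₆ => by simp [(hE₅.frame hF₆).pm]) (by simp) ?_ ?_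
    · intro θ s₆ hθ hF₆ hrθ hI
      have hE₆ := hE₅.frame hF₆
      refine wp_seq ((wp_classSum hE₆ (by have := hG.d_le; omega)
        (fun j => G.cnt j * (θ - G.p j)) k ?_ ?_ ((hG.deficit_le hθ).trans hSV)).mono
        fun s₇ hF₇ hsum _ => wp_flag hV1 fun s₈ hF₈ hbad₈ _ => ?_)
      · rw [hF₆.reg _ (by decide), hF₅.reg _ (by decide), hk₃]
      · intro t hFt hjt
        have hEt := hE₆.frame hFt
        simp [hEt.cnt _ hjt, hEt.p _ hjt, hFt.reg ixTheta (by decide), hrθ]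
      · have hE₇ := hE₆.frame hF₇
        have e1 : s₇.reg rCn = G.num b k := by
          rw [hF₇.reg _ (by decide), hF₆.reg _ (by decide), hF₅.reg _ (by decide), hCn]
        have e2 : s₇.reg rSgn = G.sum b k := by
          rw [hF₇.reg _ (by decide), hF₆.reg _ (by decide), hF₅.reg _ (by decide), hSgn]
        have e3 : s₇.reg ixTheta = θ := by rw [hF₇.reg _ (by decide), hrθ]
        have e4 : s₇.reg rBad = s₆.reg rBad := hF₇.reg _ (by decide)
        change s₇.reg rSum = G.deficit k θ at hsum
        rw [State.setReg_reg, if_neg (by decide), hbad₈]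
        simp only [Term.eval_sub, Term.eval_mul, Term.eval_add, Term.eval_reg, hE₇.Q, e1, e2, e3,
          e4, hsum, Nat.sub_eq_zero_iff_le, Nat.lt_succ_iff_lt_or_eq, or_imp, forall_and,
          forall_eq]
        split_ifs with h
        · rw [hI]
          tauto
        · simp [h]
    · intro s₆ hF₆ _ hI _
      have e1 : ∀ x ∉ [ixJ, rSum, rBad, ixTheta], s₆.reg x = s₅.reg x := fun x hx =>
        hF₆.reg x (by simp [Program.regs, classSum, flag, Program.forLoop] at hx ⊢; tauto)
      simp only [e1 rX (by decide),
        e1 rY (by decide), e1 rAcc (by decide), hF₅.reg rX (by decide), hF₅.reg rY (by decide),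
        hX, hY, hacc₅, hI, hbad₅, hbad', true_and]
      constructor
      · rintro ⟨⟨⟨h1, h2⟩, h3, h4, h5⟩, h6⟩
        refine ⟨h1, fun k' hk' => ?_⟩
        rcases Nat.lt_succ_iff_lt_or_eq.1 hk' with h | rfl
        exacts [h2 k' h, ⟨h3, h4, h5, h6⟩]
      · rintro ⟨h1, h2⟩
        have h3 := h2 k (Nat.lt_succ_self k)
        exact ⟨⟨⟨h1, fun k' hk' => h2 k' (hk'.trans (Nat.lt_succ_self k))⟩, h3.num, h3.slope,
          h3.sum⟩, h3.major⟩
  · intro s₃ hF₃ _ ⟨_, _, hacc, hbad₃⟩ _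
    have hE₃ := hE₂.frame hF₃
    have hnew : s₃.reg rNew = b := by rw [hF₃.reg _ (by decide), h2.2.2.2.2]
    refine wp_flag hV1 fun s₄ hF₄ hbad₄ => ?_
    rw [hbad₄]
    simp only [Term.eval_add, Term.eval_sub, Term.eval_mul, Term.eval_mod, Term.eval_div,
      Term.eval_reg, Term.eval_one, hE₃.Q, hE₃.B, hnew, hacc]
    constructor
    · intro h
      rw [ite_eq_iff] at h
      obtain ⟨h, h'⟩ : _ ∧ s₃.reg 18 = 0 := by simpa using h
      rw [hbad₃] at h'
      exact ⟨h'.1, h'.2, by rw [Params.lo]; omega, by rw [Params.up]; omega⟩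
    · intro h
      have := h.lower
      have := h.upper
      rw [Params.lo] at *
      rw [Params.up] at *
      rw [if_pos (by omega), hbad₃]
      exact ⟨h.bounds, h.cls⟩

end Scheduling

namespace Scheduling

open WordRAM

/-! ### The table of codes -/

theorem eq_of_mul_add_eq {n i i' j j' : ℕ} (hj : j < n) (hj' : j' < n)
    (h : i * n + j = i' * n + j') : i = i' ∧ j = j' := by
  have h1 : (i * n + j) / n = i := by
    rw [mul_comm, Nat.mul_add_div (by omega), Nat.div_eq_of_lt hj, add_zero]
  have h2 : (i' * n + j') / n = i' := by
    rw [mul_comm, Nat.mul_add_div (by omega), Nat.div_eq_of_lt hj', add_zero]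
  have h3 : i = i' := by rw [← h1, h, h2]
  subst h3
  exact ⟨rfl, by omega⟩

/-- Every nonzero entry of the table is the successor of a code that can precede it and that is
itself in the table, except in the row of the initial codes. -/
def TableSound (G : Params) (f : ℕ → ℕ) : Prop :=
  ∀ t b, b < G.S → f (t * G.S + b) ≠ 0 → (t = 0 ∧ b < G.B * G.B) ∨
    ∃ t' a, t = t' + 1 ∧ a < G.S ∧ f (t * G.S + b) = a + 1 ∧ f (t' * G.S + a) ≠ 0 ∧ G.Step a b

/-- The initial codes are in the table, and so are the successors of its codes, for the steps in
`D`. -/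
def TableComplete (G : Params) (D : ℕ → ℕ → ℕ → Prop) (f : ℕ → ℕ) : Prop :=
  (∀ a < G.B * G.B, f a ≠ 0) ∧ ∀ t a b, a < G.S → b < G.S → D t a b →
    f (t * G.S + a) ≠ 0 → G.Step a b → f ((t + 1) * G.S + b) ≠ 0

theorem TableComplete.mono {G : Params} {D D' : ℕ → ℕ → ℕ → Prop} {f : ℕ → ℕ}
    (h : TableComplete G D f) (hD : ∀ t a b, a < G.S → b < G.S → D' t a b → f (t * G.S + a) ≠ 0 →
      G.Step a b → D t a b) : TableComplete G D' f :=
  ⟨h.1, fun t a b ha hb hD' hf hs => h.2 t a b ha hb (hD t a b ha hb hD' hf hs) hf hs⟩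

theorem TableSound.update {G : Params} {f : ℕ → ℕ} {t a b : ℕ} (h : TableSound G f) (ha : a < G.S)
    (hb : b < G.S) (hf : f (t * G.S + a) ≠ 0) (hs : G.Step a b) :
    TableSound G (Function.update f ((t + 1) * G.S + b) (a + 1)) := by
  have hmono : ∀ i, f i ≠ 0 → Function.update f ((t + 1) * G.S + b) (a + 1) i ≠ 0 := by
    intro i hi
    rw [Function.update_apply]
    split_ifs <;> omega
  intro t₁ b₁ hb₁ hf₁
  rw [Function.update_apply] at hf₁ ⊢
  split_ifs at hf₁ ⊢ with h'
  · obtain ⟨rfl, rfl⟩ := eq_of_mul_add_eq hb₁ hb h'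
    exact .inr ⟨t, a, rfl, ha, rfl, hmono _ hf, hs⟩
  · rcases h t₁ b₁ hb₁ hf₁ with h0 | ⟨t', a', h1, h2, h3, h4, h5⟩
    exacts [.inl h0, .inr ⟨t', a', h1, h2, h3, hmono _ h4, h5⟩]

theorem TableComplete.update {G : Params} {D : ℕ → ℕ → ℕ → Prop} {f : ℕ → ℕ} {t a b : ℕ}
    (h : TableComplete G D f) (hD : ∀ t₁ a₁ b₁, D t₁ a₁ b₁ → t₁ ≤ t) (hb : b < G.S) :
    TableComplete G (fun t₁ a₁ b₁ => D t₁ a₁ b₁ ∨ t₁ = t ∧ a₁ = a ∧ b₁ = b)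
      (Function.update f ((t + 1) * G.S + b) (a + 1)) := by
  have hmono : ∀ i, f i ≠ 0 → Function.update f ((t + 1) * G.S + b) (a + 1) i ≠ 0 := by
    intro i hi
    rw [Function.update_apply]
    split_ifs <;> omega
  refine ⟨fun a ha => hmono a (h.1 a ha), fun t₁ a₁ b₁ ha₁ hb₁ hD₁ hf₁ hs₁ => ?_⟩
  rcases hD₁ with hD₁ | ⟨rfl, rfl, rfl⟩
  · refine hmono _ (h.2 t₁ a₁ b₁ ha₁ hb₁ hD₁ ?_ hs₁)
    rwa [Function.update_of_ne] at hf₁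
    intro h'
    have := (eq_of_mul_add_eq ha₁ hb h').1
    have := hD _ _ _ hD₁
    omega
  · simp

theorem wp_fillTable {V N : ℕ} {G : Params} {s : State} (hE : Env G s) (hG : G.Good)
    (hN : G.S ≤ N) (htab : ∀ i, s.arr aTab i = 0) : WP V N fillTable
      (fun s' => TableSound G (s'.arr aTab) ∧
        TableComplete G (fun t _ _ => t < G.m) (s'.arr aTab)) s := by
  refine .of_bounded fun hNV hb => ?_
  have hSV : G.S ≤ V := hN.trans hNV
  have hV1 : 1 ≤ V := hG.B_pos.trans_le (hG.B_le.trans hSV)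
  have hmN : G.m ≤ N := hG.m_lt.le.trans (hG.Q_lt.le.trans (hG.B_le.trans hN))
  have hS : 0 < G.S := hG.B_pos.trans_le hG.B_le
  refine wp_seq (wp_for (G.B * G.B) (fun k s' => ∀ i, s'.arr aTab i = if i < k then 1 else 0)
    (hG.BB_le.trans hN) (by decide) (fun s' hF => by simp [(hE.frame hF).B]) (by simpa using htab)
    ?_ ?_)
  · intro k s' hk hF hrk hI
    refine wp_put hV1 fun _ i => ?_
    simp only [Term.eval_reg, hrk, Term.eval_one, State.setReg_arr, State.setCell_arr, if_true,
      Function.update_apply, hI]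
    split_ifs <;> omega
  intro s₁ hF₁ _ hI₁ _
  have hE₁ := hE.frame hF₁
  have hsound : TableSound G (s₁.arr aTab) := by
    intro t b hb hf
    have h1 : t * G.S + b < G.B * G.B := by by_contra h; simp [hI₁, h] at hf
    have h2 : t = 0 := by
      by_contra h
      have := hG.BB_le
      have := Nat.le_mul_of_pos_left G.S (Nat.pos_of_ne_zero h)
      omega
    subst h2
    exact .inl ⟨rfl, by omega⟩
  have hcomplete : TableComplete G (fun _ _ _ => False) (s₁.arr aTab) :=
    ⟨fun a ha => by simp [hI₁, ha], fun _ _ _ _ _ h => h.elim⟩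
  refine wp_for G.m (fun t s' => TableSound G (s'.arr aTab) ∧
    TableComplete G (fun t' _ _ => t' < t) (s'.arr aTab)) hmN (by decide)
    (fun s' hF => (hE₁.frame hF).m) ⟨hsound, hcomplete.mono fun _ _ _ _ _ h => by omega⟩ ?_
    (fun s' _ _ h => h)
  intro t s₂ ht hF₂ hrt ⟨hs₂, hc₂⟩
  have hE₂ := hE₁.frame hF₂
  refine wp_for G.S (fun a s' => TableSound G (s'.arr aTab) ∧
    TableComplete G (fun t' a' _ => t' < t ∨ t' = t ∧ a' < a) (s'.arr aTab)) hN (by decide)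
    (fun s' hF => (hE₂.frame hF).S) ⟨hs₂, hc₂.mono fun _ _ _ _ _ h => by omega⟩ ?_
    (fun s' _ _ h _ => ⟨h.1, h.2.mono fun _ _ _ _ _ h => by omega⟩)
  intro a s₃ ha hF₃ hra ⟨hs₃, hc₃⟩
  have hE₃ := hE₂.frame hF₃
  have hrt₃ : s₃.reg ixT = t := (hF₃.reg _ (by decide)).trans hrt
  have hcell : (Term.get aTab (§ixT * §rS + §rOld)).eval s₃ = s₃.arr aTab (t * G.S + a) := by
    simp [hrt₃, hE₃.S, hra]
  refine wp_ite (fun h => ?_) (fun h => wp_skip fun _ => ?_)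
  · rw [hcell] at h
    refine wp_for G.S (fun b s' => TableSound G (s'.arr aTab) ∧
      s'.arr aTab (t * G.S + a) ≠ 0 ∧
      TableComplete G (fun t' a' b' => t' < t ∨ t' = t ∧ (a' < a ∨ a' = a ∧ b' < b))
        (s'.arr aTab)) hN (by decide) (fun s' hF => (hE₃.frame hF).S)
      ⟨hs₃, h, hc₃.mono fun _ _ _ _ _ h => by omega⟩ ?_
      (fun s' _ _ h _ => ⟨h.1, h.2.2.mono fun _ _ _ _ _ h => by omega⟩)
    intro b s₄ hb hF₄ hrb ⟨hs₄, hne₄, hc₄⟩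
    have hE₄ := hE₃.frame hF₄
    have hra₄ : s₄.reg rOld = a := (hF₄.reg _ (by decide)).trans hra
    have hrt₄ : s₄.reg ixT = t := (hF₄.reg _ (by decide)).trans hrt₃
    refine wp_seq ((wp_checkStep hE₄ hG hN).mono fun s₅ hF₅ hbad _ => ?_)
    have hE₅ := hE₄.frame hF₅
    have hra₅ : s₅.reg rOld = a := (hF₅.reg _ (by decide)).trans hra₄
    have hrt₅ : s₅.reg ixT = t := (hF₅.reg _ (by decide)).trans hrt₄
    have hrb₅ : s₅.reg rNew = b := (hF₅.reg _ (by decide)).trans hrb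
    have htab₅ : s₅.arr aTab = s₄.arr aTab := hF₅.arr _ (by decide)
    rw [hra₄, hrb] at hbad
    refine wp_ite (fun h' => wp_skip fun _ => ?_) (fun h' => wp_put ?_ fun _ => ?_)
    · simp only [State.setReg_arr, htab₅]
      refine ⟨hs₄, hne₄, hc₄.mono fun t' a' b' _ _ hD hf hst => ?_⟩
      by_contra hcon
      have : t' = t ∧ a' = a ∧ b' = b := by omega
      obtain ⟨rfl, rfl, rfl⟩ := this
      exact h' (hbad.2 hst)
    · simp only [Term.eval_add, Term.eval_reg, Term.eval_one, hra₅]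
      omega
    · have hst := hbad.1 h'
      have hi : (((§ixT + 1) * §rS + §rNew : Term)).eval s₅ = (t + 1) * G.S + b := by
        simp [hrt₅, hE₅.S, hrb₅]
      have hv : ((§rOld + 1 : Term)).eval s₅ = a + 1 := by simp [hra₅]
      rw [hi, hv]
      simp only [State.setReg_arr, State.setCell_arr, if_true, htab₅]
      refine ⟨hs₄.update ha hb hne₄ hst, ?_, (hc₄.update (a := a) (t := t)
        (fun t₁ _ _ h => by omega) hb).mono fun _ _ _ _ _ h => by omega⟩
      rw [Function.update_apply]
      split_ifs <;> omega
  · rw [hcell] at h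
    simp only [State.setReg_arr]
    refine ⟨hs₃, hc₃.mono fun t' a' b' _ _ hD hf hst => ?_⟩
    by_contra hcon
    have : t' = t ∧ a' = a := by omega
    obtain ⟨rfl, rfl⟩ := this
    exact hf h

theorem wp_sum {V N : ℕ} {P : Program} {Q : State → Prop} {s : State} {r x n : ℕ} {e bound : Term}
    (F : ℕ → ℕ) (hrx : r ≠ x) (hn : n ≤ N)
    (hbound : ∀ s', Frame [x, r] [] s s' → bound.eval s' = n)
    (he : ∀ s', Frame [x, r] [] s s' → s'.reg x < n → e.eval s' = F (s'.reg x))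
    (hV : ∑ j ∈ Finset.range n, F j ≤ V)
    (h : ∀ s', Frame [x, r] [] s s' → s'.reg r = ∑ j ∈ Finset.range n, F j → WP V N P Q s') :
    WP V N (.set r 0;; .forLoop x bound (.set r (§r + e));; P) Q s := by
  refine wp_seq_set_eq 0 rfl (Nat.zero_le _) (wp_seq ?_)
  have hF₁ : Frame [x, r] [] s (s.setReg r 0) := (Frame.refl _ _ _).setReg (by simp)
  refine wp_for n (fun k s' => s'.reg r = ∑ j ∈ Finset.range k, F j) hn
    (show x ∉ [r] by simpa using hrx.symm) (fun s' hF => hbound s' (hF₁.trans hF)) (by simp [hrx])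
    (fun k s' hk hF hrk hI => ?_) (fun s' hF _ hI _ => h s' (hF₁.trans hF) hI)
  have hval : (§r + e).eval s' = ∑ j ∈ Finset.range (k + 1), F j := by
    rw [Term.eval_add, Term.eval_reg, hI, he s' (hF₁.trans hF) (by omega), hrk,
      Finset.sum_range_succ]
  refine wp_set ?_ fun _ => ?_
  · rw [hval]
    exact (Finset.sum_le_sum_of_subset (Finset.range_mono hk)).trans hV
  · rw [hval]
    simp [hrx]

namespace Params

theorem Good.size_le {G : Params} (hG : G.Good) (k : ℕ) : G.size k ≤ G.S := by
  calc G.size k ≤ ∑ j ∈ Finset.range G.d, G.cnt j := by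
        refine Finset.sum_le_sum fun j _ => ?_
        split_ifs
        · exact le_rfl
        · exact Nat.zero_le _
    _ ≤ G.Q := hG.cnt_lt.le
    _ ≤ G.S := hG.Q_lt.le.trans hG.B_le

theorem Good.work_le' {G : Params} (hG : G.Good) : G.work ≤ G.Q * G.pm := by
  calc G.work ≤ ∑ j ∈ Finset.range G.d, G.cnt j * G.pm :=
        Finset.sum_le_sum fun j hj => Nat.mul_le_mul_left _ (hG.p_le j (Finset.mem_range.1 hj))
    _ = (∑ j ∈ Finset.range G.d, G.cnt j) * G.pm := by rw [Finset.sum_mul]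
    _ ≤ G.Q * G.pm := Nat.mul_le_mul_right _ hG.cnt_lt.le

theorem Good.work_le {G : Params} (hG : G.Good) : G.work ≤ G.S :=
  hG.work_le'.trans ((Nat.mul_le_mul_left _ hG.pm_lt.le).trans
    (hG.Q_mul_Q_lt.le.trans hG.B_le))

end Params

theorem wp_checkFinal {V N : ℕ} {G : Params} {s : State} (hE : Env G s) (hG : G.Good)
    (hN : G.S ≤ N) : WP V N checkFinal
      (fun s' => s'.reg rBad = 0 ↔ G.Final (s.reg rOld)) s := by
  refine .of_bounded fun hNV hb => ?_
  have hSV : G.S ≤ V := hN.trans hNV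
  have hV1 : 1 ≤ V := hG.B_pos.trans_le (hG.B_le.trans hSV)
  have hKN : G.K ≤ N := (Nat.le_mul_of_pos_right _ hG.B_pos).trans (hG.KB_le.trans hN)
  have hdN : G.d ≤ N := hG.d_le.trans (hG.pm_lt.le.trans (hG.Q_lt.le.trans (hG.B_le.trans hN)))
  have ha := hb.reg rOld
  obtain ⟨a, haa⟩ : ∃ a, s.reg rOld = a := ⟨_, rfl⟩
  rw [haa] at ha ⊢
  refine wp_seq_set_eq 0 rfl (Nat.zero_le _) (wp_seq_set_eq 0 rfl (Nat.zero_le _)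
    (wp_seq_set_eq (a / (G.B * G.B)) (by simp [hE.B, haa]) ((Nat.div_le_self _ _).trans ha) ?_))
  generalize hs₁ : State.setReg _ _ _ = s₁
  have hE₁ : Env G s₁ := hE.frame (R := [rBad, rAcc, rX]) (A := [])
    (hs₁ ▸ (Frame.refl _ _ s).setReg.setReg.setReg)
  have h1 : s₁.reg rBad = 0 ∧ s₁.reg rAcc = 0 ∧ s₁.reg rX = a / (G.B * G.B) := by simp [← hs₁]
  clear hs₁ hE
  refine wp_seq (wp_for G.K (fun k s' =>
    s'.reg rX = a / (G.B * G.B) / (G.B * G.B * G.B) ^ k ∧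
    s'.reg rAcc = ∑ k ∈ Finset.range k, G.sum a k ∧
    (s'.reg rBad = 0 ↔ ∀ k' < k, G.num a k' = G.size k'))
    hKN (by decide) (fun s' hF => (hE₁.frame hF).K) (by simp [h1]) ?_ ?_)
  · intro k s' hk hF hrk ⟨hx, hacc, hbad'⟩
    have hE' := hE₁.frame hF
    refine wp_popDigit hE'.B (by decide) (wp_popDigit (by simpa using hE'.B) (by decide)
      (wp_popDigit (by simpa using hE'.B) (by decide) ?_))
    simp only [State.setReg_reg, Nat.reduceEqDiff, if_true, if_false, hx]
    rw [← Params.num, ← Params.sum, ← Params.slope]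
    generalize hs₃ : State.setReg _ _ _ = s₃
    have hF₃ : Frame [rX, rC, rSg, rV] [] s' s₃ := by
      rw [← hs₃]
      exact ((((((Frame.refl _ _ _).setReg).setReg).setReg).setReg).setReg).setReg
    have h3 : s₃.reg rX = a / (G.B * G.B) / (G.B * G.B * G.B) ^ (k + 1) ∧
        s₃.reg rC = G.num a k ∧ s₃.reg rSg = G.sum a k := by
      rw [← hs₃]
      simp [Nat.div_div_eq_div_mul, pow_succ, mul_assoc]
    clear hs₃
    obtain ⟨hX, hC, hSg⟩ := h3
    have hE₃ := hE'.frame hF₃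
    refine wp_seq ((wp_classSum hE₃ hdN G.cnt k ((hF₃.reg _ (by decide)).trans hrk)
      (fun t hFt hjt => ?_) ((hG.size_le k).trans hSV)).mono
      fun s₄ hF₄ hsum _ => wp_seq (wp_flag hV1 fun s₅ hF₅ hbad₅ _ => ?_))
    · simp [(hE₃.frame hFt).cnt _ hjt]
    change s₄.reg rSum = G.size k at hsum
    have e1 : s₄.reg rC = G.num a k := (hF₄.reg _ (by decide)).trans hC
    have e2 : s₄.reg rBad = s'.reg rBad :=
      (hF₄.reg _ (by decide)).trans (hF₃.reg _ (by decide))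
    have e3 : s₅.reg rX = a / (G.B * G.B) / (G.B * G.B * G.B) ^ (k + 1) := by
      rw [hF₅.reg _ (by decide), hF₄.reg _ (by decide), hX]
    have e4 : s₅.reg rAcc = ∑ k ∈ Finset.range k, G.sum a k := by
      rw [hF₅.reg _ (by decide), hF₄.reg _ (by decide), hF₃.reg _ (by decide), hacc]
    have e5 : s₅.reg rSg = G.sum a k := by
      rw [hF₅.reg _ (by decide), hF₄.reg _ (by decide), hSg]
    rw [Term.eval_ne, Term.eval_reg, Term.eval_reg, e1, e2, hsum] at hbad₅
    have hval : (§rAcc + §rSg : Term).eval s₅ = ∑ k ∈ Finset.range (k + 1), G.sum a k := by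
      simp [e4, e5, Finset.sum_range_succ]
    refine wp_set ?_ fun _ => ?_
    · rw [hval]
      refine le_trans ?_ (hG.KB_le.trans hSV)
      calc _ ≤ ∑ _k ∈ Finset.range (k + 1), G.B := Finset.sum_le_sum fun k _ =>
            (Nat.mod_lt _ hG.B_pos).le
        _ ≤ G.K * G.B := by simpa using Nat.mul_le_mul_right _ hk
    · rw [hval]
      refine ⟨by simp [e3], by simp, ?_⟩
      simp only [State.setReg_reg, Nat.reduceEqDiff, if_false, hbad₅, sub_add_sub_eq_zero,
        Nat.lt_succ_iff_lt_or_eq, or_imp, forall_and, forall_eq]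
      split_ifs with h
      · rw [hbad']
        tauto
      · simp [h]
  · intro s₃ hF₃ _ ⟨_, hacc, hbad₃⟩ _
    have hE₃ := hE₁.frame hF₃
    refine wp_sum (n := G.d) (fun j => G.cnt j * G.p j) (by decide) hdN
      (fun s' hF => (hE₃.frame hF).d) (fun s' hF hj => ?_) (hG.work_le.trans hSV)
      (fun s₄ hF₄ hsum => wp_flag hV1 fun s₅ hF₅ hbad₅ => ?_)
    · have hE' := hE₃.frame hF
      simp [hE'.cnt _ hj, hE'.p _ hj]
    change s₄.reg rSum = G.work at hsum
    have hE₄ := hE₃.frame hF₄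
    have e1 : s₄.reg rAcc = ∑ k ∈ Finset.range G.K, G.sum a k :=
      (hF₄.reg _ (by decide)).trans hacc
    have e2 : s₄.reg rBad = s₃.reg rBad := hF₄.reg _ (by decide)
    rw [hbad₅]
    simp only [Term.eval_sub, Term.eval_mul, Term.eval_add, Term.eval_reg, Term.eval_one, e1, e2,
      hsum, hE₄.Q, Nat.sub_eq_zero_iff_le]
    split_ifs with h
    · rw [hbad₃]
      exact ⟨fun h' => ⟨h', h⟩, fun h' => h'.num⟩
    · exact ⟨fun h' => h'.elim, fun h' => (h h'.sum).elim⟩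

/-- What a code is worth; less is better. -/
def Params.val (G : Params) (a : ℕ) : Objective → ℕ
  | .cmax => G.up a
  | .cmin => G.B - G.lo a
  | .cenvy => G.up a - G.lo a

theorem Params.Good.val_le {G : Params} (hG : G.Good) (a : ℕ) (obj : Objective) :
    G.val a obj ≤ G.B := by
  have h1 : G.up a < G.B := Nat.mod_lt _ hG.B_pos
  cases obj <;> simp only [val] <;> omega

theorem Env.eval_valT {G : Params} {s : State} (hE : Env G s) (obj : Objective) :
    (valT obj).eval s = G.val (s.reg rOld) obj := by
  cases obj <;> simp [valT, Params.val, hE.B, Params.up, Params.lo]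

/-- A code that ends a path through the table and distributes all the jobs. -/
def Params.Valid (G : Params) (f : ℕ → ℕ) (a : ℕ) : Prop :=
  a < G.S ∧ f (G.m * G.S + a) ≠ 0 ∧ G.Final a

theorem wp_choose {V N : ℕ} {G : Params} {s : State} (obj : Objective) (hE : Env G s)
    (hG : G.Good) (hN : G.S ≤ N) (hex : ∃ a, G.Valid (s.arr aTab) a) :
    WP V N (choose obj) (fun s' => G.Valid (s.arr aTab) (s'.reg rBest) ∧
      ∀ a, G.Valid (s.arr aTab) a → G.val (s'.reg rBest) obj ≤ G.val a obj) s := by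
  refine .of_bounded fun hNV hb => ?_
  have hSV : G.S ≤ V := hN.trans hNV
  have hBS : G.B + 1 ≤ G.S := by
    have h1 : 2 * G.B ≤ G.B * G.B := Nat.mul_le_mul_right _ (by
      have := hG.Q_lt
      have := hG.pm_lt
      have := hG.pm_pos
      omega)
    have := hG.B_pos
    have := hG.BB_le
    omega
  refine wp_seq_set_eq 0 rfl (Nat.zero_le _) (wp_seq_set_eq (G.B + 1) (by simp [hE.B])
    (hBS.trans hSV) ?_)
  generalize hs₁ : State.setReg _ _ _ = s₁
  have hF₁ : Frame [rBest, rVal] [] s s₁ := hs₁ ▸ (Frame.refl _ _ s).setReg.setReg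
  have hE₁ : Env G s₁ := hE.frame hF₁
  have h1 : s₁.reg rVal = G.B + 1 := by simp [← hs₁]
  refine wp_for G.S (fun k s' => (s'.reg rVal = G.B + 1 ∧ ∀ a < k, ¬ G.Valid (s.arr aTab) a) ∨
    (G.Valid (s.arr aTab) (s'.reg rBest) ∧ s'.reg rVal = G.val (s'.reg rBest) obj ∧
      ∀ a < k, G.Valid (s.arr aTab) a → G.val (s'.reg rBest) obj ≤ G.val a obj)) hN
    (by cases obj <;> decide) (fun s' hF => (hE₁.frame hF (by cases obj <;> decide)
      (by cases obj <;> decide)).S) (by simp [h1]) ?_ ?_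
  · intro a s₂ ha hF₂ hra hI
    have hE₂ := hE₁.frame hF₂ (by cases obj <;> decide) (by cases obj <;> decide)
    have htab₂ : s₂.arr aTab = s.arr aTab := by
      rw [hF₂.arr _ (by cases obj <;> decide), hF₁.arr _ (by decide)]
    have hcell : (Term.get aTab (§rM * §rS + §rOld)).eval s₂ = s.arr aTab (G.m * G.S + a) := by
      simp [hE₂.m, hE₂.S, hra, htab₂]
    -- A code that is not valid leaves the invariant as it is.
    have hskip : ¬ G.Valid (s.arr aTab) a → ∀ s' : State, s'.reg rVal = s₂.reg rVal →
        s'.reg rBest = s₂.reg rBest →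
        (s'.reg rVal = G.B + 1 ∧ ∀ a' < a + 1, ¬ G.Valid (s.arr aTab) a') ∨
        (G.Valid (s.arr aTab) (s'.reg rBest) ∧ s'.reg rVal = G.val (s'.reg rBest) obj ∧
          ∀ a' < a + 1, G.Valid (s.arr aTab) a' →
            G.val (s'.reg rBest) obj ≤ G.val a' obj) := by
      intro hv s' e1 e2
      rw [e1, e2]
      refine hI.imp (fun h => ⟨h.1, fun a' ha' => ?_⟩) (fun h => ⟨h.1, h.2.1, fun a' ha' hv' => ?_⟩)
      · rcases Nat.lt_succ_iff_lt_or_eq.1 ha' with h' | rfl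
        exacts [h.2 a' h', hv]
      · rcases Nat.lt_succ_iff_lt_or_eq.1 ha' with h' | rfl
        exacts [h.2.2 a' h' hv', (hv hv').elim]
    refine wp_ite (fun h => ?_) (fun h => wp_skip fun _ => ?_)
    · rw [hcell] at h
      refine wp_seq ((wp_checkFinal hE₂ hG hN).mono fun s₃ hF₃ hbad _ => ?_)
      have hE₃ := hE₂.frame hF₃
      have hra₃ : s₃.reg rOld = a := (hF₃.reg _ (by decide)).trans hra
      have e1 : s₃.reg rVal = s₂.reg rVal := hF₃.reg _ (by decide)
      have e2 : s₃.reg rBest = s₂.reg rBest := hF₃.reg _ (by decide)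
      rw [hra] at hbad
      refine wp_ite (fun h' => wp_skip fun _ => ?_) (fun h' => ?_)
      · exact hskip (fun hv => h' (hbad.2 hv.2.2)) _ (by simpa using e1) (by simpa using e2)
      have hv : G.Valid (s.arr aTab) a := ⟨ha, h, hbad.1 h'⟩
      have hval := hE₃.eval_valT obj
      rw [hra₃] at hval
      have hle := hG.val_le a obj
      refine wp_ite (fun h'' => wp_seq_set_eq (G.val a obj) hval (by omega) ?_)
        (fun h'' => wp_skip fun _ => ?_)
      all_goals rw [Term.eval_sub, hval, Term.eval_reg, e1] at h''
      · refine wp_set ?_ fun _ => ?_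
        · simp [hra₃]
          omega
        · simp only [Term.eval_reg, State.setReg_reg, hra₃, Nat.reduceEqDiff, if_true, if_false]
          refine .inr ⟨hv, trivial, fun a' ha' hv' => ?_⟩
          rcases Nat.lt_succ_iff_lt_or_eq.1 ha' with h₀ | rfl
          · rcases hI with hI | hI
            · exact (hI.2 a' h₀ hv').elim
            · have := hI.2.2 a' h₀ hv'
              omega
          · exact le_rfl
      · simp only [State.setReg_reg, Nat.reduceEqDiff, if_false, e1, e2]
        rcases hI with hI | hI
        · omega
        · refine .inr ⟨hI.1, hI.2.1, fun a' ha' hv' => ?_⟩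
          rcases Nat.lt_succ_iff_lt_or_eq.1 ha' with h₀ | rfl
          · exact hI.2.2 a' h₀ hv'
          · omega
    · rw [hcell] at h
      exact hskip (fun hv => hv.2.1 h) _ (by simp) (by simp)
  · intro s₂ _ _ hI
    obtain ⟨a, ha⟩ := hex
    rcases hI with hI | hI
    · exact (hI.2 a ha.1 ha).elim
    · exact ⟨hI.1, fun a' ha' => hI.2.2 a' ha'.1 ha'⟩

end Scheduling

namespace Scheduling

open WordRAM

/-! ### From the table to numbers of jobs -/

namespace Params

variable (G : Params)

/-- The number of jobs of the preceding types of the class of `j`. -/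
def pre (j : ℕ) : ℕ := ∑ j' ∈ Finset.range j, if G.cls j' = G.cls j then G.cnt j' else 0

/-- The number of jobs of type `j` among the first `c` jobs of its class. -/
def part (j c : ℕ) : ℕ := min (c - G.pre j) (G.cnt j)

/-- The number of jobs of type `j` that the machine between two codes gets. -/
def share (a b j : ℕ) : ℕ := G.part j (G.num b (G.cls j)) - G.part j (G.num a (G.cls j))

end Params

theorem Env.eval_partT {G : Params} {s : State} (hE : Env G s) {e : Term} {j c : ℕ} (hj : j < G.d)
    (hrj : s.reg ixJ = j) (he : e.eval s = c) (hsum : s.reg rSum = G.pre j) :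
    (partT e).eval s = G.part j c := by
  simp [partT, he, hsum, hrj, hE.cnt j hj, Params.part]
  omega

theorem wp_assign {V N : ℕ} {G : Params} {s : State} (hE : Env G s) (hG : G.Good)
    (hN : G.S ≤ N) (path : ℕ → ℕ) (hlast : s.reg rBest = path G.m)
    (hpath : ∀ i < G.m, s.arr aTab ((i + 1) * G.S + path (i + 1)) = path i + 1) :
    WP V N assign (fun s' => ∀ i < G.m, ∀ j < G.d,
      s'.arr aX (i * G.d + j) = G.share (path i) (path (i + 1)) j) s := by
  refine .of_bounded fun hNV hb => ?_
  have hSV : G.S ≤ V := hN.trans hNV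
  have hKN : G.K ≤ N := (Nat.le_mul_of_pos_right _ hG.B_pos).trans (hG.KB_le.trans hN)
  have hQN : G.Q ≤ N := hG.Q_lt.le.trans (hG.B_le.trans hN)
  have hdN : G.d ≤ N := hG.d_le.trans (hG.pm_lt.le.trans hQN)
  refine wp_seq_set_eq (path G.m) (by simp [hlast]) (hlast ▸ hb.reg _) ?_
  generalize hs₁ : State.setReg _ _ _ = s₁
  have hF₁ : Frame [rNew] [] s s₁ := hs₁ ▸ (Frame.refl _ _ s).setReg
  have hE₁ := hE.frame hF₁
  have hnew₁ : s₁.reg rNew = path G.m := by simp [← hs₁]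
  refine wp_for G.m (fun t s' => s'.reg rNew = path (G.m - t) ∧
    ∀ i < G.m, G.m - t ≤ i → ∀ j < G.d,
      s'.arr aX (i * G.d + j) = G.share (path i) (path (i + 1)) j) (hG.m_lt.le.trans hQN)
    (by decide) (fun s' hF => (hE₁.frame hF).m) ⟨by simpa using hnew₁, fun i _ _ => by omega⟩ ?_
    (fun s' _ _ hI i hi j hj => hI.2 i hi (by omega) j hj)
  intro t s₂ ht hF₂ hrt ⟨hnew₂, hx₂⟩
  have hE₂ := hE₁.frame hF₂
  have htab₂ : s₂.arr aTab = s.arr aTab := by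
    rw [hF₂.arr _ (by decide), hF₁.arr _ (by decide)]
  obtain ⟨i, hi⟩ : ∃ i, G.m - 1 - t = i := ⟨_, rfl⟩
  have him : i < G.m := by omega
  have hnext : G.m - t = i + 1 := by omega
  rw [hnext] at hnew₂ hx₂
  have hcell := hpath i him
  refine .of_bounded fun _ hb₂ => ?_
  have hVnew : path (i + 1) ≤ V := hnew₂ ▸ hb₂.reg _
  have hVold : path i ≤ V := by
    have := hb.arr aTab ((i + 1) * G.S + path (i + 1))
    omega
  refine wp_seq_set_eq i (by simp [hE₂.m, hrt, hi]) (him.le.trans (hG.m_lt.le.trans (hQN.trans hNV)))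
    (wp_seq_set_eq (path i) (by simp [hE₂.S, hnew₂, htab₂, hcell]) hVold
    (wp_seq_set_eq (path i / (G.B * G.B)) (by simp [hE₂.B]) ((Nat.div_le_self _ _).trans hVold)
    (wp_seq_set_eq (path (i + 1) / (G.B * G.B)) (by simp [hE₂.B, hnew₂])
      ((Nat.div_le_self _ _).trans hVnew) ?_)))
  generalize hs₃ : State.setReg _ _ _ = s₃
  have hF₃ : Frame [ixI, rOld, rX, rY] [] s₂ s₃ :=
    hs₃ ▸ ((((Frame.refl _ _ s₂).setReg).setReg).setReg).setReg
  have hE₃ := hE₂.frame hF₃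
  have h3 : s₃.reg ixI = i ∧ s₃.reg rOld = path i ∧ s₃.reg rX = path i / (G.B * G.B) ∧
    s₃.reg rY = path (i + 1) / (G.B * G.B) := by simp [← hs₃]
  clear hs₃
  -- The rows from `i + 1` on are complete, and row `i` is complete for the types in `D`.
  let Filled : (ℕ → Prop) → State → Prop := fun D s' => ∀ i' < G.m, ∀ j < G.d,
    i + 1 ≤ i' ∨ i' = i ∧ D j →
      s'.arr aX (i' * G.d + j) = G.share (path i') (path (i' + 1)) j
  refine wp_seq (wp_for G.K (fun k s' =>
    s'.reg rX = path i / (G.B * G.B) / (G.B * G.B * G.B) ^ k ∧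
    s'.reg rY = path (i + 1) / (G.B * G.B) / (G.B * G.B * G.B) ^ k ∧
    Filled (fun j => G.cls j < k) s') hKN (by decide) (fun s' hF => (hE₃.frame hF).K)
    ⟨by simp [h3], by simp [h3], fun i' hi' j hj h => ?_⟩ ?_ ?_)
  · rw [State.setReg_arr, hF₃.arr _ (by decide)]
    exact hx₂ i' hi' (by omega) j hj
  · intro k s₄ hk hF₄ hrk ⟨hX, hY, hfill⟩
    have hE₄ := hE₃.frame hF₄
    have hi₄ : s₄.reg ixI = i := (hF₄.reg _ (by decide)).trans h3.1
    refine .of_bounded fun _ hb₄ => ?_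
    refine wp_seq_set_eq (G.num (path i) k) (by simp [hX, hE₄.B, Params.num])
      ((Nat.mod_lt _ hG.B_pos).le.trans (hG.B_le.trans hSV))
      (wp_seq_set_eq (path i / (G.B * G.B) / (G.B * G.B * G.B) ^ (k + 1))
      (by simp [hX, hE₄.B, Nat.div_div_eq_div_mul, pow_succ, mul_assoc])
      (((Nat.div_le_self _ _).trans (Nat.div_le_self _ _)).trans hVold)
      (wp_seq_set_eq (G.num (path (i + 1)) k) (by simp [hY, hE₄.B, Params.num])
      ((Nat.mod_lt _ hG.B_pos).le.trans (hG.B_le.trans hSV))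
      (wp_seq_set_eq (path (i + 1) / (G.B * G.B) / (G.B * G.B * G.B) ^ (k + 1))
      (by simp [hY, hE₄.B, Nat.div_div_eq_div_mul, pow_succ, mul_assoc])
      (((Nat.div_le_self _ _).trans (Nat.div_le_self _ _)).trans hVnew)
      (wp_seq_set_eq 0 rfl (Nat.zero_le _) ?_))))
    generalize hs₅ : State.setReg _ _ _ = s₅
    have hF₅ : Frame [rX, rY, rC, rCn, rSum] [] s₄ s₅ :=
      hs₅ ▸ (((((Frame.refl _ _ s₄).setReg).setReg).setReg).setReg).setReg
    have hE₅ := hE₄.frame hF₅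
    have h5 : s₅.reg rX = path i / (G.B * G.B) / (G.B * G.B * G.B) ^ (k + 1) ∧
        s₅.reg rY = path (i + 1) / (G.B * G.B) / (G.B * G.B * G.B) ^ (k + 1) ∧
        s₅.reg rC = G.num (path i) k ∧ s₅.reg rCn = G.num (path (i + 1)) k ∧
        s₅.reg rSum = 0 := by simp [← hs₅]
    clear hs₅
    refine wp_for G.d (fun j s' =>
      s'.reg rSum = ∑ j' ∈ Finset.range j, (if G.cls j' = k then G.cnt j' else 0) ∧
      Filled (fun j' => G.cls j' < k ∨ G.cls j' = k ∧ j' < j) s') hdN (by decide)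
      (fun s' hF => (hE₅.frame hF).d) ⟨by simp [h5], fun i' hi' j hj h => ?_⟩ ?_ ?_
    · rw [State.setReg_arr, hF₅.arr _ (by decide)]
      exact hfill i' hi' j hj (by omega)
    · intro j s₆ hj hF₆ hrj ⟨hsum, hfill₆⟩
      have hE₆ := hE₅.frame hF₆
      have hk₆ : s₆.reg ixK = k := by
        rw [hF₆.reg _ (by decide), hF₅.reg _ (by decide), hrk]
      have hi₆ : s₆.reg ixI = i := by
        rw [hF₆.reg _ (by decide), hF₅.reg _ (by decide), hi₄]
      have hC : s₆.reg rC = G.num (path i) k := by rw [hF₆.reg _ (by decide), h5.2.2.1]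
      have hCn : s₆.reg rCn = G.num (path (i + 1)) k := by
        rw [hF₆.reg _ (by decide), h5.2.2.2.1]
      have hc : ((clsT (§ixJ)).ne (§ixK)).eval s₆ = (G.cls j - k) + (k - G.cls j) := by
        rw [Term.eval_ne, hE₆.eval_clsT (by simpa [hrj] using hj)]
        simp [hrj, hk₆]
      refine wp_ite (fun h => wp_skip fun _ => ?_) (fun h => ?_)
      · rw [hc, Ne, sub_add_sub_eq_zero] at h
        refine ⟨by simp [hsum, Finset.sum_range_succ, h], fun i' hi' j' hj' h' => ?_⟩
        refine hfill₆ i' hi' j' hj' (h'.imp_right fun h'' => ⟨h''.1, h''.2.imp_right fun h₀ =>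
          ⟨h₀.1, ?_⟩⟩)
        rcases Nat.lt_succ_iff_lt_or_eq.1 h₀.2 with h₁ | rfl
        exacts [h₁, (h h₀.1).elim]
      · rw [hc, sub_add_sub_eq_zero] at h
        have hpre : s₆.reg rSum = G.pre j := by rw [hsum, Params.pre, h]
        have hval : (partT (§rCn) - partT (§rC)).eval s₆ =
            G.share (path i) (path (i + 1)) j := by
          rw [Term.eval_sub, hE₆.eval_partT (e := §rCn) hj hrj hCn hpre,
            hE₆.eval_partT (e := §rC) hj hrj hC hpre,
            Params.share, h]
        have hix : (§ixI * §rD + §ixJ : Term).eval s₆ = i * G.d + j := by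
          simp [hi₆, hE₆.d, hrj]
        refine wp_seq_put ?_ (wp_set ?_ fun _ => ?_)
        · rw [hval]
          exact (Nat.sub_le _ _).trans ((min_le_left _ _).trans ((Nat.sub_le _ _).trans
            ((Nat.mod_lt _ hG.B_pos).le.trans (hG.B_le.trans hSV))))
        · simp only [Term.eval_add, Term.eval_reg, Term.eval_get, State.setCell_reg,
            State.setCell_arr, Nat.reduceEqDiff, if_false, hsum, hrj, hE₆.cnt j hj]
          refine le_trans (le_of_eq ?_) ((Finset.sum_le_sum_of_subset
            (Finset.range_mono (Nat.succ_le_of_lt hj))).trans ((hG.size_le k).trans hSV))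
          rw [Finset.sum_range_succ, if_pos h]
        · rw [hval, hix]
          refine ⟨by simp [hsum, hrj, hE₆.cnt j hj, Finset.sum_range_succ, h],
            fun i' hi' j' hj' h' => ?_⟩
          simp only [State.setReg_arr, State.setCell_arr, if_true, Function.update_apply]
          split_ifs with h₀
          · obtain ⟨rfl, rfl⟩ := eq_of_mul_add_eq hj' hj h₀
            rfl
          · refine hfill₆ i' hi' j' hj' (h'.imp_right fun h'' => ⟨h''.1, h''.2.imp_right
              fun h₁ => ⟨h₁.1, ?_⟩⟩)
            rcases Nat.lt_succ_iff_lt_or_eq.1 h₁.2 with h₂ | rfl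
            exacts [h₂, (h₀ (by rw [h''.1])).elim]
    · intro s₆ hF₆ _ ⟨_, hfill₆⟩ _
      refine ⟨?_, ?_, fun i' hi' j hj h => ?_⟩
      · rw [State.setReg_reg, if_neg (by decide), hF₆.reg _ (by decide), h5.1]
      · rw [State.setReg_reg, if_neg (by decide), hF₆.reg _ (by decide), h5.2.1]
      · exact hfill₆ i' hi' j hj (by omega)
  · intro s₄ hF₄ _ ⟨_, _, hfill⟩ _
    have hold : s₄.reg rOld = path i := (hF₄.reg _ (by decide)).trans h3.2.1
    refine wp_set (by simpa [hold] using hVold) fun _ => ?_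
    have : G.m - (t + 1) = i := by omega
    rw [this]
    refine ⟨by simp [hold], fun i' hi' hle j hj => hfill i' hi' j hj ?_⟩
    have hK : G.cls j < G.K := by
      rw [hG.K_eq]
      exact Nat.lt_succ_of_le (Nat.div_le_div_right (hG.p_le j hj))
    omega

/-- The numbers of jobs in the state are `x`. -/
def HasJobs (G : Params) (x : ℕ → ℕ → ℕ) (s : State) : Prop :=
  ∀ i < G.m, ∀ j < G.d, s.arr aX (i * G.d + j) = x i j

theorem wp_addBase {V N : ℕ} {G : Params} {s : State} (hE : Env G s) (hN : G.m * G.d ≤ N)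
    {x : ℕ → ℕ → ℕ} (hx : HasJobs G x s) (hV : ∀ i < G.m, ∀ j < G.d, x i j + G.base j ≤ V) :
    WP V N addBase (HasJobs G fun i j => x i j + G.base j) s := by
  refine wp_for (G.m * G.d) (fun k s' => ∀ i < G.m, ∀ j < G.d, s'.arr aX (i * G.d + j) =
    if i * G.d + j < k then x i j + G.base j else x i j) hN (by decide)
    (fun s' hF => by simp [(hE.frame hF).m, (hE.frame hF).d])
    (fun i hi j hj => by simpa using hx i hi j hj) ?_ ?_
  · intro k s₁ hk hF hrk hI
    have hE₁ := hE.frame hF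
    have hd : 0 < G.d := Nat.pos_of_ne_zero fun h => by simp [h] at hk
    have hi : k / G.d < G.m := Nat.div_lt_of_lt_mul (by rwa [mul_comm])
    have hj : k % G.d < G.d := Nat.mod_lt _ hd
    have hdm : k / G.d * G.d + k % G.d = k := Nat.div_add_mod' _ _
    have hval : (Term.get aX (§ixK) + .get aBase ((§ixK).mod (§rD))).eval s₁ =
        x (k / G.d) (k % G.d) + G.base (k % G.d) := by
      have := hI _ hi _ hj
      rw [hdm, if_neg (lt_irrefl _)] at this
      simp [hrk, this, hE₁.d, hE₁.base _ hj]
    refine wp_put ?_ fun _ i hi' j hj' => ?_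
    · rw [hval]
      exact hV _ hi _ hj
    · rw [hval]
      simp only [Term.eval_reg, hrk, State.setReg_arr, State.setCell_arr, if_true,
        Function.update_apply, hI i hi' j hj']
      by_cases h : i * G.d + j = k
      · obtain ⟨rfl, rfl⟩ := eq_of_mul_add_eq hj' hj (h.trans hdm.symm)
        simp [h]
      · rw [if_neg h]
        have : i * G.d + j < k + 1 ↔ i * G.d + j < k := by omega
        simp [this]
  · intro s' _ _ hI i hi j hj
    rw [hI i hi j hj, if_pos]
    calc i * G.d + j < i * G.d + G.d := by omega
      _ = (i + 1) * G.d := by ring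
      _ ≤ G.m * G.d := Nat.mul_le_mul_right _ hi

/-- The load of the machine `i` for the numbers of jobs `x`. -/
def Params.load (G : Params) (x : ℕ → ℕ → ℕ) (i : ℕ) : ℕ :=
  ∑ j ∈ Finset.range G.d, x i j * G.p j

/-- The loads and sizes are initialized, and the labels are zero. -/
structure Prepared (G : Params) (E v : ℕ → ℕ) (thr : ℕ) (s : State) : Prop where
  load : ∀ i < G.m, s.arr aLoad i = E i
  label : ∀ i < G.m, s.arr aLabel i = 0
  size : ∀ j < G.d, s.arr aSize j = v j
  thr : s.reg rThr = thr

theorem wp_prepareAbove {V N : ℕ} {G : Params} {s : State} (hE : Env G s) (hG : G.Good)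
    (hN : G.S ≤ N) {x : ℕ → ℕ → ℕ} (hx : HasJobs G x s)
    (hV : ∀ i < G.m, G.load x i ≤ G.Q * G.pm) :
    WP V N prepareAbove (Prepared G (G.load x) G.p (G.up (s.reg rBest) + 1)) s := by
  refine .of_bounded fun hNV hb => ?_
  have hSV : G.S ≤ V := hN.trans hNV
  have hQN : G.Q ≤ N := hG.Q_lt.le.trans (hG.B_le.trans hN)
  have hdN : G.d ≤ N := hG.d_le.trans (hG.pm_lt.le.trans hQN)
  have hQp : G.Q * G.pm ≤ V := (Nat.mul_le_mul_left _ hG.pm_lt.le).trans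
    (hG.Q_mul_Q_lt.le.trans (hG.B_le.trans hSV))
  refine wp_seq (wp_for G.m (fun k s' => (∀ i < k, s'.arr aLoad i = G.load x i) ∧
    ∀ i < k, s'.arr aLabel i = 0) (hG.m_lt.le.trans hQN) (by decide)
    (fun s' hF => (hE.frame hF).m) ⟨fun _ h => by omega, fun _ h => by omega⟩ ?_ ?_)
  · intro i s₁ hi hF hri ⟨hl, hlab⟩
    have hE₁ := hE.frame hF
    have hx₁ : s₁.arr aX = s.arr aX := hF.arr _ (by decide)
    refine wp_sum (n := G.d) (fun j => x i j * G.p j) (by decide) hdN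
      (fun s' hF' => (hE₁.frame hF').d) (fun s' hF' hj => ?_) ((hV i hi).trans hQp)
      (fun s₂ hF₂ hsum => ?_)
    · have hE' := hE₁.frame hF'
      simp [hF'.reg ixI (by decide), hri, hE'.d, hE'.p _ hj, hF'.arr aX (by decide), hx₁,
        hx i hi _ hj]
    change s₂.reg rAcc = G.load x i at hsum
    have hri₂ : s₂.reg ixI = i := (hF₂.reg _ (by decide)).trans hri
    refine wp_seq_put (by simpa [hsum] using (hV i hi).trans hQp) (wp_put (Nat.zero_le _) fun _ => ?_)
    have e1 : s₂.arr aLoad = s₁.arr aLoad := hF₂.arr _ (by decide)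
    have e2 : s₂.arr aLabel = s₁.arr aLabel := hF₂.arr _ (by decide)
    constructor
    all_goals
      intro i' hi'
      simp only [Term.eval_reg, State.setReg_arr, State.setCell_arr, State.setCell_reg, if_true,
        Nat.reduceEqDiff, if_false, Function.update_apply, hri₂, hsum, e1, e2, Term.eval_zero]
      split_ifs with h
    · rw [h]
    · exact hl i' (by omega)
    · rfl
    · exact hlab i' (by omega)
  intro s₁ hF₁ _ ⟨hl, hlab⟩ _
  have hE₁ := hE.frame hF₁
  refine wp_seq (wp_for G.d (fun k s' => ∀ j < k, s'.arr aSize j = G.p j) hdN (by decide)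
    (fun s' hF => (hE₁.frame hF).d) (fun _ h => by omega) ?_ ?_)
  · intro j s₂ hj hF₂ hrj hI
    have hE₂ := hE₁.frame hF₂
    refine .of_bounded fun _ hb₂ => wp_put (hb₂.arr _ _) fun _ => ?_
    intro j' hj'
    simp only [Term.eval_reg, Term.eval_get, State.setReg_arr, State.setCell_arr, if_true,
      Function.update_apply, hrj, hE₂.p j hj]
    split_ifs with h
    · rw [h]
    · exact hI j' (by omega)
  intro s₂ hF₂ _ hI _
  have hE₂ := hE₁.frame hF₂
  have hbest : s₂.reg rBest = s.reg rBest := by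
    rw [hF₂.reg _ (by decide), hF₁.reg _ (by decide)]
  have hval : ((§rBest / §rB).mod (§rB) + 1 : Term).eval s₂ = G.up (s.reg rBest) + 1 := by
    simp [hbest, hE₂.B, Params.up]
  refine wp_set ?_ ⟨?_, ?_, ?_, ?_⟩
  · rw [hval]
    have : G.up (s.reg rBest) < G.B := Nat.mod_lt _ hG.B_pos
    have := hG.B_le
    omega
  · intro i hi
    rw [State.setReg_arr, hF₂.arr _ (by decide), hl i hi]
  · intro i hi
    rw [State.setReg_arr, hF₂.arr _ (by decide), hlab i hi]
  · simpa using hI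
  · rw [hval]
    simp

theorem wp_prepareBelow {V N : ℕ} {G : Params} {s : State} (hE : Env G s) (hG : G.Good)
    (hN : G.S ≤ N) {L : ℕ → ℕ} (hL : ∀ i < G.m, s.arr aLoad i = L i) :
    WP V N prepareBelow (Prepared G (fun i => G.Q * G.pm - L i) (fun j => G.pm - G.p j)
      (G.Q * G.pm + 1 - G.lo (s.reg rBest))) s := by
  refine .of_bounded fun hNV hb => ?_
  have hSV : G.S ≤ V := hN.trans hNV
  have hQN : G.Q ≤ N := hG.Q_lt.le.trans (hG.B_le.trans hN)
  have hdN : G.d ≤ N := hG.d_le.trans (hG.pm_lt.le.trans hQN)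
  have hQp : G.Q * G.pm + 1 ≤ V := by
    have := (Nat.mul_le_mul_left G.Q hG.pm_lt.le).trans_lt
      (hG.Q_mul_Q_lt.trans_le (hG.B_le.trans hSV))
    omega
  refine wp_seq (wp_for G.m (fun k s' => (∀ i < G.m, s'.arr aLoad i =
    if i < k then G.Q * G.pm - L i else L i) ∧
    ∀ i < k, s'.arr aLabel i = 0) (hG.m_lt.le.trans hQN) (by decide)
    (fun s' hF => (hE.frame hF).m) ⟨fun i hi => by simpa using hL i hi, fun _ h => by omega⟩ ?_ ?_)
  · intro i s₁ hi hF hri ⟨hl, hlab⟩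
    have hE₁ := hE.frame hF
    have hval : (§rQ * §rPmax - .get aLoad (§ixI) : Term).eval s₁ = G.Q * G.pm - L i := by
      simp [hE₁.Q, hE₁.pm, hri, hl i hi]
    refine wp_seq_put (by rw [hval]; omega) (wp_put (Nat.zero_le _) fun _ => ?_)
    rw [hval]
    constructor
    all_goals
      intro i' hi'
      simp only [Term.eval_reg, State.setReg_arr, State.setCell_arr, State.setCell_reg, if_true,
        Nat.reduceEqDiff, if_false, Function.update_apply, hri, Term.eval_zero]
    · rw [hl i' hi']
      split_ifs with h1 h2 <;> first | omega | rw [h1]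
    · split_ifs with h
      exacts [rfl, hlab i' (by omega)]
  intro s₁ hF₁ _ ⟨hl, hlab⟩ _
  have hE₁ := hE.frame hF₁
  refine wp_seq (wp_for G.d (fun k s' => ∀ j < k, s'.arr aSize j = G.pm - G.p j) hdN (by decide)
    (fun s' hF => (hE₁.frame hF).d) (fun _ h => by omega) ?_ ?_)
  · intro j s₂ hj hF₂ hrj hI
    have hE₂ := hE₁.frame hF₂
    refine .of_bounded fun _ hb₂ => wp_put ((Nat.sub_le _ _).trans (hb₂.reg _)) fun _ => ?_
    intro j' hj'
    simp only [Term.eval_reg, Term.eval_get, Term.eval_sub, State.setReg_arr, State.setCell_arr,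
      if_true, Function.update_apply, hrj, hE₂.p j hj, hE₂.pm]
    split_ifs with h
    · rw [h]
    · exact hI j' (by omega)
  intro s₂ hF₂ _ hI _
  have hE₂ := hE₁.frame hF₂
  have hbest : s₂.reg rBest = s.reg rBest := by
    rw [hF₂.reg _ (by decide), hF₁.reg _ (by decide)]
  have hval : (§rQ * §rPmax + 1 - (§rBest).mod (§rB) : Term).eval s₂ =
      G.Q * G.pm + 1 - G.lo (s.reg rBest) := by
    simp [hbest, hE₂.B, hE₂.Q, hE₂.pm, Params.lo]
  refine wp_set ?_ ⟨?_, ?_, ?_, ?_⟩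
  · rw [hval]
    omega
  · intro i hi
    rw [State.setReg_arr, hF₂.arr _ (by decide), hl i hi, if_pos hi]
  · intro i hi
    rw [State.setReg_arr, hF₂.arr _ (by decide), hlab i hi]
  · simpa using hI
  · rw [hval]
    simp

end Scheduling

/-! ### Balancing the loads by pushing and relabelling -/

namespace Scheduling

open WordRAM Finset

/-- The numbers of jobs after a job of type `a` on machine `i` has been exchanged for one of type
`b` on machine `i'`. -/
def swapJobs (x : ℕ → ℕ → ℕ) (i i' a b r j : ℕ) : ℕ :=
  if r = i then (if j = a then x r j - 1 else if j = b then x r j + 1 else x r j)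
  else if r = i' then (if j = a then x r j + 1 else if j = b then x r j - 1 else x r j)
  else x r j

/-- The loads after `δ` has been shifted from `i` to `i'`. -/
def shiftLoad (E : ℕ → ℕ) (δ i i' r : ℕ) : ℕ :=
  if r = i then E r - δ else if r = i' then E r + δ else E r

/-- Two machines hold jobs of the same class such that the exchange shifts load from `i` to
`i'`. -/
structure Edge (G : Params) (v : ℕ → ℕ) (x : ℕ → ℕ → ℕ) (i i' a b : ℕ) : Prop where
  cls : G.cls a = G.cls b
  lt : v b < v a
  left : 0 < x i a
  right : 0 < x i' b

/-- `x` and `E` arise from `x₀` and `E₀` by exchanges of jobs of the same class, where the jobs of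
type `j` have size `v j`. -/
structure Rearranged (G : Params) (v : ℕ → ℕ) (x₀ : ℕ → ℕ → ℕ) (E₀ : ℕ → ℕ)
    (x : ℕ → ℕ → ℕ) (E : ℕ → ℕ) : Prop where
  cols : ∀ j < G.d, ∑ i ∈ range G.m, x i j = ∑ i ∈ range G.m, x₀ i j
  rows : ∀ i < G.m, ∀ k, ∑ j ∈ range G.d, x i j * (if G.cls j = k then 1 else 0) =
    ∑ j ∈ range G.d, x₀ i j * (if G.cls j = k then 1 else 0)
  load : ∀ i < G.m, E i + ∑ j ∈ range G.d, x₀ i j * v j = E₀ i + ∑ j ∈ range G.d, x i j * v j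

/-- The invariant of the push-relabel method with labels `h`. -/
structure Balancing (G : Params) (v : ℕ → ℕ) (thr : ℕ) (x₀ : ℕ → ℕ → ℕ) (E₀ : ℕ → ℕ)
    (x : ℕ → ℕ → ℕ) (E h : ℕ → ℕ) : Prop extends Rearranged G v x₀ E₀ x E where
  total : ∑ i ∈ range G.m, E i = ∑ i ∈ range G.m, E₀ i
  edge : ∀ i < G.m, ∀ i' < G.m, ∀ a < G.d, ∀ b < G.d, Edge G v x i i' a b → h i ≤ h i' + 1
  above : ∀ i < G.m, 0 < h i → thr ≤ E i
  floor : ∀ i < G.m, min (E₀ i) thr ≤ E i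

/-- A set of machines from which no load can be shifted to the other machines has less load than
the threshold, on average. -/
def CutCondition (G : Params) (v : ℕ → ℕ) (thr : ℕ) (x₀ : ℕ → ℕ → ℕ) (E₀ : ℕ → ℕ) : Prop :=
  ∀ x E, Rearranged G v x₀ E₀ x E → ∀ R ⊆ range G.m, R.Nonempty →
    (∀ i ∈ R, ∀ i' < G.m, i' ∉ R → ∀ a < G.d, ∀ b < G.d, ¬ Edge G v x i i' a b) →
    ∑ i ∈ R, E i < R.card * thr

theorem sum_swapJobs {x : ℕ → ℕ → ℕ} {i i' a b : ℕ} {d : ℕ} (hii : i ≠ i') (hab : a ≠ b)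
    (ha : a < d) (hb : b < d) (h1 : 0 < x i a) (h2 : 0 < x i' b) (g : ℕ → ℕ) (r : ℕ) :
    ∑ j ∈ range d, swapJobs x i i' a b r j * g j + (if r = i then g a else 0) +
        (if r = i' then g b else 0) =
      ∑ j ∈ range d, x r j * g j + (if r = i then g b else 0) + (if r = i' then g a else 0) := by
  have e : ∀ c < d, ∀ q : Prop, ∀ [Decidable q], (if q then g c else 0) =
      ∑ j ∈ range d, (if q ∧ j = c then 1 else 0) * g j := by
    intro c hc q _
    by_cases hq : q
    · simp [hq, hc]
    · simp [hq]
  rw [e a ha, e b hb, e b hb, e a ha, ← sum_add_distrib, ← sum_add_distrib, ← sum_add_distrib,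
    ← sum_add_distrib]
  refine sum_congr rfl fun j _ => ?_
  rw [← add_mul, ← add_mul, ← add_mul, ← add_mul]
  congr 1
  rw [swapJobs]
  by_cases hr : r = i
  · subst hr
    by_cases hj : j = a
    · subst hj
      simp [hii, hab]
      omega
    · by_cases hj' : j = b <;> simp [hii, hj, hj']
      simp [hab.symm]
  · by_cases hr' : r = i'
    · subst hr'
      by_cases hj : j = a
      · subst hj
        simp [hr, hab]
      · by_cases hj' : j = b
        · subst hj'
          simp [hr, hj]
          omega
        · simp [hr, hj, hj']
    · simp [hr, hr']

theorem sum_eq_add_add_erase {m i i' : ℕ} (hii : i ≠ i') (hi : i < m) (hi' : i' < m)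
    (g : ℕ → ℕ) : ∑ r ∈ range m, g r =
      g i + (g i' + ∑ r ∈ ((range m).erase i).erase i', g r) := by
  rw [← add_sum_erase _ _ (mem_range.2 hi),
    ← add_sum_erase _ _ (mem_erase.2 ⟨hii.symm, mem_range.2 hi'⟩)]

theorem sum_shiftLoad {m i i' δ : ℕ} {E : ℕ → ℕ} (hii : i ≠ i') (hi : i < m) (hi' : i' < m)
    (f : ℕ → ℕ → ℕ) : ∑ r ∈ range m, f r (shiftLoad E δ i i' r) =
      f i (E i - δ) + (f i' (E i' + δ) +
        ∑ r ∈ ((range m).erase i).erase i', f r (E r)) := by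
  rw [sum_eq_add_add_erase hii hi hi']
  congr 1
  · simp [shiftLoad]
  congr 1
  · simp [shiftLoad, hii.symm]
  · refine sum_congr rfl fun r hr => ?_
    rw [mem_erase, mem_erase] at hr
    simp [shiftLoad, hr.1, hr.2.1]

theorem sum_col_swapJobs {x : ℕ → ℕ → ℕ} {i i' a b m : ℕ} (hii : i ≠ i') (hi : i < m) (hi' : i' < m)
    (h1 : 0 < x i a) (h2 : 0 < x i' b) (hab : a ≠ b) (j : ℕ) :
    ∑ r ∈ range m, swapJobs x i i' a b r j = ∑ r ∈ range m, x r j := by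
  rw [sum_eq_add_add_erase hii hi hi', sum_eq_add_add_erase hii hi hi' fun r => x r j]
  have : ∑ r ∈ ((range m).erase i).erase i', swapJobs x i i' a b r j =
      ∑ r ∈ ((range m).erase i).erase i', x r j := by
    refine sum_congr rfl fun r hr => ?_
    rw [mem_erase, mem_erase] at hr
    simp [swapJobs, hr.1, hr.2.1]
  rw [this]
  simp only [swapJobs, if_true, if_neg hii.symm]
  by_cases hja : j = a
  · subst hja
    simp
    omega
  · by_cases hjb : j = b
    · subst hjb
      simp [hja]
      omega
    · simp [hja, hjb]

theorem Rearranged.swap {G : Params} {v : ℕ → ℕ} {x₀ : ℕ → ℕ → ℕ} {E₀ : ℕ → ℕ} {x : ℕ → ℕ → ℕ}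
    {E : ℕ → ℕ} {i i' a b : ℕ} (h : Rearranged G v x₀ E₀ x E) (hi : i < G.m) (hi' : i' < G.m)
    (ha : a < G.d) (hb : b < G.d) (hii : i ≠ i') (he : Edge G v x i i' a b)
    (hle : v a - v b ≤ E i) :
    Rearranged G v x₀ E₀ (swapJobs x i i' a b) (shiftLoad E (v a - v b) i i') := by
  have hab : a ≠ b := by
    rintro rfl
    exact lt_irrefl _ he.lt
  have hlt := he.lt
  refine ⟨fun j hj => ?_, fun r hr k => ?_, fun r hr => ?_⟩
  · rw [sum_col_swapJobs hii hi hi' he.left he.right hab, h.cols j hj]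
  · have := sum_swapJobs hii hab ha hb he.left he.right (fun j => if G.cls j = k then 1 else 0) r
    rw [← h.rows r hr k]
    simp only [he.cls] at this
    omega
  · have := sum_swapJobs hii hab ha hb he.left he.right v r
    have h0 := h.load r hr
    rw [shiftLoad]
    by_cases h1 : r = i
    · subst h1
      simp [hii] at this ⊢
      omega
    · by_cases h2 : r = i'
      · subst h2
        simp [h1] at this ⊢
        omega
      · simp [h1, h2] at this ⊢
        omega

section Potential

variable {G : Params} {v : ℕ → ℕ} {thr : ℕ} {x₀ : ℕ → ℕ → ℕ} {E₀ : ℕ → ℕ} {x : ℕ → ℕ → ℕ}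
  {E h : ℕ → ℕ}

/-- All labels are less than the number of machines: otherwise some label is skipped, and no load
can be shifted from the machines above this gap. -/
theorem Balancing.label_lt (hB : Balancing G v thr x₀ E₀ x E h)
    (hcut : CutCondition G v thr x₀ E₀) {i : ℕ} (hi : i < G.m) : h i < G.m := by
  by_contra hcon
  push Not at hcon
  obtain ⟨g, hg, hgap⟩ : ∃ g < G.m, ∀ r < G.m, h r ≠ g := by
    by_contra hno
    push Not at hno
    have hsub : range G.m ⊆ ((range G.m).erase i).image h := by
      intro g hg
      obtain ⟨r, hr, rfl⟩ := hno g (mem_range.1 hg)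
      rw [mem_range] at hg
      exact mem_image_of_mem _ (mem_erase.2 ⟨fun e => by subst e; omega, mem_range.2 hr⟩)
    have := (card_le_card hsub).trans card_image_le
    rw [card_erase_of_mem (mem_range.2 hi), card_range] at this
    omega
  have hR : ∀ {r}, r ∈ (range G.m).filter (fun r => g < h r) ↔ r < G.m ∧ g < h r := by
    simp
  have := hcut x E hB.toRearranged ((range G.m).filter fun r => g < h r) (filter_subset _ _)
    ⟨i, hR.2 ⟨hi, by omega⟩⟩ (fun r hr r' hr' hnot a ha b hb he => by
      rw [hR] at hr hnot
      have h1 := hB.edge r hr.1 r' hr' a ha b hb he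
      have h2 := hgap r' hr'
      have h3 : ¬ g < h r' := fun hlt => hnot ⟨hr', hlt⟩
      omega)
  have h2 : ((range G.m).filter fun r => g < h r).card * thr ≤
      ∑ r ∈ (range G.m).filter (fun r => g < h r), E r := by
    rw [← smul_eq_mul]
    refine card_nsmul_le_sum _ _ _ fun r hr => ?_
    rw [hR] at hr
    exact hB.above r hr.1 (by omega)
  omega

/-- The potential: it decreases with every push, since load moves to a machine with a smaller label,
and with every relabelling. -/
def potential (G : Params) (T : ℕ) (E h : ℕ → ℕ) : ℕ :=
  ∑ i ∈ range G.m, (h i * E i + (T + 1) * (G.m - h i))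

theorem Balancing.potential_pos (hB : Balancing G v thr x₀ E₀ x E h)
    (hcut : CutCondition G v thr x₀ E₀) (hm : 0 < G.m) (T : ℕ) : 0 < potential G T E h := by
  refine sum_pos (fun i hi => ?_) ⟨0, mem_range.2 hm⟩
  have := hB.label_lt hcut (mem_range.1 hi)
  have h1 : 0 < (T + 1) * (G.m - h i) := Nat.mul_pos (by omega) (by omega)
  omega

theorem Balancing.push (hB : Balancing G v thr x₀ E₀ x E h) {i i' a b : ℕ}
    (hi : i < G.m) (hi' : i' < G.m) (ha : a < G.d) (hb : b < G.d) (hlab : h i = h i' + 1)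
    (he : Edge G v x i i' a b) (hw : v a ≤ v b + G.w) (hact : thr + G.w ≤ E i) (T : ℕ) :
    Balancing G v thr x₀ E₀ (swapJobs x i i' a b) (shiftLoad E (v a - v b) i i') h ∧
      potential G T (shiftLoad E (v a - v b) i i') h < potential G T E h := by
  have hii : i ≠ i' := by
    rintro rfl
    omega
  have hlt := he.lt
  have hpos : ∀ r j, 0 < swapJobs x i i' a b r j → 0 < x r j ∨ r = i ∧ j = b ∨ r = i' ∧ j = a := by
    intro r j
    rw [swapJobs]
    split_ifs with h1 h2 h3 h4 h5 <;> intro h0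
    · exact .inl (by omega)
    · exact .inr (.inl ⟨h1, h3⟩)
    · exact .inl h0
    · exact .inr (.inr ⟨h4, ‹_›⟩)
    · exact .inl (by omega)
    · exact .inl h0
    · exact .inl h0
  have hsum := sum_shiftLoad (E := E) (δ := v a - v b) hii hi hi'
  have hsum' : ∀ f : ℕ → ℕ → ℕ, ∑ r ∈ range G.m, f r (E r) =
      f i (E i) + (f i' (E i') + ∑ r ∈ ((range G.m).erase i).erase i', f r (E r)) :=
    fun f => sum_eq_add_add_erase hii hi hi' fun r => f r (E r)
  refine ⟨⟨hB.toRearranged.swap hi hi' ha hb hii he (by omega), ?_, ?_, ?_, ?_⟩, ?_⟩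
  · rw [← hB.total, hsum fun _ e => e, hsum' fun _ e => e]
    omega
  · -- An edge that the exchange creates can be replaced by two old ones.
    intro r hr r' hr' c hc c' hc' he'
    have old : ∀ r < G.m, ∀ r' < G.m, ∀ c < G.d, ∀ c' < G.d, G.cls c = G.cls c' → v c' < v c →
        0 < x r c → 0 < x r' c' → h r ≤ h r' + 1 := fun r hr r' hr' c hc c' hc' h1 h2 h3 h4 =>
      hB.edge r hr r' hr' c hc c' hc' ⟨h1, h2, h3, h4⟩
    have hc₁ := he'.cls
    have hv₁ := he'.lt
    have hcl := he.cls
    rcases hpos r c he'.left with h1 | ⟨rfl, rfl⟩ | ⟨rfl, rfl⟩ <;>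
    rcases hpos r' c' he'.right with h2 | ⟨rfl, rfl⟩ | ⟨rfl, rfl⟩
    · exact old r hr r' hr' c hc c' hc' hc₁ hv₁ h1 h2
    · have := old r hr i' hi' c hc c' hb hc₁ hv₁ h1 he.right
      omega
    · have := old r hr r' hi' c hc b hb (hc₁.trans hcl) (hlt.trans hv₁) h1 he.right
      omega
    · have := old r hi r' hr' a ha c' hc' (hcl.trans hc₁) (hv₁.trans hlt) he.left h2
      omega
    · omega
    · omega
    · have := old i hi r' hr' c ha c' hc' hc₁ hv₁ he.left h2
      omega
    · omega
    · omega
  · intro r hr h0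
    have := hB.above r hr h0
    rw [shiftLoad]
    split_ifs with h1
    · subst h1
      omega
    · omega
    · omega
  · intro r hr
    have := hB.floor r hr
    rw [shiftLoad]
    split_ifs with h1
    · subst h1
      omega
    · omega
    · omega
  · rw [potential, potential, hsum fun r e => h r * e + (T + 1) * (G.m - h r),
      hsum' fun r e => h r * e + (T + 1) * (G.m - h r), hlab]
    obtain ⟨δ, hδ⟩ : ∃ δ, v a - v b = δ := ⟨_, rfl⟩
    obtain ⟨y, hy⟩ : ∃ y, E i = y + δ := ⟨E i - δ, by omega⟩
    have hδ0 : 0 < δ := by omega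
    rw [hδ, hy, Nat.add_sub_cancel]
    nlinarith

theorem Balancing.relabel (hB : Balancing G v thr x₀ E₀ x E h)
    (hcut : CutCondition G v thr x₀ E₀) {i : ℕ} (hi : i < G.m) (hact : thr ≤ E i)
    (hno : ∀ i' < G.m, ∀ a < G.d, ∀ b < G.d, h i = h i' + 1 → ¬ Edge G v x i i' a b) {T : ℕ}
    (hT : ∑ i ∈ range G.m, E i ≤ T) :
    Balancing G v thr x₀ E₀ x E (Function.update h i (h i + 1)) ∧
      potential G T E (Function.update h i (h i + 1)) < potential G T E h := by
  refine ⟨⟨hB.toRearranged, hB.total, ?_, ?_, hB.floor⟩, ?_⟩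
  · intro r hr r' hr' a ha b hb he
    have h1 := hB.edge r hr r' hr' a ha b hb he
    rw [Function.update_apply, Function.update_apply]
    split_ifs with h2 h3 h3
    · omega
    · subst h2
      have : h r ≠ h r' + 1 := fun h => hno r' hr' a ha b hb h he
      omega
    · subst h3
      omega
    · exact h1
  · intro r hr h0
    rw [Function.update_apply] at h0
    split_ifs at h0 with h1
    · rwa [h1]
    · exact hB.above r hr h0
  · have hlt := hB.label_lt hcut hi
    have hE : E i ≤ T := (single_le_sum (fun _ _ => Nat.zero_le _) (mem_range.2 hi)).trans hT
    rw [potential, potential, ← add_sum_erase _ _ (mem_range.2 hi),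
      ← add_sum_erase (range G.m) (fun r => h r * E r + (T + 1) * (G.m - h r)) (mem_range.2 hi)]
    refine add_lt_add_of_lt_of_le ?_ (le_of_eq (sum_congr rfl fun r hr => ?_))
    · obtain ⟨c, hc⟩ : ∃ c, G.m - h i = c + 1 := ⟨G.m - h i - 1, by omega⟩
      rw [Function.update_self, hc, show G.m - (h i + 1) = c by omega]
      nlinarith
    · rw [Function.update_of_ne (mem_erase.1 hr).1]

end Potential

end Scheduling

/-! ### The balancing program -/

namespace Scheduling

open WordRAM Finset

/-- The state holds the numbers of jobs `x`, the loads `E`, the labels `h` and the sizes `v`. -/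
structure Config (G : Params) (v : ℕ → ℕ) (thr : ℕ) (x : ℕ → ℕ → ℕ) (E h : ℕ → ℕ) (s : State) :
    Prop where
  jobs : HasJobs G x s
  load : ∀ i < G.m, s.arr aLoad i = E i
  label : ∀ i < G.m, s.arr aLabel i = h i
  size : ∀ j < G.d, s.arr aSize j = v j
  thr : s.reg rThr = thr

theorem Config.frame {G : Params} {v : ℕ → ℕ} {thr : ℕ} {x : ℕ → ℕ → ℕ} {E h : ℕ → ℕ}
    {s s' : State} {R A : List ℕ} (hC : Config G v thr x E h s) (hF : Frame R A s s')
    (hR : rThr ∉ R := by decide)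
    (hA : ∀ a ∈ [aX, aLoad, aLabel, aSize], a ∉ A := by decide) : Config G v thr x E h s' := by
  simp only [List.mem_cons, List.not_mem_nil, or_false, forall_eq_or_imp, forall_eq] at hA
  obtain ⟨a0, a1, a2, a3⟩ := hA
  constructor
  · intro i hi j hj
    rw [hF.arr _ a0, hC.jobs i hi j hj]
  all_goals simp only [hF.reg _ hR, hF.arr _ a1, hF.arr _ a2, hF.arr _ a3]
  exacts [hC.load, hC.label, hC.size, hC.thr]

theorem mul_add_lt {i m j d : ℕ} (hi : i < m) (hj : j < d) : i * d + j < m * d :=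
  calc i * d + j < i * d + d := by omega
    _ = (i + 1) * d := by ring
    _ ≤ m * d := Nat.mul_le_mul_right _ hi

theorem wp_swap {V N : ℕ} {G : Params} {v : ℕ → ℕ} {thr : ℕ} {x : ℕ → ℕ → ℕ} {E h : ℕ → ℕ}
    {s : State} (hE : Env G s) (hC : Config G v thr x E h s) {i i' a b : ℕ} (hi : i < G.m)
    (hi' : i' < G.m) (ha : a < G.d) (hb : b < G.d) (hii : i ≠ i') (he : Edge G v x i i' a b)
    (hri : s.reg ixI = i) (hri' : s.reg rTo = i') (hra : s.reg rX = a) (hrb : s.reg rY = b)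
    (hV : x i' a + 1 ≤ V) (hV' : x i b + 1 ≤ V) (hVE : E i' + (v a - v b) ≤ V) :
    WP V N swap (Config G v thr (swapJobs x i i' a b) (shiftLoad E (v a - v b) i i') h) s := by
  refine .of_bounded fun _ hbd => ?_
  have hab : a ≠ b := by
    rintro rfl
    exact lt_irrefl _ he.lt
  have inj : ∀ {r j r' j'}, j < G.d → j' < G.d →
      (r * G.d + j = r' * G.d + j' ↔ r = r' ∧ j = j') := fun hj hj' =>
    ⟨eq_of_mul_add_eq hj hj', by rintro ⟨rfl, rfl⟩; rfl⟩
  have hx₁ := hC.jobs i hi a ha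
  have hx₂ := hC.jobs i' hi' a ha
  have hx₃ := hC.jobs i hi b hb
  have hx₄ := hC.jobs i' hi' b hb
  have hd := hE.d
  have bx := hbd.arr aX
  have bl := hbd.arr aLoad i
  rw [hC.load i hi] at bl
  have b1 := bx (i * G.d + a)
  rw [hx₁] at b1
  have b4 := bx (i' * G.d + b)
  rw [hx₄] at b4
  refine wp_seq_put ?_ (wp_seq_put ?_ (wp_seq_put ?_ (wp_seq_put ?_ (wp_seq_put ?_
    (wp_put ?_ ?_)))))
  all_goals simp only [Term.eval_add, Term.eval_sub, Term.eval_mul, Term.eval_reg, Term.eval_get,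
    Term.eval_one, State.setCell_reg, State.setCell_arr, if_true, Nat.reduceEqDiff, if_false,
    Function.update_apply,
    hri, hri', hra, hrb, hd, inj ha ha, inj hb ha, inj hb hb, hab.symm, hii,
    hii.symm, and_true, and_false, hx₁, hx₂, hx₃, hx₄, hC.load i hi, hC.load i' hi',
    hC.size a ha, hC.size b hb]
  · omega
  · exact hV
  · exact hV'
  · omega
  · omega
  · exact hVE
  constructor
  · intro r hr j hj
    simp only [State.setCell_arr, if_true, Nat.reduceEqDiff, if_false, Function.update_apply,
      inj hj ha, inj hj hb, hC.jobs r hr j hj]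
    rw [swapJobs]
    by_cases h1 : r = i <;> by_cases h2 : r = i' <;> by_cases h3 : j = a <;>
      by_cases h4 : j = b <;> simp_all
  · intro r hr
    simp only [State.setCell_arr, if_true, Nat.reduceEqDiff, if_false, Function.update_apply,
      hC.load r hr]
    rw [shiftLoad]
    by_cases h1 : r = i <;> by_cases h2 : r = i' <;> simp_all
  · exact fun r hr => by simpa using hC.label r hr
  · exact fun j hj => by simpa using hC.size j hj
  · simpa using hC.thr

/-- The hypotheses on the sizes and on the initial numbers of jobs that balancing needs. -/
structure Balanceable (G : Params) (v : ℕ → ℕ) (thr : ℕ) (x₀ : ℕ → ℕ → ℕ) (E₀ : ℕ → ℕ) : Prop where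
  cut : CutCondition G v thr x₀ E₀
  width : ∀ a < G.d, ∀ b < G.d, G.cls a = G.cls b → v a ≤ v b + G.w
  jobs : ∀ j < G.d, ∑ i ∈ range G.m, x₀ i j < G.Q
  total : ∑ i ∈ range G.m, E₀ i ≤ G.m * G.Q * G.pm

theorem Params.Good.total_lt {G : Params} (hG : G.Good) : G.m * G.Q * G.pm < G.B := by
  rw [hG.B_eq]
  have := Nat.mul_le_mul_right G.pm (Nat.mul_le_mul_right G.Q hG.m_lt.le)
  omega

theorem Params.Good.mdd_le {G : Params} (hG : G.Good) : G.m * G.d * G.d ≤ G.S := by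
  refine le_trans ?_ (hG.pow_le (n := 3) (by omega))
  have h1 := hG.m_lt.le.trans hG.Q_lt.le
  have h2 := hG.d_le.trans (hG.pm_lt.le.trans hG.Q_lt.le)
  calc G.m * G.d * G.d ≤ G.B * G.B * G.B := Nat.mul_le_mul (Nat.mul_le_mul h1 h2) h2
    _ = G.B ^ 3 := by ring

section

variable {V N : ℕ} {G : Params} {v : ℕ → ℕ} {thr : ℕ} {x₀ : ℕ → ℕ → ℕ} {E₀ : ℕ → ℕ}
  {x : ℕ → ℕ → ℕ} {E h : ℕ → ℕ} {s : State}

theorem wp_pushOrRelabel (hE : Env G s) (hG : G.Good) (hN : G.S ≤ N)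
    (hBe : Balanceable G v thr x₀ E₀) (hB : Balancing G v thr x₀ E₀ x E h)
    (hC : Config G v thr x E h s) {i : ℕ} (hi : i < G.m) (hri : s.reg ixI = i) :
    WP V N pushOrRelabel (fun s' => ∃ x' E' h', Balancing G v thr x₀ E₀ x' E' h' ∧
      Config G v thr x' E' h' s' ∧ ((x' = x ∧ E' = E ∧ h' = h ∧ E i < thr + G.w) ∨
        thr + G.w ≤ E i ∧ potential G (G.m * G.Q * G.pm) E' h' <
          potential G (G.m * G.Q * G.pm) E h)) s := by
  refine .of_bounded fun hNV hbd => ?_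
  have hBV : G.B ≤ V := hG.B_le.trans (hN.trans hNV)
  have hsumE : ∑ i ∈ range G.m, E i ≤ G.m * G.Q * G.pm := hB.total.le.trans hBe.total
  refine wp_ite (fun hact => wp_skip ⟨x, E, h, hB, hC, .inl ⟨rfl, rfl, rfl, ?_⟩⟩) (fun hact => ?_)
  · simp only [Term.eval_sub, Term.eval_add, Term.eval_reg, Term.eval_get, hC.thr, hE.w, hri,
      hC.load i hi] at hact
    omega
  have hact : thr + G.w ≤ E i := by
    simp only [Term.eval_sub, Term.eval_add, Term.eval_reg, Term.eval_get, hC.thr, hE.w, hri,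
      hC.load i hi] at hact
    omega
  refine wp_seq_set_eq 0 rfl (Nat.zero_le _) ?_
  generalize hs₁ : State.setReg _ _ _ = s₁
  have hF₁ : Frame [rFound] [] s s₁ := hs₁ ▸ (Frame.refl _ _ s).setReg
  have hE₁ := hE.frame hF₁
  have hC₁ := hC.frame hF₁
  have hfound₁ : s₁.reg rFound = 0 := by simp [← hs₁]
  have hri₁ : s₁.reg ixI = i := (hF₁.reg _ (by decide)).trans hri
  clear hs₁
  -- The candidates `i'`, `a`, `b` for the other machine and the two types are coded in one number.
  refine wp_seq (wp_for (G.m * G.d * G.d) (fun k s' =>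
    (s'.reg rFound = 0 ∧ Config G v thr x E h s' ∧ ∀ e < k, h i = h (e / G.d / G.d) + 1 →
      ¬ Edge G v x i (e / G.d / G.d) (e / G.d % G.d) (e % G.d)) ∨
    (s'.reg rFound = 1 ∧ ∃ x' E', Balancing G v thr x₀ E₀ x' E' h ∧ Config G v thr x' E' h s' ∧
      potential G (G.m * G.Q * G.pm) E' h < potential G (G.m * G.Q * G.pm) E h))
    (hG.mdd_le.trans hN) (by decide) (fun s' hF => by simp [(hE₁.frame hF).m, (hE₁.frame hF).d])
    (.inl ⟨by simpa using hfound₁, hC₁.frame (R := [ixK]) (A := [])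
      ((Frame.refl _ _ _).setReg), fun _ h => by omega⟩) ?_ ?_)
  · intro k s₂ hk hF₂ hrk hI
    have hE₂ := hE₁.frame hF₂
    have hri₂ : s₂.reg ixI = i := (hF₂.reg _ (by decide)).trans hri₁
    refine wp_ite (fun hf => wp_skip fun _ => ?_) (fun hf => ?_)
    · rw [Term.eval_reg] at hf
      rcases hI with hI | ⟨hf', x', E', hB', hC', hP⟩
      · exact (hf hI.1).elim
      · exact .inr ⟨by simpa using hf', x', E', hB', hC'.frame (R := [ixK]) (A := [])
          ((Frame.refl _ _ _).setReg), hP⟩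
    rw [Term.eval_reg] at hf
    obtain ⟨-, hC₂, hno⟩ : _ ∧ _ ∧ _ := hI.resolve_right fun h => by omega
    have hd : 0 < G.d := hG.d_pos
    obtain ⟨i', hi'⟩ : ∃ i', k / G.d / G.d = i' := ⟨_, rfl⟩
    obtain ⟨a, ha⟩ : ∃ a, k / G.d % G.d = a := ⟨_, rfl⟩
    obtain ⟨b, hb⟩ : ∃ b, k % G.d = b := ⟨_, rfl⟩
    have hi'm : i' < G.m := by
      rw [← hi', Nat.div_div_eq_div_mul]
      exact Nat.div_lt_of_lt_mul (by rwa [mul_comm, ← mul_assoc])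
    have had : a < G.d := ha ▸ Nat.mod_lt _ hd
    have hbd' : b < G.d := hb ▸ Nat.mod_lt _ hd
    have hkV : k ≤ V := by
      have := hG.mdd_le
      omega
    refine wp_seq_set_eq i' (by simp [hrk, hE₂.d, hi'])
      (hi' ▸ ((Nat.div_le_self _ _).trans (Nat.div_le_self _ _)).trans hkV)
      (wp_seq_set_eq a (by simp [hrk, hE₂.d, ha])
        (ha ▸ ((Nat.mod_le _ _).trans (Nat.div_le_self _ _)).trans hkV)
      (wp_seq_set_eq b (by simp [hrk, hE₂.d, hb]) (hb ▸ (Nat.mod_le _ _).trans hkV) ?_))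
    generalize hs₃ : State.setReg _ _ _ = s₃
    have hF₃ : Frame [rTo, rX, rY] [] s₂ s₃ :=
      hs₃ ▸ (((Frame.refl _ _ s₂).setReg).setReg).setReg
    have hE₃ := hE₂.frame hF₃
    have hC₃ := hC₂.frame hF₃
    have h3 : s₃.reg rTo = i' ∧ s₃.reg rX = a ∧ s₃.reg rY = b := by simp [← hs₃]
    obtain ⟨hrTo, hrX, hrY⟩ := h3
    have hri₃ : s₃.reg ixI = i := (hF₃.reg _ (by decide)).trans hri₂
    have hfound₃ : s₃.reg rFound = 0 := (hF₃.reg _ (by decide)).trans hf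
    have hca : (clsT (§rX)).eval s₃ = G.cls a := by
      rw [hE₃.eval_clsT (by simpa [hrX] using had)]
      simp [hrX]
    have hcb : (clsT (§rY)).eval s₃ = G.cls b := by
      rw [hE₃.eval_clsT (by simpa [hrY] using hbd')]
      simp [hrY]
    clear hs₃ hF₃
    refine wp_ite (fun hcond => wp_skip fun _ => ?_) (fun hcond => ?_)
    all_goals
      simp only [Term.eval_add, Term.eval_sub, Term.eval_mul, Term.eval_ne, Term.eval_reg,
        Term.eval_get, Term.eval_one, hca, hcb, hri₃, hrTo, hrX, hrY, hE₃.d, hC₃.label i hi,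
        hC₃.label i' hi'm, hC₃.size a had, hC₃.size b hbd', hC₃.jobs i hi a had,
        hC₃.jobs i' hi'm b hbd'] at hcond
    · refine .inl ⟨by simpa using hfound₃, hC₃.frame (R := [ixK]) (A := [])
        ((Frame.refl _ _ _).setReg), fun e he hlab hed => ?_⟩
      rcases Nat.lt_succ_iff_lt_or_eq.1 he with h1 | rfl
      · exact hno e h1 hlab hed
      · rw [hi', ha, hb] at hed
        rw [hi'] at hlab
        have h1 := hed.cls
        have h2 := hed.lt
        have h3 := hed.left
        have h4 := hed.right
        omega
    · have hed : Edge G v x i i' a b := ⟨by omega, by omega, by omega, by omega⟩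
      have hlab : h i = h i' + 1 := by omega
      have hii : i ≠ i' := by
        rintro rfl
        omega
      have hxlt : ∀ r < G.m, ∀ j < G.d, x r j < G.Q := fun r hr j hj =>
        (single_le_sum (f := fun r => x r j) (fun _ _ => Nat.zero_le _) (mem_range.2 hr)).trans_lt
          ((hB.cols j hj).trans_lt (hBe.jobs j hj))
      have hQB := hG.Q_lt
      have hx1 := hxlt i' hi'm a had
      have hx2 := hxlt i hi b hbd'
      have hwid := hBe.width a had b hbd' hed.cls
      have hEE : E i + E i' ≤ ∑ r ∈ range G.m, E r := by
        rw [← add_sum_erase _ _ (mem_range.2 hi)]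
        exact Nat.add_le_add_left (single_le_sum (f := E) (fun _ _ => Nat.zero_le _)
          (mem_erase.2 ⟨hii.symm, mem_range.2 hi'm⟩)) _
      have htot := hG.total_lt
      refine wp_seq ((wp_swap hE₃ hC₃ hi hi'm had hbd' hii hed hri₃ hrTo hrX hrY (by omega)
        (by omega) (by omega)).mono fun s₄ hF₄ hC₄ _ => wp_set (by simp; omega) fun _ => ?_)
      obtain ⟨hB', hP⟩ := hB.push hi hi'm had hbd' hlab hed hwid hact (G.m * G.Q * G.pm)
      exact .inr ⟨by simp, _, _, hB', hC₄.frame (R := [rFound, ixK]) (A := [])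
        (((Frame.refl _ _ _).setReg).setReg), hP⟩
  · intro s₂ hF₂ _ hI _
    have hri₂ : s₂.reg ixI = i := (hF₂.reg _ (by decide)).trans hri₁
    refine wp_ite (fun hf => wp_skip ?_) (fun hf => ?_)
    all_goals rw [Term.eval_reg] at hf
    · obtain ⟨-, x', E', hB', hC', hP⟩ := hI.resolve_left fun h => hf h.1
      exact ⟨x', E', h, hB', hC', .inr ⟨hact, hP⟩⟩
    · obtain ⟨-, hC₂, hno⟩ := hI.resolve_right fun h => by omega
      obtain ⟨hB', hP⟩ := hB.relabel hBe.cut hi (by omega) (fun i' hi' a ha b hb hlab hed => by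
        have e1 : (i' * G.d + a) * G.d + b < G.m * G.d * G.d :=
          mul_add_lt (mul_add_lt hi' ha) hb
        have e2 : ((i' * G.d + a) * G.d + b) / G.d = i' * G.d + a := by
          rw [mul_comm, Nat.mul_add_div hG.d_pos, Nat.div_eq_of_lt hb, add_zero]
        have e3 : (i' * G.d + a) / G.d = i' := by
          rw [mul_comm, Nat.mul_add_div hG.d_pos, Nat.div_eq_of_lt ha, add_zero]
        have := hno _ e1
        rw [e2, e3, Nat.mul_add_mod_of_lt ha, Nat.mul_add_mod_of_lt hb] at this
        exact this hlab hed) hsumE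
      have hlt := hB.label_lt hBe.cut hi
      have hmB := hG.m_lt.trans hG.Q_lt
      have hval : (Term.get aLabel (§ixI) + 1).eval s₂ = h i + 1 := by
        simp [hri₂, hC₂.label i hi]
      refine wp_put (by rw [hval]; omega) ?_
      rw [hval]
      refine ⟨x, E, _, hB', ⟨?_, ?_, ?_, ?_, ?_⟩, .inr ⟨hact, hP⟩⟩
      · exact fun r hr j hj => by simpa using hC₂.jobs r hr j hj
      · exact fun r hr => by simpa using hC₂.load r hr
      · intro r hr
        simp [hri₂, Function.update_apply, hC₂.label r hr]
      · exact fun j hj => by simpa using hC₂.size j hj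
      · simpa using hC₂.thr

theorem wp_balance (hE : Env G s) (hG : G.Good) (hN : G.S ≤ N)
    (hBe : Balanceable G v thr x₀ E₀) (hx : HasJobs G x₀ s) (hP : Prepared G E₀ v thr s) :
    WP V N balance (fun s' => ∃ x E, Rearranged G v x₀ E₀ x E ∧ HasJobs G x s' ∧
      (∀ i < G.m, s'.arr aLoad i = E i) ∧ ∀ i < G.m, min (E₀ i) thr ≤ E i ∧ E i < thr + G.w) s := by
  obtain ⟨T, hT⟩ : ∃ T, G.m * G.Q * G.pm = T := ⟨_, rfl⟩
  obtain ⟨F, hF⟩ : ∃ F, (T + 1) * G.m * G.m = F := ⟨_, rfl⟩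
  have hFS : F ≤ G.S := by
    refine le_trans ?_ (hG.pow_le (n := 3) (by omega))
    have h1 : T + 1 ≤ G.B := hT ▸ hG.total_lt
    have h2 := hG.m_lt.le.trans hG.Q_lt.le
    calc F = (T + 1) * G.m * G.m := hF.symm
      _ ≤ G.B * G.B * G.B := Nat.mul_le_mul (Nat.mul_le_mul h1 h2) h2
      _ = G.B ^ 3 := by ring
  have hinit : Balancing G v thr x₀ E₀ x₀ E₀ (fun _ => 0) :=
    ⟨⟨fun _ _ => rfl, fun _ _ _ => rfl, fun _ _ => rfl⟩, rfl, fun _ _ _ _ _ _ _ _ _ => by omega,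
      fun _ _ h => by omega, fun _ _ => min_le_left _ _⟩
  have hinitP : potential G T E₀ (fun _ => 0) = F := by
    simp only [potential, zero_mul, zero_add, tsub_zero, sum_const, card_range, smul_eq_mul, ← hF]
    ring
  refine wp_for F (fun t s' => ∃ x E h, Balancing G v thr x₀ E₀ x E h ∧ Config G v thr x E h s' ∧
    (potential G T E h + t ≤ F ∨ ∀ i < G.m, E i < thr + G.w)) (hFS.trans hN) (by decide)
    (fun s' hF' => by simp [(hE.frame hF').m, (hE.frame hF').Q, (hE.frame hF').pm, hT, hF])
    ⟨x₀, E₀, _, hinit, ?_, .inl (by rw [hinitP, add_zero])⟩ ?_ ?_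
  · exact ⟨hx, hP.load, hP.label, hP.size, by simpa using hP.thr⟩
  · intro t s₁ ht hF₁ hrt ⟨x, E, h, hB, hC, hI⟩
    have hE₁ := hE.frame hF₁
    refine wp_for G.m (fun i s' => ∃ x E h, Balancing G v thr x₀ E₀ x E h ∧
      Config G v thr x E h s' ∧ (potential G T E h + t + 1 ≤ F ∨ (∀ i' < i, E i' < thr + G.w) ∧
        (potential G T E h + t ≤ F ∨ ∀ i < G.m, E i < thr + G.w)))
      (hG.m_lt.le.trans (hG.Q_lt.le.trans (hG.B_le.trans hN))) (by decide)
      (fun s' hF' => (hE₁.frame hF').m) ⟨x, E, h, hB, hC.frame (R := [ixI]) (A := [])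
        ((Frame.refl _ _ _).setReg), .inr ⟨fun _ h => by omega, hI⟩⟩ ?_ ?_
    · intro i s₂ hi hF₂ hri ⟨x, E, h, hB, hC, hI⟩
      have hE₂ := hE₁.frame hF₂
      refine (wp_pushOrRelabel hE₂ hG hN hBe hB hC hi hri).mono
        fun s₃ _ ⟨x', E', h', hB', hC', hI'⟩ _ => ⟨x', E', h', hB', hC'.frame (R := [ixI])
          (A := []) ((Frame.refl _ _ _).setReg), ?_⟩
      rw [hT] at hI'
      rcases hI' with ⟨rfl, rfl, rfl, hlt⟩ | ⟨hle, hlt⟩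
      · refine hI.imp_right fun h1 => ⟨fun i' hi' => ?_, h1.2⟩
        rcases Nat.lt_succ_iff_lt_or_eq.1 hi' with h2 | rfl
        exacts [h1.1 i' h2, hlt]
      · left
        rcases hI with h1 | ⟨-, h1 | h1⟩
        · omega
        · omega
        · have := h1 i hi
          omega
    · intro s₂ hF₂ _ ⟨x, E, h, hB, hC, hI⟩ _
      refine ⟨x, E, h, hB, hC.frame (R := [ixT]) (A := []) ((Frame.refl _ _ _).setReg), ?_⟩
      rcases hI with h1 | h1
      · exact .inl (by omega)
      · exact .inr h1.1
  · intro s₁ hF₁ _ ⟨x, E, h, hB, hC, hI⟩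
    have hpos := hB.potential_pos hBe.cut hG.m_pos T
    exact ⟨x, E, hB.toRearranged, hC.jobs, hC.load, fun i hi => ⟨hB.floor i hi,
      (hI.resolve_left (by omega)) i hi⟩⟩

end

end Scheduling

/-! ### What a path of codes says about the loads -/

namespace Scheduling

open WordRAM Finset

/-- A path of codes for the machines, from an initial code to a code that distributes all jobs. -/
structure IsPath (G : Params) (a : ℕ → ℕ) : Prop where
  start : a 0 < G.B * G.B
  lt : ∀ i ≤ G.m, a i < G.S
  step : ∀ i < G.m, G.Step (a i) (a (i + 1))
  final : G.Final (a G.m)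

/-- The number of jobs of class `k` of machine `i`. -/
def Params.slots (G : Params) (a : ℕ → ℕ) (i k : ℕ) : ℕ := G.num (a (i + 1)) k - G.num (a i) k

/-- The load, scaled by `Q`, that the path attributes to machine `i`. -/
def Params.virtual (G : Params) (a : ℕ → ℕ) (i : ℕ) : ℕ :=
  ∑ k ∈ range G.K, G.slots a i k * G.slope (a (i + 1)) k

/-- A distribution of all jobs with the numbers of jobs of the classes given by the path. -/
structure Realizes (G : Params) (a : ℕ → ℕ) (x : ℕ → ℕ → ℕ) : Prop where
  cols : ∀ j < G.d, ∑ i ∈ range G.m, x i j = G.cnt j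
  rows : ∀ i < G.m, ∀ k < G.K, ∑ j ∈ range G.d, x i j * (if G.cls j = k then 1 else 0) =
    G.slots a i k

theorem Params.Good.cls_lt {G : Params} (hG : G.Good) {j : ℕ} (hj : j < G.d) : G.cls j < G.K := by
  rw [hG.K_eq]
  exact Nat.lt_succ_of_le (Nat.div_le_div_right (hG.p_le j hj))

theorem Params.Good.le_add_width {G : Params} {i j : ℕ} (h : G.cls i = G.cls j) :
    G.p i ≤ G.p j + G.w := by
  have h1 := Nat.div_add_mod (G.p i) (G.w + 1)
  have h2 := Nat.div_add_mod (G.p j) (G.w + 1)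
  have h3 := Nat.mod_lt (G.p i) (Nat.succ_pos G.w)
  rw [Params.cls, Params.cls] at h
  rw [h] at h1
  rw [Nat.succ_eq_add_one] at h3
  omega

namespace IsPath

variable {G : Params} {a : ℕ → ℕ}

theorem num_zero (h : IsPath G a) (k : ℕ) : G.num (a 0) k = 0 := by
  rw [Params.num, Nat.div_eq_of_lt h.start, Nat.zero_div, Nat.zero_mod]

theorem sum_zero (h : IsPath G a) (k : ℕ) : G.sum (a 0) k = 0 := by
  rw [Params.sum, Nat.div_eq_of_lt h.start, Nat.zero_div, Nat.zero_div, Nat.zero_mod]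

theorem mod_eq (h : IsPath G a) {i : ℕ} (hi : i ≤ G.m) :
    a i % (G.B * G.B) = a G.m % (G.B * G.B) := by
  obtain ⟨n, hn⟩ : ∃ n, G.m - i = n := ⟨_, rfl⟩
  induction n generalizing i with
  | zero => rw [show i = G.m by omega]
  | succ n ih =>
    rw [(h.step i (by omega)).bounds]
    exact ih (by omega) (by omega)

theorem lo_eq (h : IsPath G a) {i : ℕ} (hi : i ≤ G.m) : G.lo (a i) = G.lo (a G.m) := by
  rw [Params.lo, Params.lo, ← Nat.mod_mul_right_mod (a i) G.B G.B, h.mod_eq hi,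
    Nat.mod_mul_right_mod]

theorem up_eq (h : IsPath G a) {i : ℕ} (hi : i ≤ G.m) : G.up (a i) = G.up (a G.m) := by
  rw [Params.up, Params.up, ← Nat.mod_mul_right_div_self, h.mod_eq hi,
    Nat.mod_mul_right_div_self]

theorem num_eq (h : IsPath G a) {t k : ℕ} (ht : t ≤ G.m) (hk : k < G.K) :
    G.num (a t) k = ∑ i ∈ range t, G.slots a i k := by
  induction t with
  | zero => simp [h.num_zero]
  | succ t ih =>
    rw [sum_range_succ, ← ih (by omega), Params.slots]
    have := ((h.step t (by omega)).cls k hk).num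
    omega

theorem sum_eq (h : IsPath G a) {t k : ℕ} (ht : t ≤ G.m) (hk : k < G.K) :
    G.sum (a t) k = ∑ i ∈ range t, G.slots a i k * G.slope (a (i + 1)) k := by
  induction t with
  | zero => simp [h.sum_zero]
  | succ t ih =>
    rw [sum_range_succ, ← ih (by omega), Params.slots]
    exact ((h.step t (by omega)).cls k hk).sum

theorem slope_mono (h : IsPath G a) {i t k : ℕ} (hit : i ≤ t) (ht : t ≤ G.m) (hk : k < G.K) :
    G.slope (a i) k ≤ G.slope (a t) k := by
  induction t, hit using Nat.le_induction with
  | base => exact le_rfl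
  | succ t _ ih => exact (ih (by omega)).trans ((h.step t (by omega)).cls k hk).slope

theorem virtual_eq (h : IsPath G a) {i : ℕ} (hi : i < G.m) :
    G.virtual a i = ∑ k ∈ range G.K, (G.sum (a (i + 1)) k - G.sum (a i) k) := by
  refine sum_congr rfl fun k hk => ?_
  have := ((h.step i hi).cls k (mem_range.1 hk)).sum
  rw [Params.slots]
  omega

theorem le_virtual (h : IsPath G a) {i : ℕ} (hi : i < G.m) :
    G.Q * G.lo (a G.m) ≤ G.virtual a i := by
  rw [h.virtual_eq hi, ← h.lo_eq (i := i + 1) (by omega)]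
  exact (h.step i hi).lower

theorem virtual_lt (h : IsPath G a) {i : ℕ} (hi : i < G.m) :
    G.virtual a i < G.Q * (G.up (a G.m) + 1) := by
  rw [h.virtual_eq hi, ← h.up_eq (i := i + 1) (by omega)]
  exact (h.step i hi).upper

theorem sum_virtual_lt (h : IsPath G a) : ∑ i ∈ range G.m, G.virtual a i < G.Q * (G.work + 1) := by
  refine lt_of_le_of_lt (le_of_eq ?_) h.final.sum
  simp only [Params.virtual]
  rw [sum_comm]
  exact sum_congr rfl fun k hk => (h.sum_eq le_rfl (mem_range.1 hk)).symm

/-- The slopes of the path are majorized by the processing times, on every set of machines: since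
they are monotone, the prefixes are the worst sets. -/
theorem slots_mul_le (h : IsPath G a) {k θ : ℕ} (hk : k < G.K) (hθ : θ < G.pm + 1) {R : Finset ℕ}
    (hR : R ⊆ range G.m) : ∑ i ∈ R, G.slots a i k * (G.Q * θ) ≤
      ∑ i ∈ R, G.slots a i k * G.slope (a (i + 1)) k + G.Q * G.deficit k θ := by
  have prefixes : ∀ t ≤ G.m,
      ∑ i ∈ range t, G.slots a i k * (G.Q * θ - G.slope (a (i + 1)) k) ≤
        G.Q * G.deficit k θ := by
    intro t
    induction t with
    | zero => simp
    | succ t ih =>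
      intro ht
      by_cases hlt : G.slope (a (t + 1)) k < G.Q * θ
      · have e : ∑ i ∈ range (t + 1), G.slots a i k * (G.Q * θ - G.slope (a (i + 1)) k) +
            G.sum (a (t + 1)) k = G.Q * θ * G.num (a (t + 1)) k := by
          rw [h.sum_eq ht hk, h.num_eq ht hk, mul_sum, ← sum_add_distrib]
          refine sum_congr rfl fun i hi => ?_
          rw [mem_range] at hi
          have := h.slope_mono (i := i + 1) (t := t + 1) (by omega) ht hk
          rw [← mul_add, Nat.sub_add_cancel (by omega), mul_comm]
        have := ((h.step t (by omega)).cls k hk).major θ hθ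
        omega
      · rw [sum_range_succ, Nat.sub_eq_zero_of_le (by omega), mul_zero, add_zero]
        exact ih (by omega)
  have h1 : ∑ i ∈ R, G.slots a i k * (G.Q * θ) ≤
      ∑ i ∈ R, G.slots a i k * G.slope (a (i + 1)) k +
        ∑ i ∈ R, G.slots a i k * (G.Q * θ - G.slope (a (i + 1)) k) := by
    rw [← sum_add_distrib]
    refine sum_le_sum fun i _ => ?_
    rw [← mul_add]
    exact Nat.mul_le_mul_left _ (by omega)
  exact h1.trans (Nat.add_le_add_left ((sum_le_sum_of_subset hR).trans (prefixes G.m le_rfl)) _)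

end IsPath

/-- If the machines in `R` hold the smallest jobs of every class, then their load is at most the
load that the path attributes to them. -/
theorem load_le_virtual {G : Params} (hG : G.Good) {a : ℕ → ℕ} (h : IsPath G a)
    {x : ℕ → ℕ → ℕ} (hx : Realizes G a x) {R : Finset ℕ} (hR : R ⊆ range G.m)
    (hclosed : ∀ i ∈ R, ∀ i' < G.m, i' ∉ R → ∀ j < G.d, ∀ j' < G.d, ¬ Edge G G.p x i i' j j') :
    G.Q * ∑ i ∈ R, G.load x i ≤ ∑ i ∈ R, G.virtual a i := by
  set X : ℕ → ℕ := fun j => ∑ i ∈ R, x i j with hX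
  have hXle : ∀ j < G.d, X j ≤ G.cnt j := fun j hj => by
    rw [← hx.cols j hj]
    exact sum_le_sum_of_subset hR
  have key : ∀ k < G.K, G.Q * ∑ j ∈ range G.d, X j * (if G.cls j = k then G.p j else 0) ≤
      ∑ i ∈ R, G.slots a i k * G.slope (a (i + 1)) k := by
    intro k hk
    -- The largest job of the class on the machines in `R`.
    set θ := ((range G.d).filter fun j => G.cls j = k ∧ 0 < X j).sup G.p with hθ
    have hθle : θ < G.pm + 1 := Nat.lt_succ_of_le (Finset.sup_le fun j hj =>
      hG.p_le j (mem_range.1 (mem_filter.1 hj).1))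
    have above : ∀ j < G.d, G.cls j = k → θ < G.p j → X j = 0 := by
      intro j hj hjk hlt
      by_contra h0
      have hmem : j ∈ (range G.d).filter fun j => G.cls j = k ∧ 0 < X j :=
        mem_filter.2 ⟨mem_range.2 hj, hjk, Nat.pos_of_ne_zero h0⟩
      have : G.p j ≤ θ := le_sup (f := G.p) hmem
      omega
    have below : ∀ j < G.d, G.cls j = k → G.p j < θ → X j = G.cnt j := by
      intro j hj hjk hlt
      obtain ⟨j', hj', hlt'⟩ := (Finset.lt_sup_iff).1 hlt
      obtain ⟨hj'd, hj'k, hpos⟩ := mem_filter.1 hj'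
      obtain ⟨i, hi, hij⟩ : ∃ i ∈ R, 0 < x i j' := by
        by_contra hno
        push Not at hno
        exact hpos.ne' (sum_eq_zero fun i hi => Nat.le_zero.1 (hno i hi))
      rw [← hx.cols j hj]
      refine sum_subset hR fun i' hi' hnot => ?_
      by_contra h0
      exact hclosed i hi i' (mem_range.1 hi') hnot j' (mem_range.1 hj'd) j hj
        ⟨by rw [hj'k, hjk], hlt', hij, Nat.pos_of_ne_zero h0⟩
    have e1 : ∑ j ∈ range G.d, X j * (if G.cls j = k then G.p j else 0) + G.deficit k θ =
        ∑ i ∈ R, G.slots a i k * θ := by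
      have e2 : ∑ i ∈ R, G.slots a i k = ∑ j ∈ range G.d, X j * (if G.cls j = k then 1 else 0) := by
        simp only [hX, sum_mul]
        rw [sum_comm]
        exact sum_congr rfl fun i hi => (hx.rows i (mem_range.1 (hR hi)) k hk).symm
      rw [← sum_mul, e2, sum_mul, Params.deficit, ← sum_add_distrib]
      refine sum_congr rfl fun j hj => ?_
      rw [mem_range] at hj
      split_ifs with hjk
      · rcases lt_trichotomy (G.p j) θ with h1 | h1 | h1
        · rw [below j hj hjk h1, ← mul_add]
          rw [mul_one]
          congr 1
          omega
        · rw [h1]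
          simp
        · rw [above j hj hjk h1, Nat.sub_eq_zero_of_le h1.le]
          simp
      · simp
    have e3 := h.slots_mul_le hk hθle hR
    have e4 : ∑ i ∈ R, G.slots a i k * (G.Q * θ) = G.Q * ∑ i ∈ R, G.slots a i k * θ := by
      rw [mul_sum]
      exact sum_congr rfl fun i _ => by ring
    rw [e4, ← e1, mul_add] at e3
    omega
  calc G.Q * ∑ i ∈ R, G.load x i
      = ∑ k ∈ range G.K, G.Q * ∑ j ∈ range G.d, X j * (if G.cls j = k then G.p j else 0) := by
        rw [← mul_sum, sum_comm]
        congr 1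
        simp only [Params.load]
        rw [sum_comm]
        refine sum_congr rfl fun j hj => ?_
        rw [← mul_sum, sum_ite_eq, if_pos (mem_range.2 (hG.cls_lt (mem_range.1 hj))), hX, sum_mul]
    _ ≤ ∑ k ∈ range G.K, ∑ i ∈ R, G.slots a i k * G.slope (a (i + 1)) k :=
        sum_le_sum fun k hk => key k (mem_range.1 hk)
    _ = ∑ i ∈ R, G.virtual a i := by rw [sum_comm]; rfl

theorem Realizes.sum_load {G : Params} {a : ℕ → ℕ} {x : ℕ → ℕ → ℕ} (hx : Realizes G a x) :
    ∑ i ∈ range G.m, G.load x i = G.work := by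
  simp only [Params.load]
  rw [sum_comm]
  refine sum_congr rfl fun j hj => ?_
  rw [← sum_mul, hx.cols j (mem_range.1 hj)]

theorem Rearranged.realizes {G : Params} {v : ℕ → ℕ} {a : ℕ → ℕ} {x₀ : ℕ → ℕ → ℕ} {E₀ : ℕ → ℕ}
    {x : ℕ → ℕ → ℕ} {E : ℕ → ℕ} (h : Rearranged G v x₀ E₀ x E) (hx : Realizes G a x₀) :
    Realizes G a x :=
  ⟨fun j hj => (h.cols j hj).trans (hx.cols j hj),
    fun i hi k hk => (h.rows i hi k).trans (hx.rows i hi k hk)⟩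

section

variable {G : Params} {a : ℕ → ℕ} {x : ℕ → ℕ → ℕ}

theorem Rearranged.load_eq {E₀ : ℕ → ℕ} {x' : ℕ → ℕ → ℕ} {E : ℕ → ℕ}
    (h : Rearranged G G.p x E₀ x' E) (hE₀ : ∀ i < G.m, E₀ i = G.load x i) {i : ℕ} (hi : i < G.m) :
    E i = G.load x' i := by
  have := h.load i hi
  rw [hE₀ i hi, Params.load] at this
  rw [Params.load]
  omega

theorem Realizes.jobs_lt (hG : G.Good) (hx : Realizes G a x) (j : ℕ) (hj : j < G.d) :
    ∑ i ∈ range G.m, x i j < G.Q := by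
  rw [hx.cols j hj]
  exact (single_le_sum (f := G.cnt) (fun _ _ => Nat.zero_le _) (mem_range.2 hj)).trans_lt hG.cnt_lt

/-- Balancing brings the loads down to the upper bound of the path. -/
theorem balanceable_above (hG : G.Good) (h : IsPath G a) (hx : Realizes G a x) :
    Balanceable G G.p (G.up (a G.m) + 1) x (G.load x) := by
  refine ⟨fun x' E hx' R hR hne hclosed => ?_, fun i _ j _ hij => Params.Good.le_add_width hij,
    hx.jobs_lt hG, ?_⟩
  · have h1 := load_le_virtual hG h (hx'.realizes hx) hR hclosed
    have h2 : ∑ i ∈ R, G.virtual a i < ∑ _i ∈ R, G.Q * (G.up (a G.m) + 1) :=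
      sum_lt_sum_of_nonempty hne fun i hi => h.virtual_lt (mem_range.1 (hR hi))
    rw [sum_const, smul_eq_mul] at h2
    have h3 : ∑ i ∈ R, E i = ∑ i ∈ R, G.load x' i :=
      sum_congr rfl fun i hi => hx'.load_eq (fun _ _ => rfl) (mem_range.1 (hR hi))
    rw [h3]
    refine Nat.lt_of_mul_lt_mul_left (a := G.Q) (h1.trans_lt (h2.trans_eq ?_))
    ring
  · rw [hx.sum_load]
    refine hG.work_le'.trans ?_
    rw [mul_assoc]
    exact Nat.le_mul_of_pos_left _ hG.m_pos

theorem Realizes.load_le (hG : G.Good) (hx : Realizes G a x) {i : ℕ} (hi : i < G.m) :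
    G.load x i ≤ G.Q * G.pm :=
  (single_le_sum (fun _ _ => Nat.zero_le _) (mem_range.2 hi)).trans
    (hx.sum_load.le.trans hG.work_le')

theorem Rearranged.load_eq_below (hG : G.Good) {x' : ℕ → ℕ → ℕ} {E : ℕ → ℕ} (hx : Realizes G a x)
    (h : Rearranged G (fun j => G.pm - G.p j) x (fun i => G.Q * G.pm - G.load x i) x' E)
    {i : ℕ} (hi : i < G.m) : E i = G.Q * G.pm - G.load x' i := by
  have hx' := h.realizes hx
  have h1 := h.load i hi
  have e : ∀ y : ℕ → ℕ → ℕ, ∑ j ∈ range G.d, y i j * (G.pm - G.p j) + G.load y i =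
      (∑ j ∈ range G.d, y i j) * G.pm := by
    intro y
    rw [Params.load, ← sum_add_distrib, sum_mul]
    refine sum_congr rfl fun j hj => ?_
    rw [← mul_add, Nat.sub_add_cancel (hG.p_le j (mem_range.1 hj))]
  have e' : ∀ y : ℕ → ℕ → ℕ, ∑ j ∈ range G.d, y i j =
      ∑ k ∈ range G.K, ∑ j ∈ range G.d, y i j * (if G.cls j = k then 1 else 0) := by
    intro y
    rw [sum_comm]
    refine sum_congr rfl fun j hj => ?_
    rw [← mul_sum, sum_ite_eq, if_pos (mem_range.2 (hG.cls_lt (mem_range.1 hj))), mul_one]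
  have e2 : ∑ j ∈ range G.d, x i j = ∑ j ∈ range G.d, x' i j := by
    rw [e', e' x']
    exact sum_congr rfl fun k _ => (h.rows i hi k).symm
  have h2 := e x
  have h3 := e x'
  rw [e2] at h2
  have h4 := hx.load_le hG hi
  have h5 := hx'.load_le hG hi
  omega

theorem IsPath.lo_le_work (hG : G.Good) (h : IsPath G a) : G.lo (a G.m) ≤ G.work := by
  have h1 := h.le_virtual hG.m_pos
  have h2 := (single_le_sum (f := G.virtual a) (fun _ _ => Nat.zero_le _)
    (mem_range.2 hG.m_pos)).trans_lt h.sum_virtual_lt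
  exact Nat.lt_succ_iff.1 (Nat.lt_of_mul_lt_mul_left (h1.trans_lt h2))

/-- Balancing brings the loads up to the lower bound of the path, since complemented loads come
down. -/
theorem balanceable_below (hG : G.Good) (h : IsPath G a) (hx : Realizes G a x) :
    Balanceable G (fun j => G.pm - G.p j) (G.Q * G.pm + 1 - G.lo (a G.m)) x
      (fun i => G.Q * G.pm - G.load x i) := by
  refine ⟨fun x' E hx' R hR hne hclosed => ?_, fun i _ j _ hij => ?_, hx.jobs_lt hG, ?_⟩
  · -- The machines outside of `R` hold the smallest jobs of every class.
    have hr := hx'.realizes hx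
    have h1 := load_le_virtual hG h hr (R := range G.m \ R) sdiff_subset
      fun i hi i' hi' hnot j hj j' hj' he => by
        rw [mem_sdiff, mem_range] at hi hnot
        have hi'R : i' ∈ R := by
          by_contra hc
          exact hnot ⟨hi', hc⟩
        refine hclosed i' hi'R i hi.1 hi.2 j' hj' j hj ⟨he.cls.symm, ?_, he.right, he.left⟩
        have := he.lt
        have := hG.p_le j hj
        show G.pm - G.p j < G.pm - G.p j'
        omega
    have h2 := sum_sdiff (f := G.load x') hR
    rw [hr.sum_load] at h2
    have h3 := sum_sdiff (f := G.virtual a) hR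
    have h4 := h.sum_virtual_lt
    have h5 : R.card * (G.Q * G.lo (a G.m)) ≤ ∑ i ∈ R, G.virtual a i := by
      rw [← smul_eq_mul]
      exact card_nsmul_le_sum _ _ _ fun i hi => h.le_virtual (mem_range.1 (hR hi))
    have h6 : R.card * G.lo (a G.m) ≤ ∑ i ∈ R, G.load x' i := by
      refine Nat.lt_succ_iff.1 (Nat.lt_of_mul_lt_mul_left (a := G.Q) ?_)
      rw [← h2, mul_add, mul_add] at h4
      rw [Nat.succ_eq_add_one, mul_add]
      have : G.Q * (R.card * G.lo (a G.m)) = R.card * (G.Q * G.lo (a G.m)) := by ring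
      omega
    have h7 : ∑ i ∈ R, E i + ∑ i ∈ R, G.load x' i = R.card * (G.Q * G.pm) := by
      rw [← sum_add_distrib, ← smul_eq_mul, ← sum_const]
      refine sum_congr rfl fun i hi => ?_
      have hi' := mem_range.1 (hR hi)
      rw [hx'.load_eq_below hG hx hi', Nat.sub_add_cancel (hr.load_le hG hi')]
    have h8 := (h.lo_le_work hG).trans hG.work_le'
    have h9 : R.card * (G.Q * G.pm + 1 - G.lo (a G.m)) + R.card * G.lo (a G.m) =
        R.card * (G.Q * G.pm) + R.card := by
      rw [← mul_add, Nat.sub_add_cancel (by omega)]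
      ring
    have := hne.card_pos
    omega
  · have := Params.Good.le_add_width hij.symm
    show G.pm - G.p i ≤ G.pm - G.p j + G.w
    omega
  · calc _ ≤ ∑ _i ∈ range G.m, G.Q * G.pm := sum_le_sum fun i _ => Nat.sub_le _ _
      _ = G.m * G.Q * G.pm := by simp [mul_assoc]

end

/-! ### The distribution that is read off from a path -/

/-- Of the first `c` jobs of a class, `part j c` have type `j`. -/
theorem sum_part {G : Params} (k c d : ℕ) :
    ∑ j ∈ range d, G.part j c * (if G.cls j = k then 1 else 0) =
      min c (∑ j ∈ range d, if G.cls j = k then G.cnt j else 0) := by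
  induction d with
  | zero => simp
  | succ d ih =>
    rw [sum_range_succ, sum_range_succ, ih]
    by_cases h : G.cls d = k
    · simp only [h, if_true, Params.part, Params.pre]
      omega
    · simp [h]

theorem IsPath.realizes {G : Params} (hG : G.Good) {a : ℕ → ℕ} (h : IsPath G a) :
    Realizes G a (fun i j => G.share (a i) (a (i + 1)) j) := by
  have hmono : ∀ j, Monotone (G.part j) := fun j c c' hc =>
    min_le_min_right _ (Nat.sub_le_sub_right hc _)
  refine ⟨fun j hj => ?_, fun i hi k hk => ?_⟩
  · have hk := hG.cls_lt hj
    have tele : ∀ t ≤ G.m, ∑ i ∈ range t, G.share (a i) (a (i + 1)) j =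
        G.part j (G.num (a t) (G.cls j)) := by
      intro t ht
      induction t with
      | zero => simp [h.num_zero, Params.part]
      | succ t ih =>
        rw [sum_range_succ, ih (by omega), Params.share]
        have := hmono j ((h.step t (by omega)).cls _ hk).num
        omega
    rw [tele G.m le_rfl, h.final.num _ hk, Params.part]
    refine min_eq_right ?_
    have h1 : ∑ j' ∈ range (j + 1), (if G.cls j' = G.cls j then G.cnt j' else 0) ≤
        G.size (G.cls j) := sum_le_sum_of_subset (range_mono (Nat.succ_le_of_lt hj))
    rw [sum_range_succ, if_pos rfl] at h1
    rw [Params.pre]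
    omega
  · have hle : ∀ t ≤ G.m, G.num (a t) k ≤ G.size k := by
      intro t ht
      rw [← h.final.num k hk, h.num_eq ht hk, h.num_eq le_rfl hk]
      exact sum_le_sum_of_subset (range_mono ht)
    have e : ∀ t ≤ G.m, ∑ j ∈ range G.d, G.part j (G.num (a t) k) * (if G.cls j = k then 1 else 0) =
        G.num (a t) k := fun t ht => by
      rw [sum_part]
      exact min_eq_left (hle t ht)
    have h1 : ∑ j ∈ range G.d, G.share (a i) (a (i + 1)) j * (if G.cls j = k then 1 else 0) +
        G.num (a i) k = G.num (a (i + 1)) k := by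
      refine Eq.trans ?_ (e (i + 1) (by omega))
      refine (congrArg₂ (· + ·) rfl (e i (by omega)).symm).trans ?_
      rw [← sum_add_distrib]
      refine sum_congr rfl fun j _ => ?_
      split_ifs with hjk
      · subst hjk
        have := hmono j ((h.step i hi).cls _ hk).num
        rw [Params.share]
        omega
      · simp
    rw [Params.slots]
    omega

end Scheduling

/-! ### The parameters of an instance -/

namespace Scheduling

open WordRAM Finset

/-- The parameters that the program computes from `d` types with processing times `p` and
multiplicities `n`, from `m` machines, and from `ε = u / v`. -/
def Params.ofInput (d m u v : ℕ) (p n : ℕ → ℕ) : Params :=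
  let pm := (range d).sup p
  let w := u * pm / (2 * v)
  let D := pm * pm
  let Q := pm * m * (D + 1) + 1
  { d, m, pm, w, K := pm / (w + 1) + 1, Q, B := Q * Q * pm + 1, p,
    cnt := fun j => n j - m * (n j / m - D)
    base := fun j => n j / m - D }

section

variable {d m u v : ℕ} {p n : ℕ → ℕ}

theorem Params.cnt_ofInput_lt (hm : 0 < m) (j : ℕ) : (ofInput d m u v p n).cnt j <
    m * ((range d).sup p * (range d).sup p + 1) := by
  simp only [ofInput]
  generalize (range d).sup p * (range d).sup p = D
  have h1 := Nat.div_add_mod (n j) m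
  have h2 := Nat.mod_lt (n j) hm
  rw [Nat.mul_sub, mul_add, mul_one]
  omega

theorem Params.good_ofInput (hd : 0 < d) (hm : 0 < m) (hp : ∀ j < d, 0 < p j)
    (hinj : ∀ i < d, ∀ j < d, p i = p j → i = j) : (ofInput d m u v p n).Good := by
  have hle : ∀ j < d, p j ≤ (range d).sup p := fun j hj => le_sup (mem_range.2 hj)
  have hd' : d ≤ (range d).sup p := by
    have := card_le_card_of_injOn p (s := range d) (t := Icc 1 ((range d).sup p))
      (fun j hj => mem_coe.2 (mem_Icc.2 ⟨hp j (mem_range.1 hj), hle j (mem_range.1 hj)⟩))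
      fun i hi j hj h => hinj i (by simpa using hi) j (by simpa using hj) h
    simpa using this
  refine ⟨hd, hm, hd', hp, hle, rfl, rfl, ?_, ?_⟩
  · exact Nat.lt_succ_of_le (Nat.le_mul_of_pos_right _ (Nat.succ_pos _))
  · refine Nat.lt_succ_of_le ?_
    calc _ ≤ ∑ _j ∈ range d, m * ((range d).sup p * (range d).sup p + 1) :=
          sum_le_sum fun j _ => (cnt_ofInput_lt hm j).le
      _ = d * (m * ((range d).sup p * (range d).sup p + 1)) := by simp
      _ ≤ _ := by
        rw [← mul_assoc]
        refine Nat.mul_le_mul_right _ ?_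
        exact Nat.mul_le_mul_right _ hd'

/-- The program computes the parameters; `u ≤ v` ensures that `w` is at most `pmax`. -/
theorem wp_setup {V N : ℕ} {s : State} (hG : (Params.ofInput d m u v p n).Good)
    (hN : (Params.ofInput d m u v p n).S ≤ N) (huv : u ≤ v) (hd : s.reg rD = d)
    (hm : s.reg rM = m) (hu : s.reg rNum = u) (hv : s.reg rDen = v)
    (hp : ∀ j < d, s.arr aP j = p j) (hn : ∀ j < d, s.arr aN j = n j) :
    WP V N setup (Env (Params.ofInput d m u v p n)) s := by
  set G := Params.ofInput d m u v p n with hGdef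
  refine .of_bounded fun hNV hb => ?_
  have hSV : G.S ≤ V := hN.trans hNV
  have hBV : G.B ≤ V := hG.B_le.trans hSV
  have hQV : G.Q ≤ V := hG.Q_lt.le.trans hBV
  have hpmV : G.pm ≤ V := hG.pm_lt.le.trans hQV
  have hdN : d ≤ N := hG.d_le.trans (hG.pm_lt.le.trans (hG.Q_lt.le.trans (hG.B_le.trans hN)))
  refine wp_seq_set_eq 0 rfl (Nat.zero_le _) ?_
  generalize hs₁ : State.setReg _ _ _ = s₁
  have hF₁ : Frame [rPmax] [] s s₁ := hs₁ ▸ (Frame.refl _ _ s).setReg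
  have h1 : s₁.reg rPmax = 0 := by simp [← hs₁]
  refine wp_seq (wp_for d (fun j s' => s'.reg rPmax = (range j).sup p) hdN (by decide)
    (fun s' hF => ?_) (by simp [h1]) ?_ ?_)
  · simp [hF.reg rD (by decide), hF₁.reg rD (by decide), hd]
  · intro j s₂ hj hF₂ hrj hI
    have hpV : p j ≤ V := (hG.p_le j hj).trans hpmV
    have hcell : s₂.arr aP j = p j := by
      rw [hF₂.arr _ (by decide), hF₁.arr _ (by decide), hp j hj]
    refine wp_ite (fun h => wp_set ?_ fun _ => ?_) (fun h => wp_skip fun _ => ?_)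
    · simpa [hrj, hcell] using hpV
    all_goals
      simp only [Term.eval_sub, Term.eval_get, Term.eval_reg, hrj, hcell, hI] at h
      simp only [Term.eval_get, Term.eval_reg, hrj, hcell, State.setReg_reg, Nat.reduceEqDiff,
        if_true, if_false, range_add_one, sup_insert]
    · exact (sup_eq_left.2 (by omega)).symm
    · rw [hI]
      exact (sup_eq_right.2 (by omega)).symm
  intro s₂ hF₂ _ hpm _
  change s₂.reg rPmax = G.pm at hpm
  have hF₀₂ : Frame [ixJ, rPmax] [] s s₂ :=
    (hF₁.mono (by decide) (by decide)).trans (hF₂.mono (by decide) (by decide))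
  have hw : G.w ≤ G.pm := by
    refine Nat.div_le_of_le_mul ?_
    have h1 : u * G.pm ≤ v * G.pm := Nat.mul_le_mul_right _ huv
    have h2 : 2 * v * G.pm = v * G.pm + v * G.pm := by ring
    exact h1.trans (by omega)
  have hD : G.pm * G.pm < G.Q := by
    refine Nat.lt_succ_of_le ((Nat.le_succ _).trans (Nat.le_mul_of_pos_left _ ?_))
    exact Nat.mul_pos hG.pm_pos hG.m_pos
  refine wp_seq_set_eq G.w ?_ (hw.trans hpmV) (wp_seq_set_eq G.K ?_ ?_
    (wp_seq_set_eq (G.pm * G.pm) ?_ (hD.le.trans hQV) ?_))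
  · simp [hpm, hF₀₂.reg rNum (by decide), hF₀₂.reg rDen (by decide), hu, hv]
    rfl
  · simp [hpm]
    rfl
  · exact (Nat.le_mul_of_pos_right _ hG.B_pos).trans (hG.KB_le.trans hSV)
  · simp [hpm]
  generalize hs₃ : State.setReg _ _ _ = s₃
  have hF₃ : Frame [rWidth, rK, rDist] [] s₂ s₃ :=
    hs₃ ▸ (((Frame.refl _ _ s₂).setReg).setReg).setReg
  have h3 : s₃.reg rPmax = G.pm ∧ s₃.reg rWidth = G.w ∧ s₃.reg rK = G.K ∧
    s₃.reg rDist = G.pm * G.pm := by simp [← hs₃, hpm]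
  have hF₀₃ : Frame [ixJ, rPmax, rWidth, rK, rDist] [] s s₃ :=
    (hF₀₂.mono (by decide) (by decide)).trans (hF₃.mono (by decide) (by decide))
  clear hs₃
  refine wp_seq (wp_for d (fun j s' => ∀ i < j, s'.arr aBase i = G.base i ∧
    s'.arr aCnt i = G.cnt i) hdN (by decide) (fun s' hF => ?_) (fun _ h => by omega) ?_ ?_)
  · simp [hF.reg rD (by decide), hF₀₃.reg rD (by decide), hd]
  · intro j s₄ hj hF₄ hrj hI
    have hcell : s₄.arr aN j = n j := by
      rw [hF₄.arr _ (by decide), hF₀₃.arr _ (by decide), hn j hj]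
    have hmm : s₄.reg rM = m := by rw [hF₄.reg _ (by decide), hF₀₃.reg _ (by decide), hm]
    have hDD : s₄.reg rDist = G.pm * G.pm := by rw [hF₄.reg _ (by decide), h3.2.2.2]
    have e1 : (.get aN (§ixJ) / §rM - §rDist : Term).eval s₄ = G.base j := by
      simp [hrj, hcell, hmm, hDD]
      rfl
    refine .of_bounded fun _ hb₄ => ?_
    have hnV : n j ≤ V := hcell ▸ hb₄.arr _ _
    have hbase : G.base j ≤ n j := (Nat.sub_le _ _).trans (Nat.div_le_self _ _)
    refine wp_seq_put (by rw [e1]; exact hbase.trans hnV) ?_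
    rw [e1]
    simp only [Term.eval_reg, hrj]
    generalize hs₅ : State.setCell _ _ _ _ = s₅
    have hr₅ : s₅.reg = s₄.reg := by simp only [← hs₅]; rfl
    have ha₅ : s₅.arr aN = s₄.arr aN := by simp [← hs₅]
    have hb₅ : s₅.arr aBase = Function.update (s₄.arr aBase) j (G.base j) := by simp [← hs₅]
    have hc₅ : s₅.arr aCnt = s₄.arr aCnt := by simp [← hs₅]
    have e2 : (.get aN (§ixJ) - §rM * .get aBase (§ixJ) : Term).eval s₅ = G.cnt j := by
      simp [hr₅, hrj, ha₅, hcell, hmm, hb₅]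
      rfl
    refine wp_put (by rw [e2]; exact (Nat.sub_le _ _).trans hnV) fun _ i hi => ?_
    rw [e2]
    simp only [Term.eval_reg, hr₅, hrj, State.setReg_arr, State.setCell_arr, Nat.reduceEqDiff,
      if_true, if_false, hb₅, hc₅, Function.update_apply]
    split_ifs with h
    · simp [h]
    · exact hI i (by omega)
  intro s₄ hF₄ _ hI _
  have hF₀₄ : Frame [ixJ, rPmax, rWidth, rK, rDist] [aBase, aCnt] s s₄ :=
    (hF₀₃.mono (by decide) (by decide)).trans (hF₄.mono (by decide) (by decide))
  have hreg : s₄.reg rPmax = G.pm ∧ s₄.reg rWidth = G.w ∧ s₄.reg rK = G.K ∧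
      s₄.reg rDist = G.pm * G.pm := by
    simpa only [hF₄.reg rPmax (by decide), hF₄.reg rWidth (by decide), hF₄.reg rK (by decide),
      hF₄.reg rDist (by decide)] using h3
  have hmm : s₄.reg rM = m := by rw [hF₀₄.reg _ (by decide), hm]
  refine wp_seq_set_eq G.Q ?_ hQV (wp_seq_set_eq G.B ?_ hBV
    (wp_seq_set_eq (G.B * G.B) ?_ (hG.BB_le.trans hSV) ?_))
  · simp [hreg, hmm]
    rfl
  · simp [hreg]
    rfl
  · simp
  generalize hs₅ : State.setReg _ _ _ = s₅
  have hF₅ : Frame [rQ, rB, rS] [] s₄ s₅ := hs₅ ▸ (((Frame.refl _ _ s₄).setReg).setReg).setReg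
  have h5 : s₅.reg rQ = G.Q ∧ s₅.reg rB = G.B ∧ s₅.reg rS = G.B * G.B := by simp [← hs₅]
  clear hs₅
  have hK3 : 3 * G.K ≤ N := by
    refine le_trans ?_ (hG.KB_le.trans hN)
    rw [mul_comm]
    refine Nat.mul_le_mul_left _ ?_
    have h1 : 2 ≤ G.Q := by
      have := hG.pm_pos
      have := hG.pm_lt
      omega
    exact (show 3 ≤ 2 * 2 by omega).trans ((Nat.mul_le_mul h1 h1).trans hG.Q_mul_Q_lt.le)
  refine wp_for (3 * G.K) (fun k s' => s'.reg rS = G.B ^ (k + 2)) hK3 (by decide)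
    (fun s' hF => ?_) (by simp [h5, pow_two]) ?_ ?_
  · simp [hF.reg rK (by decide), hF₅.reg rK (by decide), hreg]
    exact .inl rfl
  · intro k s₆ hk hF₆ _ hI'
    have hBB : s₆.reg rB = G.B := by rw [hF₆.reg _ (by decide), h5.2.1]
    have e : (§rS * §rB : Term).eval s₆ = G.B ^ (k + 1 + 2) := by
      simp only [Term.eval_mul, Term.eval_reg, hI', hBB]
      ring
    refine wp_set (by rw [e]; exact (Nat.pow_le_pow_right hG.B_pos (by omega)).trans hSV)
      fun _ => ?_
    rw [e]
    simp
  · intro s₆ hF₆ _ hI'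
    have hF₄₆ : Frame [rQ, rB, rS, ixK] [] s₄ s₆ :=
      (hF₅.mono (by decide) (by decide)).trans (hF₆.mono (by decide) (by decide))
    constructor
    · rw [hF₄₆.reg _ (by decide), hF₀₄.reg _ (by decide), hd]
      rfl
    · rw [hF₄₆.reg _ (by decide), hmm]
      rfl
    · rw [hF₄₆.reg _ (by decide), hreg.1]
    · rw [hF₄₆.reg _ (by decide), hreg.2.1]
    · rw [hF₄₆.reg _ (by decide), hreg.2.2.1]
    · rw [hF₆.reg _ (by decide), h5.1]
    · rw [hF₆.reg _ (by decide), h5.2.1]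
    · exact hI'
    · intro j hj
      rw [hF₄₆.arr _ (by decide), hF₀₄.arr _ (by decide), hp j hj]
      rfl
    · intro j hj
      rw [hF₄₆.arr _ (by decide), (hI j hj).2]
    · intro j hj
      rw [hF₄₆.arr _ (by decide), (hI j hj).1]

end

end Scheduling

/-! ### The whole program -/

namespace Scheduling

open WordRAM Finset

/-- The table can be followed back to an initial code. -/
theorem TableSound.exists_path {G : Params} {f : ℕ → ℕ} (hf : TableSound G f) (t b : ℕ)
    (hb : b < G.S) (h : f (t * G.S + b) ≠ 0) : ∃ a : ℕ → ℕ, a t = b ∧ a 0 < G.B * G.B ∧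
      (∀ i ≤ t, a i < G.S) ∧ ∀ i < t, G.Step (a i) (a (i + 1)) ∧
        f ((i + 1) * G.S + a (i + 1)) = a i + 1 := by
  induction t generalizing b with
  | zero =>
    rcases hf 0 b hb h with ⟨-, h1⟩ | ⟨t', a, h1, -⟩
    · exact ⟨fun _ => b, rfl, h1, fun _ _ => hb, fun _ h => by omega⟩
    · omega
  | succ t ih =>
    rcases hf (t + 1) b hb h with ⟨h1, -⟩ | ⟨t', c, h1, hc, h2, h3, h4⟩
    · omega
    · obtain rfl : t = t' := by omega
      obtain ⟨a, e, h0, hlt, hs⟩ := ih c hc h3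
      have hold : ∀ i ≤ t, Function.update a (t + 1) b i = a i := fun i hi =>
        Function.update_of_ne (by omega) _ _
      refine ⟨Function.update a (t + 1) b, by simp, by rwa [hold 0 (by omega)], fun i hi => ?_,
        fun i hi => ?_⟩
      · rcases Nat.le_succ_iff.1 hi with h' | rfl
        · rw [hold i h']
          exact hlt i h'
        · simpa using hb
      · rw [hold i (by omega)]
        rcases Nat.lt_succ_iff_lt_or_eq.1 hi with h' | rfl
        · rw [hold (i + 1) (by omega)]
          exact hs i h'
        · rw [Function.update_self, e]
          exact ⟨h4, h2⟩

theorem IsPath.valid {G : Params} {a f : ℕ → ℕ} (h : IsPath G a)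
    (hf : TableComplete G (fun t _ _ => t < G.m) f) : G.Valid f (a G.m) := by
  refine ⟨h.lt _ le_rfl, ?_, h.final⟩
  have key : ∀ t ≤ G.m, f (t * G.S + a t) ≠ 0 := by
    intro t
    induction t with
    | zero => intro _; simpa using hf.1 _ h.start
    | succ t ih =>
      intro ht
      exact hf.2 t _ _ (h.lt _ (by omega)) (h.lt _ ht) (by omega) (ih (by omega))
        (h.step t (by omega))
  exact key _ le_rfl

theorem IsPath.lo_le_up {G : Params} (hG : G.Good) {a : ℕ → ℕ} (h : IsPath G a) :
    G.lo (a G.m) ≤ G.up (a G.m) :=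
  Nat.lt_succ_iff.1 (Nat.lt_of_mul_lt_mul_left
    ((h.le_virtual hG.m_pos).trans_lt (h.virtual_lt hG.m_pos)))

section

variable {d m u v : ℕ} {p n : ℕ → ℕ}

theorem Params.cnt_add_base_le (hm : 0 < m) (j : ℕ) :
    (ofInput d m u v p n).cnt j + (ofInput d m u v p n).base j ≤ n j := by
  simp only [ofInput]
  generalize (range d).sup p * (range d).sup p = D
  have h1 : m * (n j / m - D) ≤ n j :=
    (Nat.mul_le_mul_left _ (Nat.sub_le _ _)).trans (Nat.mul_div_le _ _)
  have h2 : n j / m - D ≤ m * (n j / m - D) := Nat.le_mul_of_pos_left _ hm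
  omega

/-- The program distributes the jobs such that the loads satisfy the bounds of some path up to `w`,
and that path is at least as good as any given one. -/
theorem wp_solve {V N : ℕ} {s : State} (obj : Objective)
    (hG : (Params.ofInput d m u v p n).Good)
    (hN : (Params.ofInput d m u v p n).S ≤ N) (huv : u ≤ v) (hd : s.reg rD = d)
    (hm : s.reg rM = m) (hu : s.reg rNum = u) (hv : s.reg rDen = v)
    (hp : ∀ j < d, s.arr aP j = p j) (hn : ∀ j < d, s.arr aN j = n j)
    (htab : ∀ i, s.arr aTab i = 0) {a₀ : ℕ → ℕ} (ha₀ : IsPath (Params.ofInput d m u v p n) a₀) :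
    WP V N (solve obj) (fun s' => ∃ (G : Params) (a : ℕ → ℕ) (x : ℕ → ℕ → ℕ),
      G = Params.ofInput d m u v p n ∧ IsPath G a ∧ G.val (a m) obj ≤ G.val (a₀ m) obj ∧
      Realizes G a x ∧
      (∀ i < m, G.lo (a m) ≤ G.load x i + G.w ∧ G.load x i ≤ G.up (a m) + G.w) ∧
      HasJobs G (fun i j => x i j + G.base j) s') s := by
  refine .of_bounded fun hNV hb => ?_
  refine wp_seq ((wp_setup hG hN huv hd hm hu hv hp hn).mono fun s₁ hF₁ hE₁ _ => ?_)
  have hcb : ∀ j < d, (Params.ofInput d m u v p n).cnt j + (Params.ofInput d m u v p n).base j ≤ V :=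
    fun j hj => (Params.cnt_add_base_le hG.m_pos j).trans (hn j hj ▸ hb.arr _ _)
  obtain ⟨G, hGd, hGm, hGeq⟩ : ∃ G : Params, G.d = d ∧ G.m = m ∧ G = Params.ofInput d m u v p n :=
    ⟨_, rfl, rfl, rfl⟩
  rw [← hGeq] at hG hN ha₀ hE₁ hcb
  subst hGd hGm
  clear hd hm hu hv hp hn huv
  refine wp_seq ((wp_fillTable hE₁ hG hN fun i => by
    rw [hF₁.arr _ (by decide), htab]).mono fun s₂ hF₂ ⟨hsound, hcomp⟩ _ => ?_)
  have hE₂ := hE₁.frame hF₂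
  refine wp_seq ((wp_choose obj hE₂ hG hN ⟨_, ha₀.valid hcomp⟩).mono
    fun s₃ hF₃ ⟨hvalid, hbest⟩ _ => ?_)
  have hE₃ := hE₂.frame hF₃ (by cases obj <;> decide) (by cases obj <;> decide)
  obtain ⟨a, hend, h0, hlt, hstep⟩ := hsound.exists_path _ _ hvalid.1 hvalid.2.1
  have ha : IsPath G a := ⟨h0, hlt, fun i hi => (hstep i hi).1, hend ▸ hvalid.2.2⟩
  have hval := hbest _ (ha₀.valid hcomp)
  rw [← hend] at hval
  refine wp_seq ((wp_assign hE₃ hG hN a hend.symm fun i hi => by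
    rw [hF₃.arr _ (by cases obj <;> decide)]
    exact (hstep i hi).2).mono fun s₄ hF₄ hx₄ _ => ?_)
  have hE₄ := hE₃.frame hF₄
  have hr₀ := ha.realizes hG
  have hb₄ : s₄.reg rBest = a G.m := (hF₄.reg _ (by decide)).trans hend.symm
  refine wp_seq ((wp_prepareAbove hE₄ hG hN hx₄ fun i hi => hr₀.load_le hG hi).mono
    fun s₅ hF₅ hP₅ _ => ?_)
  have hE₅ := hE₄.frame hF₅
  rw [hb₄] at hP₅
  refine wp_seq ((wp_balance hE₅ hG hN (balanceable_above hG ha hr₀) (fun i hi j hj => by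
    rw [hF₅.arr _ (by decide)]
    exact hx₄ i hi j hj) hP₅).mono fun s₆ hF₆ ⟨x, E, hR, hx₆, hL₆, hfin⟩ _ => ?_)
  have hE₆ := hE₅.frame hF₆
  have hr₁ := hR.realizes hr₀
  have hload : ∀ i < G.m, E i = G.load x i := fun i hi => hR.load_eq (fun _ _ => rfl) hi
  refine wp_seq ((wp_prepareBelow hE₆ hG hN (L := G.load x)
    fun i hi => (hL₆ i hi).trans (hload i hi)).mono fun s₇ hF₇ hP₇ _ => ?_)
  have hE₇ := hE₆.frame hF₇
  have hb₇ : s₆.reg rBest = a G.m := by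
    rw [hF₆.reg _ (by decide), hF₅.reg _ (by decide), hb₄]
  rw [hb₇] at hP₇
  refine wp_seq ((wp_balance hE₇ hG hN (balanceable_below hG ha hr₁) (fun i hi j hj => by
    rw [hF₇.arr _ (by decide)]
    exact hx₆ i hi j hj) hP₇).mono fun s₈ hF₈ ⟨y, E', hR', hx₈, _, hfin'⟩ _ => ?_)
  have hE₈ := hE₇.frame hF₈
  have hr₂ := hR'.realizes hr₁
  refine (wp_addBase hE₈ ((Nat.le_mul_of_pos_right _ hG.d_pos).trans (hG.mdd_le.trans hN)) hx₈
    fun i hi j hj => le_trans ?_ (hcb j hj)).mono fun s₉ _ hx₉ => ?_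
  · rw [← hr₂.cols j hj]
    exact Nat.add_le_add_right (single_le_sum (f := fun i => y i j) (fun _ _ => Nat.zero_le _)
      (mem_range.2 hi)) _
  · refine ⟨G, a, y, hGeq, ha, hval, hr₂, fun i hi => ?_, hx₉⟩
    have h1 := hfin i hi
    have h2 := hfin' i hi
    rw [hload i hi] at h1
    rw [hR'.load_eq_below hG hr₁ hi] at h2
    have h3 := hr₁.load_le hG hi
    have h4 := hr₂.load_le hG hi
    have h5 := ha.lo_le_up hG
    have h6 := (ha.lo_le_work hG).trans hG.work_le'
    simp only [min_def] at h2
    split_ifs at h2 <;> omega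

end

end Scheduling

/-! ### Nearly uniform schedules -/

namespace Scheduling

open WordRAM Finset

/-- The numbers of jobs after `c` jobs of type `a` have been moved from machine `i` to `i'`. -/
def moveJobs (x : ℕ → ℕ → ℕ) (a c i i' r j : ℕ) : ℕ :=
  if j = a then shiftLoad (fun r => x r a) c i i' r else x r j

section

variable {x : ℕ → ℕ → ℕ} {d m a c i i' : ℕ}

theorem sum_moveJobs_col (hii : i ≠ i') (hi : i < m) (hi' : i' < m) (hc : c ≤ x i a) (j : ℕ) :
    ∑ r ∈ range m, moveJobs x a c i i' r j = ∑ r ∈ range m, x r j := by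
  by_cases hj : j = a
  · subst hj
    simp only [moveJobs, if_true]
    rw [sum_shiftLoad hii hi hi' fun _ e => e, sum_eq_add_add_erase hii hi hi' fun r => x r j]
    omega
  · simp [moveJobs, hj]

theorem load_moveJobs (p : ℕ → ℕ) (ha : a < d) (hc : c ≤ x i a) (r : ℕ) :
    ∑ j ∈ range d, moveJobs x a c i i' r j * p j =
      shiftLoad (fun r => ∑ j ∈ range d, x r j * p j) (c * p a) i i' r := by
  have e : ∀ y : ℕ → ℕ, ∑ j ∈ range d, y j * p j =
      y a * p a + ∑ j ∈ (range d).erase a, y j * p j := fun y =>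
    (add_sum_erase _ _ (mem_range.2 ha)).symm
  have e' : ∑ j ∈ (range d).erase a, moveJobs x a c i i' r j * p j =
      ∑ j ∈ (range d).erase a, x r j * p j :=
    sum_congr rfl fun j hj => by rw [moveJobs, if_neg (ne_of_mem_erase hj)]
  rw [e, e', moveJobs, if_pos rfl]
  simp only [shiftLoad]
  rw [e]
  split_ifs with h1
  · subst h1
    have := Nat.mul_le_mul_right (p a) hc
    rw [Nat.sub_mul]
    omega
  · rw [add_mul]
    omega
  · rfl

/-- Moving a small amount from a large number to a small one decreases the sum of the squares. -/
theorem sum_sq_shiftLoad_lt {E : ℕ → ℕ} {δ : ℕ} (hi : i < m) (hi' : i' < m) (hδ : 0 < δ)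
    (h : E i' + δ < E i) :
    ∑ r ∈ range m, shiftLoad E δ i i' r ^ 2 < ∑ r ∈ range m, E r ^ 2 := by
  have hii : i ≠ i' := by
    rintro rfl
    omega
  rw [sum_shiftLoad hii hi hi' fun _ e => e ^ 2, sum_eq_add_add_erase hii hi hi' fun r => E r ^ 2]
  obtain ⟨y, hy⟩ : ∃ y, E i = E i' + δ + y := ⟨E i - (E i' + δ), by omega⟩
  have hy' : E i - δ = E i' + y := by omega
  have hy0 : 0 < y := by omega
  rw [hy', hy]
  nlinarith [Nat.mul_pos hδ hy0]

theorem sum_sq_moveJobs_lt (ha : a < d) (hi : i < m) (hi' : i' < m) (hc : 0 < c)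
    (h : x i' a + c < x i a) :
    ∑ j ∈ range d, ∑ r ∈ range m, moveJobs x a c i i' r j ^ 2 <
      ∑ j ∈ range d, ∑ r ∈ range m, x r j ^ 2 := by
  refine sum_lt_sum (fun j _ => ?_) ⟨a, mem_range.2 ha, ?_⟩
  · by_cases hj : j = a
    · subst hj
      simp only [moveJobs, if_true]
      exact (sum_sq_shiftLoad_lt hi hi' hc h).le
    · simp [moveJobs, hj]
  · simp only [moveJobs, if_true]
    exact sum_sq_shiftLoad_lt hi hi' hc h

end

/-- A schedule whose loads, and among these whose numbers of jobs, have the least sum of squares is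
nearly uniform. -/
theorem exists_nearly_uniform {d m pm ℓ u : ℕ} {p n : ℕ → ℕ} (hd : d ≤ pm)
    (hp : ∀ j < d, 0 < p j) (hp' : ∀ j < d, p j ≤ pm) {x : ℕ → ℕ → ℕ}
    (hx : ∀ j < d, ∑ i ∈ range m, x i j = n j)
    (hℓ : ∀ i < m, ℓ ≤ ∑ j ∈ range d, x i j * p j)
    (hu : ∀ i < m, ∑ j ∈ range d, x i j * p j ≤ u) :
    ∃ y : ℕ → ℕ → ℕ, (∀ j < d, ∑ i ∈ range m, y i j = n j) ∧
      (∀ i < m, ℓ ≤ ∑ j ∈ range d, y i j * p j) ∧ (∀ i < m, ∑ j ∈ range d, y i j * p j ≤ u) ∧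
      ∀ i < m, ∀ j < d, n j / m - pm * pm ≤ y i j := by
  let L : (ℕ → ℕ → ℕ) → ℕ → ℕ := fun y i => ∑ j ∈ range d, y i j * p j
  let P : (ℕ → ℕ → ℕ) → Prop := fun y => (∀ j < d, ∑ i ∈ range m, y i j = n j) ∧
    (∀ i < m, ℓ ≤ L y i) ∧ ∀ i < m, L y i ≤ u
  let F : (ℕ → ℕ → ℕ) → ℕ ×ₗ ℕ := fun y =>
    toLex (∑ i ∈ range m, L y i ^ 2, ∑ j ∈ range d, ∑ i ∈ range m, y i j ^ 2)
  obtain ⟨y, hy, hmin⟩ := WellFounded.has_min (InvImage.wf F wellFounded_lt) {y | P y}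
    ⟨x, hx, hℓ, hu⟩
  obtain ⟨hcol, hlow, hupp⟩ : P y := hy
  have hmin' : ∀ z, P z → ¬ F z < F y := fun z hz => hmin z hz
  -- A machine whose load is much larger than that of another could pass on one of its jobs.
  have hload : ∀ i < m, ∀ i' < m, L y i ≤ L y i' + pm := by
    intro i hi i' hi'
    by_contra! hlt
    obtain ⟨a, ha, hpos⟩ : ∃ a < d, 0 < y i a := by
      by_contra! hno
      have : L y i = 0 := sum_eq_zero fun j hj => by
        rw [Nat.le_zero.1 (hno j (mem_range.1 hj)), zero_mul]
      omega
    have hpa := hp' a ha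
    have hL : ∀ r, L (moveJobs y a 1 i i') r = shiftLoad (L y) (p a) i i' r := fun r => by
      simpa only [one_mul] using load_moveJobs (i' := i') p ha (c := 1) hpos r
    have hii : i ≠ i' := by
      rintro rfl
      omega
    refine hmin' (moveJobs y a 1 i i') ⟨fun j hj =>
      (sum_moveJobs_col hii hi hi' hpos j).trans (hcol j hj), fun r hr => ?_, fun r hr => ?_⟩ ?_
    · rw [hL, shiftLoad]
      have := hlow i' hi'
      have := hlow r hr
      split_ifs with h1
      · subst h1
        omega
      · omega
      · omega
    · rw [hL, shiftLoad]
      have := hupp i hi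
      have := hupp r hr
      split_ifs with h1 h2
      · omega
      · subst h2
        omega
      · omega
    · refine Prod.Lex.toLex_lt_toLex.2 (.inl ?_)
      simp only [hL]
      exact sum_sq_shiftLoad_lt hi hi' (hp a ha) (by omega)
  -- If the numbers of jobs of one type differ much, then those of another type differ much in the
  -- other direction, and exchanging a batch of each keeps the loads.
  have huni : ∀ i < m, ∀ i' < m, ∀ a < d, y i a ≤ y i' a + pm * pm := by
    intro i hi i' hi' a ha
    by_contra! hlt
    have hii : i ≠ i' := by
      rintro rfl
      omega
    obtain ⟨b, hb, hba, hgt⟩ : ∃ b < d, b ≠ a ∧ y i b + p a < y i' b := by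
      by_contra! hno
      have h1 : L y i' ≤ L y i + pm := hload i' hi' i hi
      have e : ∀ r, L y r = y r a * p a + ∑ j ∈ (range d).erase a, y r j * p j := fun r =>
        (add_sum_erase _ _ (mem_range.2 ha)).symm
      have h2 : ∑ j ∈ (range d).erase a, y i' j * p j ≤
          ∑ j ∈ (range d).erase a, y i j * p j + (d - 1) * (p a * pm) := by
        have hcard : ((range d).erase a).card = d - 1 := by
          rw [card_erase_of_mem (mem_range.2 ha), card_range]
        rw [← hcard, ← smul_eq_mul, ← sum_const, ← sum_add_distrib]
        refine sum_le_sum fun j hj => ?_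
        obtain ⟨hja, hj⟩ := mem_erase.1 hj
        rw [mem_range] at hj
        have h3 := Nat.mul_le_mul_right (p j) (hno j hj hja)
        have h4 := Nat.mul_le_mul_left (p a) (hp' j hj)
        rw [add_mul] at h3
        omega
      have h0 : L y i ≤ L y i' + pm := hload i hi i' hi'
      rw [e i, e i'] at h0
      have h3 : (y i' a + pm * pm + 1) * p a ≤ y i a * p a := Nat.mul_le_mul_right _ hlt
      have h4 : (d - 1) * (p a * pm) + p a * pm ≤ pm * (p a * pm) := by
        rw [← Nat.succ_mul]
        exact Nat.mul_le_mul_right _ (by omega)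
      have h5 : pm ≤ p a * pm := Nat.le_mul_of_pos_left _ (hp a ha)
      have h6 := hp a ha
      nlinarith
    have hpb := hp' b hb
    have hpa := hp' a ha
    have hpm : pm ≤ pm * pm := Nat.le_mul_of_pos_left _ (by omega)
    set y₁ := moveJobs y a (p b) i i' with hy₁
    have hb₁ : ∀ r, y₁ r b = y r b := fun r => by rw [hy₁, moveJobs, if_neg hba]
    have hc : p b ≤ y i a := by omega
    have hc₁ : p a ≤ y₁ i' b := by
      rw [hb₁]
      omega
    have hL : ∀ r, L (moveJobs y₁ b (p a) i' i) r = L y r := by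
      intro r
      have h1 : ∀ r, L y₁ r = _ := load_moveJobs (i' := i') p ha hc
      refine (load_moveJobs p hb hc₁ r).trans ?_
      change shiftLoad (L y₁) _ _ _ _ = _
      have h2 : p b * p a ≤ L y i := (Nat.mul_le_mul_right _ hc).trans
        (single_le_sum (f := fun j => y i j * p j) (fun _ _ => Nat.zero_le _) (mem_range.2 ha))
      simp only [shiftLoad, h1]
      rw [mul_comm (p a)]
      split_ifs with h3 h4 h4
      · exact absurd (h4.symm.trans h3) hii
      · exact Nat.add_sub_cancel _ _
      · subst h4
        exact Nat.sub_add_cancel h2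
      · rfl
    refine hmin' (moveJobs y₁ b (p a) i' i) ⟨fun j hj => ?_, fun r hr => ?_, fun r hr => ?_⟩ ?_
    · rw [sum_moveJobs_col hii.symm hi' hi hc₁, sum_moveJobs_col hii hi hi' hc, hcol j hj]
    · rw [hL]
      exact hlow r hr
    · rw [hL]
      exact hupp r hr
    · refine Prod.Lex.toLex_lt_toLex.2 (.inr ⟨by simp only [hL], ?_⟩)
      refine (sum_sq_moveJobs_lt hb hi' hi (hp a ha) ?_).trans
        (sum_sq_moveJobs_lt ha hi hi' (hp b hb) ?_)
      · rwa [hb₁, hb₁]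
      · omega
  refine ⟨y, hcol, hlow, hupp, fun i hi j hj => ?_⟩
  have h1 : n j ≤ m * (y i j + pm * pm) := by
    rw [← hcol j hj]
    refine (sum_le_sum fun r hr => huni r (mem_range.1 hr) i hi j hj).trans_eq ?_
    simp
  have := Nat.div_le_of_le_mul h1
  omega

end Scheduling

/-! ### Fractional redistributions and the order of the machines -/

namespace Scheduling

open WordRAM Finset

/-- The number of jobs of class `k` on machine `i`. -/
def Params.classNum (G : Params) (x : ℕ → ℕ → ℕ) (i k : ℕ) : ℕ :=
  ∑ j ∈ range G.d, x i j * (if G.cls j = k then 1 else 0)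

/-- The load of machine `i` by jobs of class `k`. -/
noncomputable def Params.classLoad (G : Params) (y : ℕ → ℕ → ℝ) (i k : ℕ) : ℝ :=
  ∑ j ∈ range G.d, if G.cls j = k then y i j * G.p j else 0

/-- `y` is a fractional redistribution of the jobs that keeps the loads of the machines and their
numbers of jobs of the classes. -/
structure Fractional (G : Params) (x : ℕ → ℕ → ℕ) (y : ℕ → ℕ → ℝ) : Prop where
  nonneg : ∀ i j, 0 ≤ y i j
  supp : ∀ i j, ¬ (i < G.m ∧ j < G.d) → y i j = 0
  cols : ∀ j < G.d, ∑ i ∈ range G.m, y i j = (∑ i ∈ range G.m, x i j : ℕ)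
  rows : ∀ i < G.m, ∀ k, ∑ j ∈ range G.d, (if G.cls j = k then y i j else 0) = G.classNum x i k
  load : ∀ i < G.m, ∑ j ∈ range G.d, y i j * G.p j = G.load x i

/-- The average processing time of the jobs of class `k` on machine `i`. -/
noncomputable def Params.average (G : Params) (x : ℕ → ℕ → ℕ) (y : ℕ → ℕ → ℝ) (i k : ℕ) : ℝ :=
  G.classLoad y i k / G.classNum x i k

/-- A convex function of the loads of the classes. Its gradient consists of the averages, so it
decreases when load of a class is shifted from a machine with a larger average to one with a smaller
average. -/
noncomputable def Params.spread (G : Params) (x : ℕ → ℕ → ℕ) (y : ℕ → ℕ → ℝ) : ℝ :=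
  ∑ i ∈ range G.m, ∑ k ∈ range G.K, G.classLoad y i k ^ 2 / G.classNum x i k

/-- In some class, machine `i` has smaller jobs than machine `i'`, on average. -/
def Params.Below (G : Params) (x : ℕ → ℕ → ℕ) (y : ℕ → ℕ → ℝ) (i i' : ℕ) : Prop :=
  i < G.m ∧ i' < G.m ∧ ∃ k < G.K, 0 < G.classNum x i k ∧ 0 < G.classNum x i' k ∧
    G.average x y i k < G.average x y i' k

/-- A feasible direction that shifts a unit of load from `i'` to `i` and decreases the spread. -/
structure Improving (G : Params) (x : ℕ → ℕ → ℕ) (y : ℕ → ℕ → ℝ) (i i' : ℕ) (v : ℕ → ℕ → ℝ) :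
    Prop where
  supp : ∀ r j, ¬ (r < G.m ∧ j < G.d) → v r j = 0
  cols : ∀ j < G.d, ∑ r ∈ range G.m, v r j = 0
  rows : ∀ r < G.m, ∀ k, ∑ j ∈ range G.d, (if G.cls j = k then v r j else 0) = 0
  load : ∀ r < G.m, ∑ j ∈ range G.d, v r j * G.p j =
    (if r = i then 1 else 0) - (if r = i' then 1 else 0)
  pos : ∀ r j, v r j < 0 → 0 < y r j
  deriv : ∑ r ∈ range G.m, ∑ k ∈ range G.K, G.average x y r k * G.classLoad v r k < 0

section

variable {G : Params} {x : ℕ → ℕ → ℕ} {y : ℕ → ℕ → ℝ}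

theorem Fractional.of_int (G : Params) (x : ℕ → ℕ → ℕ) :
    Fractional G x fun i j => if i < G.m ∧ j < G.d then x i j else 0 := by
  have e : ∀ i < G.m, ∀ j ∈ range G.d, (if i < G.m ∧ j < G.d then (x i j : ℝ) else 0) = x i j :=
    fun i hi j hj => if_pos ⟨hi, mem_range.1 hj⟩
  refine ⟨fun i j => ?_, fun i j h => if_neg h, fun j hj => ?_, fun i hi k => ?_, fun i hi => ?_⟩
  · split_ifs
    exacts [Nat.cast_nonneg _, le_rfl]
  · rw [Nat.cast_sum]
    exact sum_congr rfl fun i hi => e i (mem_range.1 hi) j (mem_range.2 hj)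
  · rw [Params.classNum, Nat.cast_sum]
    refine sum_congr rfl fun j hj => ?_
    rw [e i hi j hj]
    split_ifs <;> simp
  · rw [Params.load, Nat.cast_sum]
    refine sum_congr rfl fun j hj => ?_
    rw [e i hi j hj, Nat.cast_mul]

theorem Params.continuous_classLoad (i k : ℕ) : Continuous fun y => G.classLoad y i k := by
  refine continuous_finsetSum _ fun j _ => ?_
  split_ifs <;> fun_prop

theorem exists_min_spread (G : Params) (x : ℕ → ℕ → ℕ) :
    ∃ y, Fractional G x y ∧ ∀ y', Fractional G x y' → G.spread x y ≤ G.spread x y' := by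
  let U : ℕ → ℕ → ℝ := fun i j => if i < G.m ∧ j < G.d then (∑ i ∈ range G.m, x i j : ℕ) else 0
  have hcont : Continuous (G.spread x) := by
    refine continuous_finsetSum _ fun i _ => continuous_finsetSum _ fun k _ => ?_
    exact ((Params.continuous_classLoad i k).pow 2).div_const _
  have hclosed : IsClosed {y | Fractional G x y} := by
    have e : {y | Fractional G x y} = {y : ℕ → ℕ → ℝ | (∀ i j, 0 ≤ y i j) ∧
        (∀ i j, ¬ (i < G.m ∧ j < G.d) → y i j = 0) ∧
        (∀ j < G.d, ∑ i ∈ range G.m, y i j = ((∑ i ∈ range G.m, x i j : ℕ) : ℝ)) ∧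
        (∀ i < G.m, ∀ k, ∑ j ∈ range G.d, (if G.cls j = k then y i j else 0) =
          (G.classNum x i k : ℝ)) ∧
        ∀ i < G.m, ∑ j ∈ range G.d, y i j * (G.p j : ℝ) = (G.load x i : ℝ)} := by
      ext y
      exact ⟨fun h => ⟨h.1, h.2, h.3, h.4, h.5⟩, fun h => ⟨h.1, h.2.1, h.2.2.1, h.2.2.2.1, h.2.2.2.2⟩⟩
    rw [e]
    simp only [Set.ofPred_and, Set.ofPred_forall]
    refine .inter ?_ (.inter ?_ (.inter ?_ (.inter ?_ ?_)))
    · exact isClosed_iInter fun i => isClosed_iInter fun j =>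
        isClosed_le continuous_const (by fun_prop)
    · exact isClosed_iInter fun i => isClosed_iInter fun j => isClosed_iInter fun _ =>
        isClosed_eq (by fun_prop) continuous_const
    · exact isClosed_iInter fun j => isClosed_iInter fun _ =>
        isClosed_eq (by fun_prop) continuous_const
    · refine isClosed_iInter fun i => isClosed_iInter fun _ => isClosed_iInter fun k =>
        isClosed_eq (continuous_finsetSum _ fun j _ => ?_) continuous_const
      split_ifs <;> fun_prop
    · exact isClosed_iInter fun j => isClosed_iInter fun _ =>
        isClosed_eq (by fun_prop) continuous_const
  have hsub : {y | Fractional G x y} ⊆ Set.Icc 0 U := by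
    intro y hy
    refine ⟨fun i j => hy.nonneg i j, fun i j => ?_⟩
    simp only [U]
    split_ifs with h
    · rw [← hy.cols j h.2]
      exact single_le_sum (f := fun i => y i j) (fun i _ => hy.nonneg i j) (mem_range.2 h.1)
    · exact (hy.supp i j h).le
  obtain ⟨y, hy, hmin⟩ := (isCompact_Icc.of_isClosed_subset hclosed hsub).exists_isMinOn
    ⟨_, Fractional.of_int G x⟩ hcont.continuousOn
  exact ⟨y, hy, fun y' hy' => hmin hy'⟩

theorem Params.classLoad_add (u v : ℕ → ℕ → ℝ) (i k : ℕ) :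
    G.classLoad (u + v) i k = G.classLoad u i k + G.classLoad v i k := by
  simp only [Params.classLoad, ← sum_add_distrib]
  refine sum_congr rfl fun j _ => ?_
  split_ifs
  · rw [Pi.add_apply, Pi.add_apply, add_mul]
  · rw [add_zero]

theorem Params.classLoad_smul (t : ℝ) (v : ℕ → ℕ → ℝ) (i k : ℕ) :
    G.classLoad (t • v) i k = t * G.classLoad v i k := by
  simp only [Params.classLoad, mul_sum]
  refine sum_congr rfl fun j _ => ?_
  split_ifs
  · rw [Pi.smul_apply, Pi.smul_apply, smul_eq_mul, mul_assoc]
  · rw [mul_zero]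

theorem Improving.trans {i i' i'' : ℕ} {u v : ℕ → ℕ → ℝ} (hu : Improving G x y i i' u)
    (hv : Improving G x y i' i'' v) : Improving G x y i i'' (u + v) where
  supp r j h := by rw [Pi.add_apply, Pi.add_apply, hu.supp r j h, hv.supp r j h, add_zero]
  cols j hj := by
    simp only [Pi.add_apply, sum_add_distrib, hu.cols j hj, hv.cols j hj, add_zero]
  rows r hr k := by
    have h := congrArg₂ (· + ·) (hu.rows r hr k) (hv.rows r hr k)
    rw [← sum_add_distrib, add_zero] at h
    refine (sum_congr rfl fun j _ => ?_).trans h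
    split_ifs <;> simp
  load r hr := by
    simp only [Pi.add_apply, add_mul, sum_add_distrib, hu.load r hr, hv.load r hr]
    ring
  pos r j h := by
    rw [Pi.add_apply, Pi.add_apply] at h
    by_cases h' : u r j < 0
    · exact hu.pos r j h'
    · exact hv.pos r j (by linarith)
  deriv := by
    simp only [Params.classLoad_add, mul_add, sum_add_distrib]
    linarith [hu.deriv, hv.deriv]

/-- A machine with a positive number of jobs of a class has a job below the average, and one above
it. -/
theorem Fractional.exists_le_average (hy : Fractional G x y) {i k : ℕ} (hi : i < G.m)
    (h : 0 < G.classNum x i k) :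
    (∃ a < G.d, G.cls a = k ∧ 0 < y i a ∧ (G.p a : ℝ) ≤ G.average x y i k) ∧
      ∃ b < G.d, G.cls b = k ∧ 0 < y i b ∧ G.average x y i k ≤ G.p b := by
  set R := (range G.d).filter fun j => G.cls j = k ∧ 0 < y i j with hR
  have restrict : ∀ f : ℕ → ℝ, (∀ j, y i j = 0 → f j = 0) →
      ∑ j ∈ range G.d, (if G.cls j = k then f j else 0) = ∑ j ∈ R, f j := by
    intro f hf
    rw [hR, sum_filter]
    refine sum_congr rfl fun j _ => ?_
    by_cases h1 : G.cls j = k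
    · by_cases h2 : 0 < y i j
      · simp [h1, h2]
      · simp [h2, hf j (le_antisymm (not_lt.1 h2) (hy.nonneg i j))]
    · simp [h1]
  have hcount : ∑ j ∈ R, y i j = G.classNum x i k := by
    rw [← hy.rows i hi k, restrict _ fun _ h => h]
  have hpos : (0 : ℝ) < G.classNum x i k := Nat.cast_pos.2 h
  have hload : ∑ j ∈ R, y i j * G.p j = ∑ j ∈ R, y i j * G.average x y i k := by
    rw [← sum_mul, hcount, Params.average, mul_div_cancel₀ _ hpos.ne', Params.classLoad,
      restrict (fun j => y i j * G.p j) fun j h => by rw [h, zero_mul]]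
  have hne : R.Nonempty := by
    by_contra h0
    rw [not_nonempty_iff_eq_empty.1 h0, sum_empty] at hcount
    exact hpos.ne hcount
  have split : ∀ j ∈ R, j < G.d ∧ G.cls j = k ∧ 0 < y i j := fun j hj => by
    simpa [hR] using hj
  constructor
  · obtain ⟨a, ha, hle⟩ := exists_le_of_sum_le hne hload.le
    obtain ⟨h1, h2, h3⟩ := split a ha
    exact ⟨a, h1, h2, h3, le_of_mul_le_mul_left hle h3⟩
  · obtain ⟨b, hb, hle⟩ := exists_le_of_sum_le hne hload.ge
    obtain ⟨h1, h2, h3⟩ := split b hb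
    exact ⟨b, h1, h2, h3, le_of_mul_le_mul_left hle h3⟩

/-- The exchange of a large job on `i'` for a small job of the same class on `i`. -/
theorem Params.Below.exists_improving (hy : Fractional G x y) {i i' : ℕ} (h : G.Below x y i i') :
    ∃ v, Improving G x y i i' v := by
  obtain ⟨hi, hi', k, hk, hs, hs', hlt⟩ := h
  obtain ⟨a, ha, hak, hya, hpa⟩ := (hy.exists_le_average hi hs).1
  obtain ⟨b, hb, hbk, hyb, hpb⟩ := (hy.exists_le_average hi' hs').2
  have hab : (0 : ℝ) < G.p b - G.p a := by linarith
  have hii : i ≠ i' := by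
    rintro rfl
    exact lt_irrefl _ hlt
  have hba : a ≠ b := by
    rintro rfl
    exact lt_irrefl _ (sub_pos.1 hab)
  let α : ℕ → ℝ := fun r => (if r = i then 1 else 0) - (if r = i' then 1 else 0)
  let β : ℕ → ℝ := fun j => ((if j = b then 1 else 0) - (if j = a then 1 else 0)) / (G.p b - G.p a)
  have hβ : ∀ f : ℕ → ℝ, ∑ j ∈ range G.d, β j * f j = (f b - f a) / (G.p b - G.p a) := by
    intro f
    simp only [β, div_mul_eq_mul_div, ← sum_div, sub_mul, ite_mul, one_mul, zero_mul,
      sum_sub_distrib, sum_ite_eq', mem_range, if_pos ha, if_pos hb]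
  have hα : ∀ f : ℕ → ℝ, ∑ r ∈ range G.m, α r * f r = f i - f i' := by
    intro f
    simp only [α, sub_mul, ite_mul, one_mul, zero_mul, sum_sub_distrib, sum_ite_eq', mem_range,
      if_pos hi, if_pos hi']
  have hw : ∀ r k', G.classLoad (fun r j => α r * β j) r k' = α r * (if k' = k then 1 else 0) := by
    intro r k'
    have e : G.classLoad (fun r j => α r * β j) r k' =
        α r * ∑ j ∈ range G.d, β j * (if G.cls j = k' then (G.p j : ℝ) else 0) := by
      rw [Params.classLoad, mul_sum]
      refine sum_congr rfl fun j _ => ?_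
      split_ifs <;> ring
    rw [e, hβ, hak, hbk]
    by_cases h : k = k'
    · rw [if_pos h, if_pos h, if_pos h.symm, div_self hab.ne']
    · rw [if_neg h, if_neg h, if_neg (Ne.symm h), sub_zero, zero_div]
  refine ⟨fun r j => α r * β j, fun r j h => ?_, fun j _ => ?_, fun r _ k' => ?_, fun r _ => ?_,
    fun r j h => ?_, ?_⟩
  · by_cases hr : r < G.m
    · have hj : ¬ j < G.d := fun hj => h ⟨hr, hj⟩
      have h1 : j ≠ b := by rintro rfl; exact hj hb
      have h2 : j ≠ a := by rintro rfl; exact hj ha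
      simp [β, h1, h2]
    · have h1 : r ≠ i := by rintro rfl; exact hr hi
      have h2 : r ≠ i' := by rintro rfl; exact hr hi'
      simp [α, h1, h2]
  · have := hα fun _ => β j
    rwa [sub_self] at this
  · have e : ∑ j ∈ range G.d, (if G.cls j = k' then α r * β j else 0) =
        α r * ∑ j ∈ range G.d, β j * (if G.cls j = k' then (1 : ℝ) else 0) := by
      rw [mul_sum]
      refine sum_congr rfl fun j _ => ?_
      split_ifs <;> ring
    rw [e, hβ, hak, hbk, sub_self, zero_div, mul_zero]
  · have e : ∑ j ∈ range G.d, α r * β j * (G.p j : ℝ) = α r * ∑ j ∈ range G.d, β j * G.p j := by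
      rw [mul_sum]
      exact sum_congr rfl fun j _ => mul_assoc _ _ _
    rw [e, hβ, div_self hab.ne', mul_one]
  · -- The direction decreases only the jobs `a` on `i` and `b` on `i'`.
    by_cases h1 : r = i
    · by_cases h2 : j = a
      · rwa [h1, h2]
      · exfalso
        refine not_lt.2 ?_ h
        simp only [α, β, h1, if_neg hii, if_neg h2, if_true, sub_zero, one_mul]
        split_ifs
        · positivity
        · simp
    · by_cases h3 : r = i'
      · by_cases h2 : j = b
        · rwa [h3, h2]
        · exfalso
          refine not_lt.2 ?_ h
          simp only [α, β, h3, if_neg hii.symm, if_neg h2, if_true, zero_sub, neg_mul, one_mul,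
            neg_div, neg_neg]
          split_ifs
          · positivity
          · simp
      · exfalso
        simp [α, h1, h3] at h
  · have e : ∀ r, ∑ k' ∈ range G.K, G.average x y r k' * G.classLoad (fun r j => α r * β j) r k' =
        α r * G.average x y r k := by
      intro r
      simp only [hw, mul_ite, mul_one, mul_zero, sum_ite_eq', mem_range, if_pos hk]
      ring
    simp only [e, hα]
    linarith

/-- At a minimizer of the spread, no machine is below itself, even indirectly: the directions along a
cycle would add up to one that keeps all the loads and decreases the spread. -/
theorem not_transGen_below (hy : Fractional G x y)
    (hmin : ∀ y', Fractional G x y' → G.spread x y ≤ G.spread x y') (i : ℕ) :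
    ¬ Relation.TransGen (G.Below x y) i i := by
  intro h
  obtain ⟨v, hv⟩ : ∃ v, Improving G x y i i v := by
    have key : ∀ i', Relation.TransGen (G.Below x y) i i' → ∃ v, Improving G x y i i' v := by
      intro i' h
      induction h with
      | single h => exact h.exists_improving hy
      | tail _ h ih =>
        obtain ⟨u, hu⟩ := ih
        obtain ⟨v, hv⟩ := h.exists_improving hy
        exact ⟨_, hu.trans hv⟩
    exact key i h
  set A := ∑ r ∈ range G.m, ∑ k ∈ range G.K, G.average x y r k * G.classLoad v r k with hA
  set E := ∑ r ∈ range G.m, ∑ k ∈ range G.K, G.classLoad v r k ^ 2 / G.classNum x r k with hE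
  have hspread : ∀ t : ℝ, G.spread x (y + t • v) = G.spread x y + t * (2 * A + t * E) := by
    intro t
    have e : t * (2 * A + t * E) = 2 * t * A + t ^ 2 * E := by ring
    rw [e, Params.spread, Params.spread, hA, hE, mul_sum, mul_sum, ← sum_add_distrib,
      ← sum_add_distrib]
    refine sum_congr rfl fun r _ => ?_
    rw [mul_sum, mul_sum, ← sum_add_distrib, ← sum_add_distrib]
    refine sum_congr rfl fun k _ => ?_
    rw [Params.classLoad_add, Params.classLoad_smul, Params.average]
    ring
  have hlim : ∀ a b : ℝ, Filter.Tendsto (fun t : ℝ => a + t * b) (nhdsWithin 0 (Set.Ioi 0))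
      (nhds a) := by
    intro a b
    have : Continuous fun t : ℝ => a + t * b := by fun_prop
    simpa using (this.tendsto 0).mono_left nhdsWithin_le_nhds
  have h1 : ∀ᶠ t : ℝ in nhdsWithin 0 (Set.Ioi 0), 2 * A + t * E < 0 :=
    (hlim _ _).eventually_lt_const (by linarith [hv.deriv])
  have h2 : ∀ᶠ t : ℝ in nhdsWithin 0 (Set.Ioi 0), ∀ r ∈ range G.m, ∀ j ∈ range G.d,
      0 ≤ y r j + t * v r j := by
    rw [Filter.eventually_all_finset]
    intro r _
    rw [Filter.eventually_all_finset]
    intro j _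
    by_cases hneg : v r j < 0
    · exact ((hlim _ _).eventually_const_lt (hv.pos r j hneg)).mono fun _ h => h.le
    · filter_upwards [self_mem_nhdsWithin] with t ht
      exact add_nonneg (hy.nonneg r j) (mul_nonneg (le_of_lt ht) (not_lt.1 hneg))
  have h3 : ∀ᶠ t : ℝ in nhdsWithin 0 (Set.Ioi 0), 0 < t := self_mem_nhdsWithin
  obtain ⟨t, ht, ht0, hpos⟩ := (h1.and (h3.and h2)).exists
  have hy' : Fractional G x (y + t • v) := by
    refine ⟨fun r j => ?_, fun r j h => ?_, fun j hj => ?_, fun r hr k => ?_, fun r hr => ?_⟩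
    · by_cases h : r < G.m ∧ j < G.d
      · exact hpos r (mem_range.2 h.1) j (mem_range.2 h.2)
      · simp [hy.supp r j h, hv.supp r j h]
    · simp [hy.supp r j h, hv.supp r j h]
    · simp only [Pi.add_apply, Pi.smul_apply, smul_eq_mul, sum_add_distrib, ← mul_sum, hv.cols j hj,
        hy.cols j hj, mul_zero, add_zero]
    · have h := congrArg₂ (fun a b : ℝ => a + t * b) (hy.rows r hr k) (hv.rows r hr k)
      simp only [mul_zero, add_zero, mul_sum, ← sum_add_distrib] at h
      refine (sum_congr rfl fun j _ => ?_).trans h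
      split_ifs <;> simp
    · have e := hv.load r hr
      rw [sub_self] at e
      simp only [Pi.add_apply, Pi.smul_apply, smul_eq_mul, add_mul, sum_add_distrib, mul_assoc,
        ← mul_sum, e, hy.load r hr, mul_zero, add_zero]
  have := hmin _ hy'
  rw [hspread] at this
  have : t * (2 * A + t * E) < 0 := mul_neg_of_pos_of_neg ht0 ht
  linarith

end

end Scheduling

namespace Scheduling

open WordRAM Finset

theorem exists_sorting (m : ℕ) (f : ℕ → ℕ) : ∃ e : ℕ → ℕ, (∀ i, e i < m ↔ i < m) ∧
    Set.InjOn e (range m) ∧ ∀ i i', i ≤ i' → i' < m → f (e i) ≤ f (e i') := by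
  let σ := Tuple.sort fun i : Fin m => f i
  have hσ : ∀ i (h : i < m), (if h : i < m then (σ ⟨i, h⟩ : ℕ) else i) = σ ⟨i, h⟩ :=
    fun i h => dif_pos h
  refine ⟨fun i => if h : i < m then (σ ⟨i, h⟩ : ℕ) else i, fun i => ?_, fun i hi i' hi' h => ?_,
    fun i i' hii hi' => ?_⟩
  · dsimp only
    split_ifs with h
    · exact iff_of_true (σ ⟨i, h⟩).2 h
    · exact Iff.rfl
  · rw [mem_coe, mem_range] at hi hi'
    simp only [hσ i hi, hσ i' hi'] at h
    simpa using σ.injective (Fin.ext h)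
  · have hi := hii.trans_lt hi'
    simp only [hσ i hi, hσ i' hi']
    exact Tuple.monotone_sort (fun i : Fin m => f i) (a := ⟨i, hi⟩) (b := ⟨i', hi'⟩) hii

/-- The machines can be ordered such that the averages increase in every class simultaneously. -/
theorem exists_ordered {G : Params} {x : ℕ → ℕ → ℕ} : ∃ x' y, Fractional G x' y ∧
    (∀ j, ∑ i ∈ range G.m, x' i j = ∑ i ∈ range G.m, x i j) ∧
    (∀ i < G.m, ∃ i' < G.m, x' i = x i') ∧
    ∀ i i', i ≤ i' → i' < G.m → ∀ k < G.K, 0 < G.classNum x' i k → 0 < G.classNum x' i' k →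
      G.average x' y i k ≤ G.average x' y i' k := by
  classical
  obtain ⟨y, hy, hmin⟩ := exists_min_spread G x
  let f : ℕ → ℕ := fun i =>
    ((range G.m).filter fun r => Relation.TransGen (G.Below x y) r i).card
  have hf : ∀ i i', G.Below x y i i' → f i < f i' := by
    intro i i' h
    refine card_lt_card ⟨fun r hr => ?_, fun hsub => ?_⟩
    · rw [mem_filter] at hr ⊢
      exact ⟨hr.1, hr.2.tail h⟩
    · have : i ∈ (range G.m).filter fun r => Relation.TransGen (G.Below x y) r i :=
        hsub (mem_filter.2 ⟨mem_range.2 h.1, .single h⟩)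
      exact not_transGen_below hy hmin i (mem_filter.1 this).2
  obtain ⟨e, hlt, hinj, hmono⟩ := exists_sorting G.m f
  have hmaps : Set.MapsTo e (range G.m) (range G.m) := fun i hi => by simpa [hlt] using hi
  have hsum : ∀ {M : Type} [AddCommMonoid M] (g : ℕ → M),
      ∑ i ∈ range G.m, g (e i) = ∑ i ∈ range G.m, g i := fun g =>
    sum_nbij e hmaps hinj (surjOn_of_injOn_of_card_le e hmaps hinj le_rfl) fun _ _ => rfl
  refine ⟨fun i => x (e i), fun i => y (e i), ⟨fun i => hy.nonneg _, fun i j h => hy.supp _ j ?_,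
    fun j hj => ?_, fun i hi => hy.rows _ ((hlt i).2 hi), fun i hi => hy.load _ ((hlt i).2 hi)⟩,
    fun j => hsum fun i => x i j, fun i hi => ⟨e i, (hlt i).2 hi, rfl⟩,
    fun i i' hii hi' k hk h h' => ?_⟩
  · rwa [hlt]
  · rw [hsum fun i => y i j, hsum fun i => x i j, hy.cols j hj]
  · by_contra! hc
    have := hf _ _ (show G.Below x y (e i') (e i) from
      ⟨(hlt i').2 hi', (hlt i).2 (hii.trans_lt hi'), k, hk, h', h, hc⟩)
    have := hmono i i' hii hi'
    omega

/-! ### Codes with given digits -/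

theorem sum_mul_pow_lt {C n : ℕ} {g : ℕ → ℕ} (hg : ∀ k < n, g k < C) :
    ∑ k ∈ range n, g k * C ^ k < C ^ n := by
  induction n with
  | zero => simp
  | succ n ih =>
    rw [sum_range_succ]
    have h1 := ih fun k hk => hg k (by omega)
    have h2 : (g n + 1) * C ^ n ≤ C * C ^ n := Nat.mul_le_mul_right _ (hg n (by omega))
    rw [pow_succ']
    rw [add_mul] at h2
    omega

theorem sum_mul_pow_div_mod {C n k : ℕ} {g : ℕ → ℕ} (hk : k < n) (hg : ∀ k < n, g k < C) :
    (∑ k ∈ range n, g k * C ^ k) / C ^ k % C = g k := by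
  induction n generalizing g k with
  | zero => omega
  | succ n ih =>
    have hC : 0 < C := (Nat.zero_le _).trans_lt (hg k hk)
    have e : ∑ k ∈ range (n + 1), g k * C ^ k =
        C * (∑ k ∈ range n, g (k + 1) * C ^ k) + g 0 := by
      rw [sum_range_succ', mul_sum, pow_zero, mul_one]
      congr 1
      exact sum_congr rfl fun k _ => by ring
    rw [e]
    cases k with
    | zero => rw [pow_zero, Nat.div_one, Nat.mul_add_mod, Nat.mod_eq_of_lt (hg 0 (by omega))]
    | succ k =>
      rw [pow_succ', ← Nat.div_div_eq_div_mul, Nat.mul_add_div hC, Nat.div_eq_of_lt (hg 0 (by omega)),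
        add_zero]
      exact ih (by omega) fun k hk => hg (k + 1) (by omega)

namespace Params

variable (G : Params)

/-- The part of a code that encodes the classes. -/
def codeTail (c σ q : ℕ → ℕ) : ℕ :=
  ∑ k ∈ range G.K, (c k + G.B * (σ k + G.B * q k)) * (G.B * G.B * G.B) ^ k

/-- The code with the given digits. -/
def code (ℓ u : ℕ) (c σ q : ℕ → ℕ) : ℕ := ℓ + G.B * u + G.B * G.B * G.codeTail c σ q

variable {G} {ℓ u : ℕ} {c σ q : ℕ → ℕ}

theorem add_mul_lt {B C a b : ℕ} (ha : a < B) (hb : b < C) : a + B * b < B * C := by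
  calc a + B * b < B + B * b := by omega
    _ = B * (b + 1) := by ring
    _ ≤ B * C := Nat.mul_le_mul_left _ hb

theorem add_mul_mod {B a b : ℕ} (ha : a < B) : (a + B * b) % B = a := by
  rw [Nat.add_mul_mod_self_left, Nat.mod_eq_of_lt ha]

theorem add_mul_div {B a b : ℕ} (ha : a < B) : (a + B * b) / B = b := by
  rw [Nat.add_mul_div_left _ _ (by omega), Nat.div_eq_of_lt ha, zero_add]

section

variable (hℓ : ℓ < G.B) (hu : u < G.B)
include hℓ hu

theorem code_mod : G.code ℓ u c σ q % (G.B * G.B) = ℓ + G.B * u :=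
  add_mul_mod (add_mul_lt hℓ hu)

theorem code_div : G.code ℓ u c σ q / (G.B * G.B) = G.codeTail c σ q :=
  add_mul_div (add_mul_lt hℓ hu)

theorem lo_code : G.lo (G.code ℓ u c σ q) = ℓ := by
  rw [lo, ← Nat.mod_mul_right_mod _ G.B G.B, code_mod hℓ hu, add_mul_mod hℓ]

theorem up_code : G.up (G.code ℓ u c σ q) = u := by
  rw [up, ← Nat.mod_mul_right_div_self, code_mod hℓ hu, add_mul_div hℓ]

variable (h : ∀ k < G.K, c k < G.B ∧ σ k < G.B ∧ q k < G.B)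
include h

omit hℓ hu in
theorem digits_lt {k : ℕ} (hk : k < G.K) :
    c k + G.B * (σ k + G.B * q k) < G.B * G.B * G.B := by
  obtain ⟨h1, h2, h3⟩ := h k hk
  rw [mul_assoc]
  exact add_mul_lt h1 (add_mul_lt h2 h3)

theorem code_lt : G.code ℓ u c σ q < G.S := by
  refine (add_mul_lt (add_mul_lt hℓ hu) (sum_mul_pow_lt fun k hk => digits_lt h hk)).trans_eq ?_
  rw [S]
  ring

theorem num_code {k : ℕ} (hk : k < G.K) : G.num (G.code ℓ u c σ q) k = c k := by
  have e := sum_mul_pow_div_mod hk fun k hk => digits_lt h hk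
  rw [num, code_div hℓ hu, codeTail, ← Nat.mod_mod_of_dvd _ (Dvd.intro_left (G.B * G.B) rfl), e,
    add_mul_mod (h k hk).1]

theorem sum_code {k : ℕ} (hk : k < G.K) : G.sum (G.code ℓ u c σ q) k = σ k := by
  have e := sum_mul_pow_div_mod hk fun k hk => digits_lt h hk
  rw [mul_assoc] at e
  rw [sum, code_div hℓ hu, codeTail, mul_assoc, ← Nat.mod_mul_right_mod _ G.B G.B,
    ← Nat.mod_mul_right_div_self, e, add_mul_div (h k hk).1, add_mul_mod (h k hk).2.1]

theorem slope_code {k : ℕ} (hk : k < G.K) : G.slope (G.code ℓ u c σ q) k = q k := by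
  have e := sum_mul_pow_div_mod hk fun k hk => digits_lt h hk
  rw [mul_assoc] at e
  rw [slope, code_div hℓ hu, codeTail, mul_assoc, ← Nat.mod_mul_right_div_self,
    ← Nat.mod_mul_right_div_self, e, add_mul_div (h k hk).1, add_mul_div (h k hk).2.1]

end

end Params

end Scheduling

/-! ### The path of a schedule -/

namespace Scheduling

open WordRAM Finset

section

variable (G : Params) (x : ℕ → ℕ → ℕ) (y : ℕ → ℕ → ℝ)

/-- The largest average of the class `k` on the first `t` machines, scaled by `Q` and rounded up. -/
noncomputable def Params.slopeAt (t k : ℕ) : ℕ :=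
  ((range t).filter fun i => 0 < G.classNum x i k).sup fun i => ⌈G.Q * G.average x y i k⌉₊

/-- The number of jobs of class `k` on the first `t` machines. -/
def Params.numAt (t k : ℕ) : ℕ := ∑ i ∈ range t, G.classNum x i k

/-- The load by jobs of class `k` on the first `t` machines, scaled by `Q` and rounded up. -/
noncomputable def Params.sumAt (t k : ℕ) : ℕ :=
  ∑ i ∈ range t, G.classNum x i k * G.slopeAt x y (i + 1) k

end

section

variable {G : Params} {x : ℕ → ℕ → ℕ} {y : ℕ → ℕ → ℝ}

theorem Fractional.classLoad_eq_zero (hy : Fractional G x y) {i k : ℕ} (hi : i < G.m)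
    (h : G.classNum x i k = 0) : G.classLoad y i k = 0 := by
  have h0 := hy.rows i hi k
  rw [h, Nat.cast_zero, sum_eq_zero_iff_of_nonneg fun j _ => by
    split_ifs
    exacts [hy.nonneg i j, le_rfl]] at h0
  refine sum_eq_zero fun j hj => ?_
  have := h0 j hj
  split_ifs with hjk
  · rw [if_pos hjk] at this
    rw [this, zero_mul]
  · rfl

theorem Fractional.classNum_mul_average (hy : Fractional G x y) {i k : ℕ} (hi : i < G.m) :
    G.classNum x i k * G.average x y i k = G.classLoad y i k := by
  by_cases h : G.classNum x i k = 0
  · rw [hy.classLoad_eq_zero hi h, h, Nat.cast_zero, zero_mul]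
  · rw [Params.average, mul_div_cancel₀ _ (Nat.cast_ne_zero.2 h)]

theorem Fractional.sum_classLoad (hG : G.Good) (hy : Fractional G x y) {i : ℕ} (hi : i < G.m) :
    ∑ k ∈ range G.K, G.classLoad y i k = G.load x i := by
  rw [← hy.load i hi]
  simp only [Params.classLoad]
  rw [sum_comm]
  refine sum_congr rfl fun j hj => ?_
  rw [sum_ite_eq, if_pos (mem_range.2 (hG.cls_lt (mem_range.1 hj)))]

theorem Params.Good.sum_classNum (hG : G.Good) (i : ℕ) :
    ∑ k ∈ range G.K, G.classNum x i k = ∑ j ∈ range G.d, x i j := by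
  simp only [Params.classNum]
  rw [sum_comm]
  refine sum_congr rfl fun j hj => ?_
  rw [← mul_sum, sum_ite_eq, if_pos (mem_range.2 (hG.cls_lt (mem_range.1 hj))), mul_one]

/-- The jobs on the first machines are not smaller than the smallest jobs of the class. -/
theorem Fractional.mul_numAt_le (hy : Fractional G x y)
    (hx : ∀ j < G.d, ∑ i ∈ range G.m, x i j = G.cnt j) {t : ℕ} (ht : t ≤ G.m) (k θ : ℕ) :
    (θ : ℝ) * G.numAt x t k ≤ ∑ i ∈ range t, G.classLoad y i k + G.deficit k θ := by
  have h1 : (θ : ℝ) * G.numAt x t k =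
      ∑ i ∈ range t, ∑ j ∈ range G.d, if G.cls j = k then y i j * θ else 0 := by
    rw [Params.numAt, Nat.cast_sum, mul_sum]
    refine sum_congr rfl fun i hi => ?_
    rw [← hy.rows i ((mem_range.1 hi).trans_le ht), mul_sum]
    refine sum_congr rfl fun j _ => ?_
    split_ifs
    · exact mul_comm _ _
    · exact mul_zero _
  have h2 : (G.deficit k θ : ℝ) = ∑ i ∈ range G.m, ∑ j ∈ range G.d,
      if G.cls j = k then y i j * (θ - G.p j : ℕ) else 0 := by
    rw [Params.deficit, Nat.cast_sum, sum_comm]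
    refine sum_congr rfl fun j hj => ?_
    split_ifs
    · rw [← sum_mul, hy.cols j (mem_range.1 hj), hx j (mem_range.1 hj), Nat.cast_mul]
    · simp
  have h3 : ∑ i ∈ range t, ∑ j ∈ range G.d,
      (if G.cls j = k then y i j * (θ - G.p j : ℕ) else 0) ≤ G.deficit k θ := by
    rw [h2]
    refine sum_le_sum_of_subset_of_nonneg (range_mono ht) fun i _ _ => sum_nonneg fun j _ => ?_
    split_ifs
    · exact mul_nonneg (hy.nonneg i j) (Nat.cast_nonneg _)
    · exact le_rfl
  rw [h1]
  refine le_trans ?_ (add_le_add_right h3 _)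
  rw [← sum_add_distrib]
  refine sum_le_sum fun i _ => ?_
  rw [Params.classLoad, ← sum_add_distrib]
  refine sum_le_sum fun j _ => ?_
  split_ifs
  · rw [← mul_add]
    refine mul_le_mul_of_nonneg_left ?_ (hy.nonneg i j)
    exact_mod_cast (show θ ≤ G.p j + (θ - G.p j) by omega)
  · rw [add_zero]

theorem Fractional.average_nonneg (hy : Fractional G x y) (i k : ℕ) : 0 ≤ G.average x y i k := by
  refine div_nonneg (sum_nonneg fun j _ => ?_) (Nat.cast_nonneg _)
  split_ifs
  · exact mul_nonneg (hy.nonneg i j) (Nat.cast_nonneg _)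
  · exact le_rfl

theorem Fractional.slopeAt_le (hy : Fractional G x y) (hG : G.Good) {t k : ℕ} (ht : t ≤ G.m) : G.slopeAt x y t k ≤ G.Q * G.pm := by
  refine Finset.sup_le fun i hi => ?_
  obtain ⟨h1, h2⟩ := mem_filter.1 hi
  have hi' := (mem_range.1 h1).trans_le ht
  refine Nat.ceil_le.2 ?_
  rw [Nat.cast_mul]
  refine mul_le_mul_of_nonneg_left ?_ (Nat.cast_nonneg _)
  obtain ⟨b, hb, -, -, hle⟩ := (hy.exists_le_average hi' h2).2
  exact hle.trans (Nat.cast_le.2 (hG.p_le b hb))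

theorem Params.slopeAt_mono (k : ℕ) {t t' : ℕ} (h : t ≤ t') :
    G.slopeAt x y t k ≤ G.slopeAt x y t' k :=
  sup_mono (filter_subset_filter _ (range_mono h))

section

variable (hord : ∀ i i', i ≤ i' → i' < G.m → ∀ k < G.K,
  0 < G.classNum x i k → 0 < G.classNum x i' k → G.average x y i k ≤ G.average x y i' k)
include hord

theorem slopeAt_succ {i k : ℕ} (hi : i < G.m) (hk : k < G.K) (h : 0 < G.classNum x i k) :
    G.slopeAt x y (i + 1) k = ⌈G.Q * G.average x y i k⌉₊ := by
  refine le_antisymm (Finset.sup_le fun i' hi' => ?_)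
    (le_sup (f := fun i => ⌈G.Q * G.average x y i k⌉₊) (mem_filter.2 ⟨self_mem_range_succ i, h⟩))
  obtain ⟨h1, h2⟩ := mem_filter.1 hi'
  exact Nat.ceil_mono (mul_le_mul_of_nonneg_left
    (hord i' i (Nat.lt_succ_iff.1 (mem_range.1 h1)) hi k hk h2 h) (Nat.cast_nonneg _))

variable (hy : Fractional G x y)
include hy

theorem le_classNum_mul_slopeAt {i k : ℕ} (hi : i < G.m) (hk : k < G.K) :
    G.Q * G.classLoad y i k ≤ (G.classNum x i k * G.slopeAt x y (i + 1) k : ℕ) := by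
  rw [← hy.classNum_mul_average hi]
  rcases Nat.eq_zero_or_pos (G.classNum x i k) with h | h
  · simp [h]
  · rw [slopeAt_succ hord hi hk h, Nat.cast_mul, mul_left_comm]
    exact mul_le_mul_of_nonneg_left (Nat.le_ceil _) (Nat.cast_nonneg _)

theorem classNum_mul_slopeAt_le {i k : ℕ} (hi : i < G.m) (hk : k < G.K) :
    ((G.classNum x i k * G.slopeAt x y (i + 1) k : ℕ) : ℝ) ≤
      G.Q * G.classLoad y i k + G.classNum x i k := by
  rw [← hy.classNum_mul_average hi]
  rcases Nat.eq_zero_or_pos (G.classNum x i k) with h | h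
  · simp [h]
  · rw [slopeAt_succ hord hi hk h, Nat.cast_mul, mul_left_comm]
    have h1 := (Nat.ceil_lt_add_one (mul_nonneg (Nat.cast_nonneg G.Q)
      (hy.average_nonneg i k))).le
    have h2 := mul_le_mul_of_nonneg_left h1 (Nat.cast_nonneg (α := ℝ) (G.classNum x i k))
    linarith

/-- The load of a machine in terms of the rounded slopes. -/
theorem sum_classNum_mul_slopeAt (hG : G.Good) {i : ℕ} (hi : i < G.m) :
    G.Q * G.load x i ≤ ∑ k ∈ range G.K, G.classNum x i k * G.slopeAt x y (i + 1) k ∧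
      ∑ k ∈ range G.K, G.classNum x i k * G.slopeAt x y (i + 1) k ≤
        G.Q * G.load x i + ∑ j ∈ range G.d, x i j := by
  have e := hy.sum_classLoad hG hi
  constructor
  · rw [← Nat.cast_le (α := ℝ), Nat.cast_mul, ← e, mul_sum, Nat.cast_sum]
    exact sum_le_sum fun k hk => le_classNum_mul_slopeAt hord hy hi (mem_range.1 hk)
  · rw [← Nat.cast_le (α := ℝ), Nat.cast_add, Nat.cast_mul, ← e, mul_sum, Nat.cast_sum,
      ← hG.sum_classNum, Nat.cast_sum, ← sum_add_distrib]
    exact sum_le_sum fun k hk => classNum_mul_slopeAt_le hord hy hi (mem_range.1 hk)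

end

/-- A distribution of the jobs with loads between `ℓ` and `u` yields a path with these bounds. Rounding
up adds less than one unit per job, in total less than `Q`. -/
theorem exists_isPath (hG : G.Good) {x : ℕ → ℕ → ℕ}
    (hx : ∀ j < G.d, ∑ i ∈ range G.m, x i j = G.cnt j) {ℓ u : ℕ} (hℓ : ∀ i < G.m, ℓ ≤ G.load x i)
    (hu : ∀ i < G.m, G.load x i ≤ u) (hℓB : ℓ < G.B) (huB : u < G.B) :
    ∃ a, IsPath G a ∧ G.lo (a G.m) = ℓ ∧ G.up (a G.m) = u := by
  obtain ⟨x', y, hy, hcol, hrow, hord⟩ := exists_ordered (G := G) (x := x)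
  have hx' : ∀ j < G.d, ∑ i ∈ range G.m, x' i j = G.cnt j := fun j hj => by rw [hcol, hx j hj]
  have hℓ' : ∀ i < G.m, ℓ ≤ G.load x' i := fun i hi => by
    obtain ⟨r, hr, e⟩ := hrow i hi
    rw [Params.load, e]
    exact hℓ r hr
  have hu' : ∀ i < G.m, G.load x' i ≤ u := fun i hi => by
    obtain ⟨r, hr, e⟩ := hrow i hi
    rw [Params.load, e]
    exact hu r hr
  clear hcol hrow hx hℓ hu
  have hjobs : ∑ i ∈ range G.m, ∑ j ∈ range G.d, x' i j = ∑ j ∈ range G.d, G.cnt j := by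
    rw [sum_comm]
    exact sum_congr rfl fun j hj => hx' j (mem_range.1 hj)
  have hwork : ∑ i ∈ range G.m, G.load x' i = G.work := by
    simp only [Params.load]
    rw [sum_comm]
    refine sum_congr rfl fun j hj => ?_
    rw [← sum_mul, hx' j (mem_range.1 hj)]
  have hsize : ∀ k, G.numAt x' G.m k = G.size k := fun k => by
    simp only [Params.numAt, Params.classNum, Params.size]
    rw [sum_comm]
    refine sum_congr rfl fun j hj => ?_
    rw [← sum_mul, hx' j (mem_range.1 hj)]
    split_ifs <;> simp
  have hfinal : ∑ k ∈ range G.K, G.sumAt x' y G.m k < G.Q * (G.work + 1) := by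
    simp only [Params.sumAt]
    rw [sum_comm]
    refine (sum_le_sum fun i hi => (sum_classNum_mul_slopeAt hord hy hG (mem_range.1 hi)).2).trans_lt
      ?_
    rw [sum_add_distrib, ← mul_sum, hwork, hjobs, mul_add, mul_one]
    exact Nat.add_lt_add_left hG.cnt_lt _
  have hworkB : G.Q * (G.work + 1) < G.B := by
    have h1 : G.work ≤ (∑ j ∈ range G.d, G.cnt j) * G.pm := by
      rw [sum_mul]
      exact sum_le_sum fun j hj => Nat.mul_le_mul_left _ (hG.p_le j (mem_range.1 hj))
    have h2 : (∑ j ∈ range G.d, G.cnt j + 1) * G.pm ≤ G.Q * G.pm :=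
      Nat.mul_le_mul_right _ hG.cnt_lt
    have h3 := hG.pm_pos
    rw [add_mul] at h2
    rw [hG.B_eq, mul_assoc]
    exact Nat.lt_succ_of_le (Nat.mul_le_mul_left _ (by omega))
  have hdig : ∀ t ≤ G.m, ∀ k < G.K, G.numAt x' t k < G.B ∧ G.sumAt x' y t k < G.B ∧
      G.slopeAt x' y t k < G.B := by
    refine fun t ht k hk => ⟨?_, ?_, ?_⟩
    · have h1 : G.numAt x' t k ≤ G.numAt x' G.m k := sum_le_sum_of_subset (range_mono ht)
      have h2 : G.size k ≤ ∑ j ∈ range G.d, G.cnt j := sum_le_sum fun j _ => by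
        split_ifs <;> omega
      rw [hsize] at h1
      exact (h1.trans h2).trans_lt (hG.cnt_lt.trans hG.Q_lt)
    · have h1 : G.sumAt x' y t k ≤ G.sumAt x' y G.m k := sum_le_sum_of_subset (range_mono ht)
      have h2 : G.sumAt x' y G.m k ≤ ∑ k ∈ range G.K, G.sumAt x' y G.m k :=
        single_le_sum (fun _ _ => Nat.zero_le _) (mem_range.2 hk)
      omega
    · refine (hy.slopeAt_le hG ht).trans_lt ?_
      exact (Nat.mul_le_mul_left _ hG.pm_lt.le).trans_lt hG.Q_mul_Q_lt
  let a : ℕ → ℕ := fun t => G.code ℓ u (G.numAt x' t) (G.sumAt x' y t) (G.slopeAt x' y t)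
  have hnum : ∀ t ≤ G.m, ∀ k < G.K, G.num (a t) k = G.numAt x' t k := fun t ht k hk =>
    Params.num_code hℓB huB (hdig t ht) hk
  have hsum : ∀ t ≤ G.m, ∀ k < G.K, G.sum (a t) k = G.sumAt x' y t k := fun t ht k hk =>
    Params.sum_code hℓB huB (hdig t ht) hk
  have hslope : ∀ t ≤ G.m, ∀ k < G.K, G.slope (a t) k = G.slopeAt x' y t k := fun t ht k hk =>
    Params.slope_code hℓB huB (hdig t ht) hk
  have hdiff : ∀ i < G.m, ∑ k ∈ range G.K, (G.sum (a (i + 1)) k - G.sum (a i) k) =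
      ∑ k ∈ range G.K, G.classNum x' i k * G.slopeAt x' y (i + 1) k := fun i hi => by
    refine sum_congr rfl fun k hk => ?_
    rw [hsum (i + 1) hi k (mem_range.1 hk), hsum i hi.le k (mem_range.1 hk), Params.sumAt,
      Params.sumAt, sum_range_succ, Nat.add_sub_cancel_left]
  refine ⟨a, ⟨?_, fun t ht => Params.code_lt hℓB huB (hdig t ht), fun i hi => ⟨?_, fun k hk => ?_,
    ?_, ?_⟩, ?_⟩, Params.lo_code hℓB huB, Params.up_code hℓB huB⟩
  · have e : G.codeTail (G.numAt x' 0) (G.sumAt x' y 0) (G.slopeAt x' y 0) = 0 :=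
      sum_eq_zero fun k _ => by simp [Params.numAt, Params.sumAt, Params.slopeAt]
    simp only [a, Params.code, e, mul_zero, add_zero]
    exact Params.add_mul_lt hℓB huB
  · rw [Params.code_mod hℓB huB, Params.code_mod hℓB huB]
  · constructor
    · rw [hnum i hi.le k hk, hnum (i + 1) hi k hk]
      exact sum_le_sum_of_subset (range_mono (Nat.le_succ i))
    · rw [hslope i hi.le k hk, hslope (i + 1) hi k hk]
      exact Params.slopeAt_mono k (Nat.le_succ i)
    · rw [hsum i hi.le k hk, hsum (i + 1) hi k hk, hnum i hi.le k hk, hnum (i + 1) hi k hk,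
        hslope (i + 1) hi k hk, Params.sumAt, Params.sumAt, Params.numAt, Params.numAt,
        sum_range_succ, sum_range_succ, Nat.add_sub_cancel_left]
    · intro θ _
      rw [hnum (i + 1) hi k hk, hsum (i + 1) hi k hk, ← Nat.cast_le (α := ℝ)]
      have h1 := mul_le_mul_of_nonneg_left (hy.mul_numAt_le hx' (Nat.succ_le_of_lt hi) k θ)
        (Nat.cast_nonneg (α := ℝ) G.Q)
      have h2 : G.Q * ∑ i ∈ range (i + 1), G.classLoad y i k ≤ (G.sumAt x' y (i + 1) k : ℝ) := by
        rw [Params.sumAt, Nat.cast_sum, mul_sum]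
        exact sum_le_sum fun r hr => le_classNum_mul_slopeAt hord hy
          ((Nat.lt_succ_iff.1 (mem_range.1 hr)).trans_lt hi) hk
      push_cast
      rw [mul_assoc]
      simp only [Nat.succ_eq_add_one] at h1
      linarith
  · rw [hdiff i hi, Params.lo_code hℓB huB]
    exact (Nat.mul_le_mul_left _ (hℓ' i hi)).trans (sum_classNum_mul_slopeAt hord hy hG hi).1
  · rw [hdiff i hi, Params.up_code hℓB huB]
    refine (sum_classNum_mul_slopeAt hord hy hG hi).2.trans_lt ?_
    rw [mul_add, mul_one]
    refine Nat.add_lt_add_of_le_of_lt (Nat.mul_le_mul_left _ (hu' i hi)) (lt_of_le_of_lt ?_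
      hG.cnt_lt)
    rw [← hjobs]
    exact single_le_sum (f := fun i => ∑ j ∈ range G.d, x' i j) (fun _ _ => Nat.zero_le _)
      (mem_range.2 hi)
  · exact ⟨fun k hk => (hnum _ le_rfl k hk).trans (hsize k), by
      rw [sum_congr rfl fun k hk => hsum _ le_rfl k (mem_range.1 hk)]
      exact hfinal⟩

end

end Scheduling

/-! ### The size of the table -/

namespace Scheduling

open WordRAM Finset

section

variable {d m u v : ℕ} {p n : ℕ → ℕ}

/-- The number of classes is at most `2 / ε + 1`. -/
theorem Params.K_mul_le (hv : 0 < v) :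
    ((ofInput d m u v p n).K - 1) * u ≤ 2 * v := by
  obtain ⟨w, hw⟩ : ∃ w, u * (range d).sup p / (2 * v) = w := ⟨_, rfl⟩
  have h1 : u * (range d).sup p < (w + 1) * (2 * v) := by
    rw [← Nat.div_lt_iff_lt_mul (by omega), hw]
    exact Nat.lt_succ_self w
  have h2 : (range d).sup p / (w + 1) * (w + 1) ≤ (range d).sup p := Nat.div_mul_le_self _ _
  have e : (ofInput d m u v p n).K - 1 = (range d).sup p / (w + 1) := by
    simp only [ofInput, hw]
    exact Nat.add_sub_cancel _ _
  rw [e]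
  refine Nat.le_of_mul_le_mul_left (c := w + 1) ?_ (Nat.succ_pos w)
  calc _ = u * ((range d).sup p / (w + 1) * (w + 1)) := by ring
    _ ≤ u * (range d).sup p := Nat.mul_le_mul_left _ h2
    _ ≤ _ := h1.le

theorem Params.B_le_pow (hm : 0 < m) (hp : 0 < (range d).sup p) :
    (ofInput d m u v p n).B ≤ 10 * (m * (range d).sup p) ^ 7 := by
  simp only [ofInput]
  generalize (range d).sup p = q at hp
  obtain ⟨M, hM⟩ : ∃ M, m * q = M := ⟨_, rfl⟩
  have hqM : q ≤ M := hM ▸ Nat.le_mul_of_pos_left _ hm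
  have hM1 : 1 ≤ M := hp.trans_le hqM
  have h1 : q * q + 1 ≤ 2 * M ^ 2 := by nlinarith
  have h2 : q * m * (q * q + 1) + 1 ≤ 3 * M ^ 3 := by
    rw [mul_comm q m, hM]
    have := Nat.mul_le_mul_left M h1
    have : 1 ≤ M ^ 3 := Nat.one_le_pow _ _ hM1
    have : M ^ 3 = M * M ^ 2 := by ring
    nlinarith
  have h3 := Nat.mul_le_mul (Nat.mul_le_mul h2 h2) hqM
  have h4 : 3 * M ^ 3 * (3 * M ^ 3) * M = 9 * M ^ 7 := by ring
  have h5 : 1 ≤ M ^ 7 := Nat.one_le_pow _ _ hM1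
  rw [hM]
  omega

/-- The number of codes is at most `c (m pmax) ^ (c / ε)`. -/
theorem Params.S_le_rpow {ε : ℝ} (hm : 0 < m) (hp : 0 < (range d).sup p) (hu : 0 < u) (huv : u ≤ v)
    (hε : ε = u / v) : ((ofInput d m u v p n).S : ℝ) ≤
      10 ^ 8 * ((m : ℝ) * ((range d).sup p : ℕ)) ^ (121 / ε) := by
  have hv : 0 < v := hu.trans_le huv
  have hu' : (0 : ℝ) < u := Nat.cast_pos.2 hu
  have hv' : (0 : ℝ) < v := Nat.cast_pos.2 hv
  have hε0 : 0 < ε := hε ▸ div_pos hu' hv'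
  have hε1 : ε ≤ 1 := hε ▸ (div_le_one hv').2 (Nat.cast_le.2 huv)
  have hB := B_le_pow (n := n) (u := u) (v := v) hm hp
  have hKu := K_mul_le (d := d) (m := m) (u := u) (p := p) (n := n) hv
  set G := ofInput d m u v p n with hG
  have hK0 : G.K = (range d).sup p / (G.w + 1) + 1 := rfl
  have hB0 : 0 < G.B := Nat.succ_pos _
  obtain ⟨M, hM⟩ : ∃ M, m * (range d).sup p = M := ⟨_, rfl⟩
  have hM1 : 1 ≤ M := hM ▸ Nat.mul_pos hm hp
  have hMR : (m : ℝ) * ((range d).sup p : ℕ) = M := by rw [← hM, Nat.cast_mul]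
  rw [hMR]
  rw [hM] at hB
  have hMR1 : (1 : ℝ) ≤ M := by exact_mod_cast hM1
  rcases Nat.eq_or_lt_of_le hM1 with h1 | h2
  · -- A single machine and unit jobs: there are at most two classes.
    have hp1 : (range d).sup p = 1 := Nat.eq_one_of_mul_eq_one_left (hM.trans h1.symm)
    have hK : G.K ≤ 2 := by
      rw [hK0, hp1]
      have := Nat.div_le_self 1 (G.w + 1)
      omega
    rw [← h1, Nat.cast_one, Real.one_rpow, mul_one]
    rw [← h1, one_pow, mul_one] at hB
    have : G.S ≤ 10 ^ 8 := (Nat.pow_le_pow_left hB _).trans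
      (Nat.pow_le_pow_right (by omega) (by omega))
    exact_mod_cast this
  · have hBM : G.B ≤ M ^ 11 := by
      have h4 : 2 ^ 4 ≤ M ^ 4 := Nat.pow_le_pow_left h2 4
      refine hB.trans ?_
      rw [show M ^ 11 = M ^ 4 * M ^ 7 by ring]
      exact Nat.mul_le_mul_right _ (by omega)
    have hS : G.S ≤ M ^ (11 * (3 * G.K + 2)) := by
      rw [pow_mul]
      exact Nat.pow_le_pow_left hBM _
    have hexp : ((11 * (3 * G.K + 2) : ℕ) : ℝ) ≤ 121 / ε := by
      have h3 : ((G.K - 1 : ℕ) : ℝ) * ε ≤ 2 := by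
        rw [hε, ← mul_div_assoc, div_le_iff₀ hv']
        exact_mod_cast hKu
      have h4 : G.K = (G.K - 1) + 1 := (Nat.succ_pred_eq_of_pos (hK0 ▸ Nat.succ_pos _)).symm
      rw [h4, le_div_iff₀ hε0]
      push_cast
      nlinarith
    calc (G.S : ℝ) ≤ (M : ℝ) ^ (11 * (3 * G.K + 2)) := by exact_mod_cast hS
      _ = (M : ℝ) ^ ((11 * (3 * G.K + 2) : ℕ) : ℝ) := (Real.rpow_natCast _ _).symm
      _ ≤ (M : ℝ) ^ (121 / ε) := Real.rpow_le_rpow_of_exponent_le hMR1 hexp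
      _ ≤ _ := le_mul_of_one_le_left (Real.rpow_nonneg (by linarith) _) (by norm_num)

end

/-! ### Schedules and matrices -/

namespace Problem

variable {I : Problem}

/-- The processing times, as a function on the natural numbers. -/
def times (I : Problem) (j : ℕ) : ℕ := if h : j < I.d then I.p ⟨j, h⟩ else 0

/-- The multiplicities, as a function on the natural numbers. -/
def mults (I : Problem) (j : ℕ) : ℕ := if h : j < I.d then I.n ⟨j, h⟩ else 0

@[simp] theorem times_val (j : Fin I.d) : I.times j = I.p j := dif_pos j.2

@[simp] theorem mults_val (j : Fin I.d) : I.mults j = I.n j := dif_pos j.2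

theorem sup_times : (range I.d).sup I.times = I.pmax := by
  refine le_antisymm (Finset.sup_le fun j hj => ?_) (Finset.sup_le fun j _ => ?_)
  · rw [mem_range] at hj
    rw [show j = ((⟨j, hj⟩ : Fin I.d) : ℕ) from rfl, times_val]
    exact le_sup (f := I.p) (mem_univ _)
  · rw [← times_val]
    exact le_sup (f := I.times) (mem_range.2 j.2)

/-- The parameters of an instance. -/
def params (I : Problem) (u v : ℕ) : Params := Params.ofInput I.d I.m u v I.times I.mults

theorem good_params (I : Problem) (u v : ℕ) : (I.params u v).Good := by
  refine Params.good_ofInput I.d_pos I.m_pos (fun j hj => ?_) fun i hi j hj h => ?_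
  · rw [times, dif_pos hj]
    exact I.p_pos _
  · rw [times, times, dif_pos hi, dif_pos hj] at h
    simpa using I.p_injective h

/-- A schedule as a function on the natural numbers. -/
def Schedule.jobs (π : I.Schedule) (i j : ℕ) : ℕ :=
  if h : i < I.m ∧ j < I.d then π.x ⟨i, h.1⟩ ⟨j, h.2⟩ else 0

@[simp] theorem Schedule.jobs_val (π : I.Schedule) (i : Fin I.m) (j : Fin I.d) :
    π.jobs i j = π.x i j := dif_pos ⟨i.2, j.2⟩

theorem Schedule.sum_jobs (π : I.Schedule) {j : ℕ} (hj : j < I.d) :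
    ∑ i ∈ range I.m, π.jobs i j = I.mults j := by
  obtain ⟨j, rfl⟩ : ∃ j' : Fin I.d, (j' : ℕ) = j := ⟨⟨j, hj⟩, rfl⟩
  rw [sum_range, mults_val, ← π.sum_eq]
  exact sum_congr rfl fun i _ => π.jobs_val i j

theorem Schedule.sum_jobs_mul (π : I.Schedule) (i : Fin I.m) :
    ∑ j ∈ range I.d, π.jobs i j * I.times j = π.load i := by
  rw [sum_range]
  exact sum_congr rfl fun j _ => by rw [π.jobs_val, times_val]

/-- The schedule that is given by a matrix. -/
def Schedule.ofJobs (x : ℕ → ℕ → ℕ) (hx : ∀ j < I.d, ∑ i ∈ range I.m, x i j = I.mults j) :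
    I.Schedule where
  x i j := x i j
  sum_eq j := by rw [← mults_val, ← hx j j.2, sum_range]

theorem Schedule.load_ofJobs {x : ℕ → ℕ → ℕ}
    {hx : ∀ j < I.d, ∑ i ∈ range I.m, x i j = I.mults j} (i : Fin I.m) :
    (ofJobs x hx).load i = ∑ j ∈ range I.d, x i j * I.times j := by
  rw [sum_range]
  exact sum_congr rfl fun j _ => by rw [times_val]; rfl

theorem Schedule.nonempty (I : Problem) : Nonempty I.Schedule :=
  ⟨⟨fun i j => if i = ⟨0, I.m_pos⟩ then I.n j else 0, fun j => by simp⟩⟩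

theorem Schedule.cmin_le_load (π : I.Schedule) (i : Fin I.m) : π.cmin ≤ π.load i :=
  inf'_le _ (mem_univ i)

theorem Schedule.load_le_cmax (π : I.Schedule) (i : Fin I.m) : π.load i ≤ π.cmax :=
  le_sup' _ (mem_univ i)

theorem Schedule.cmin_le (π : I.Schedule) : π.cmin ≤ ∑ j, I.n j * I.p j := by
  refine (π.cmin_le_load ⟨0, I.m_pos⟩).trans (sum_le_sum fun j _ => Nat.mul_le_mul_right _ ?_)
  rw [← π.sum_eq]
  exact single_le_sum (f := fun i => π.x i j) (fun _ _ => Nat.zero_le _) (mem_univ _)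

/-- The value of a schedule for an objective. -/
def Schedule.value (π : I.Schedule) : Objective → ℕ
  | .cmax => π.cmax
  | .cmin => π.cmin
  | .cenvy => π.cenvy

theorem exists_optimal (I : Problem) (obj : Objective) :
    ∃ π : I.Schedule, I.opt obj = π.value obj := by
  have := Schedule.nonempty I
  cases obj with
  | cmax =>
    obtain ⟨π, h⟩ := Nat.sInf_mem (Set.range_nonempty fun π : I.Schedule => π.cmax)
    exact ⟨π, h.symm⟩
  | cmin =>
    obtain ⟨π, h⟩ := Nat.sSup_mem (Set.range_nonempty fun π : I.Schedule => π.cmin)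
      ⟨_, Set.forall_mem_range.2 fun π => π.cmin_le⟩
    exact ⟨π, h.symm⟩
  | cenvy =>
    obtain ⟨π, h⟩ := Nat.sInf_mem (Set.range_nonempty fun π : I.Schedule => π.cenvy)
    exact ⟨π, h.symm⟩

/-- The load of every machine by the jobs that are set aside. -/
def baseLoad (I : Problem) (u v : ℕ) : ℕ :=
  ∑ j ∈ range I.d, (I.params u v).base j * I.times j

theorem sum_add_base (u v : ℕ) (x : ℕ → ℕ → ℕ) (i : ℕ) :
    ∑ j ∈ range I.d, (x i j + (I.params u v).base j) * I.times j =
      (I.params u v).load x i + I.baseLoad u v := by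
  rw [baseLoad, Params.load]
  simp only [add_mul, sum_add_distrib]
  rfl

theorem cnt_add_mul_base (u v j : ℕ) :
    (I.params u v).cnt j + I.m * (I.params u v).base j = I.mults j :=
  Nat.sub_add_cancel ((Nat.mul_le_mul_left _ (Nat.sub_le _ _)).trans (Nat.mul_div_le _ _))

/-- Every schedule has a path that is as good for all three objectives. -/
theorem Schedule.exists_isPath (π : I.Schedule) (u v : ℕ) : ∃ a, IsPath (I.params u v) a ∧
    π.cmin ≤ (I.params u v).lo (a I.m) + I.baseLoad u v ∧
    (I.params u v).up (a I.m) + I.baseLoad u v ≤ π.cmax := by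
  have hG := I.good_params u v
  set β := I.baseLoad u v with hβ
  have hbase : ∀ j, (I.params u v).base j = I.mults j / I.m - I.pmax * I.pmax := fun j => by
    rw [← sup_times]
    rfl
  obtain ⟨y, hy, hlow, hupp, hnear⟩ := exists_nearly_uniform (p := I.times)
    (n := I.mults) (ℓ := π.cmin) (u := π.cmax)
    (sup_times ▸ hG.d_le : I.d ≤ I.pmax) hG.p_pos
    (fun j hj => (sup_times ▸ hG.p_le j hj : I.times j ≤ I.pmax)) (fun j hj => π.sum_jobs hj)
    (fun i hi => (π.sum_jobs_mul ⟨i, hi⟩).symm ▸ π.cmin_le_load _)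
    (fun i hi => (π.sum_jobs_mul ⟨i, hi⟩).symm ▸ π.load_le_cmax _)
  set G := I.params u v with hGdef
  let z : ℕ → ℕ → ℕ := fun i j => y i j - G.base j
  have hzy : ∀ i < I.m, ∀ j < I.d, z i j + G.base j = y i j := fun i hi j hj =>
    Nat.sub_add_cancel (hbase j ▸ hnear i hi j hj)
  have hz : ∀ j < I.d, ∑ i ∈ range I.m, z i j = G.cnt j := by
    intro j hj
    have h1 : ∑ i ∈ range I.m, (z i j + G.base j) = I.mults j := by
      rw [← hy j hj]
      exact sum_congr rfl fun i hi => hzy i (mem_range.1 hi) j hj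
    rw [sum_add_distrib, sum_const, card_range, smul_eq_mul] at h1
    have h2 : G.cnt j + I.m * G.base j = I.mults j := cnt_add_mul_base u v j
    omega
  have hload : ∀ i < I.m, G.load z i + β = ∑ j ∈ range I.d, y i j * I.times j := by
    intro i hi
    rw [hβ, ← sum_add_base]
    exact sum_congr rfl fun j hj => by rw [hzy i hi j (mem_range.1 hj)]
  have hzB : ∀ i < I.m, G.load z i ≤ G.Q * G.pm := by
    intro i hi
    refine le_trans ?_ hG.work_le'
    have : G.work = ∑ i ∈ range I.m, G.load z i := by
      simp only [Params.load]
      rw [sum_comm]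
      refine sum_congr rfl fun j hj => ?_
      rw [← sum_mul, hz j (mem_range.1 hj)]
    rw [this]
    exact single_le_sum (fun _ _ => Nat.zero_le _) (mem_range.2 hi)
  have hB : G.Q * G.pm < G.B := (Nat.mul_le_mul_left _ hG.pm_lt.le).trans_lt hG.Q_mul_Q_lt
  have h0 := hload 0 I.m_pos
  have h0' := hzB 0 I.m_pos
  have hlow0 := hlow 0 I.m_pos
  have hupp0 := hupp 0 I.m_pos
  have hℓ : ∀ i < I.m, π.cmin - β ≤ G.load z i := fun i hi => by
    have := hload i hi
    have := hlow i hi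
    omega
  have hu : ∀ i < I.m, G.load z i ≤ min (π.cmax - β) (G.Q * G.pm) := fun i hi => by
    have := hload i hi
    have := hupp i hi
    have := hzB i hi
    omega
  obtain ⟨a, ha, hlo, hup⟩ := Scheduling.exists_isPath hG hz hℓ hu (by omega) (by omega)
  refine ⟨a, ha, ?_, ?_⟩
  · change π.cmin ≤ G.lo (a G.m) + β
    omega
  · change G.up (a G.m) + β ≤ π.cmax
    omega

end Problem

end Scheduling

/-! ### The approximation scheme -/

namespace Scheduling

open WordRAM Finset

/-- Loads that the path `a` allows up to `w` are good enough, if the path is as good as one that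
belongs to an optimal schedule. -/
theorem Problem.Schedule.hasAdditiveError {I : Problem} {G : Params} (hG : G.Good)
    {a a₀ β : ℕ} {δ : ℝ} (hδ : 2 * (G.w : ℝ) ≤ δ) {obj : Objective}
    (hval : G.val a obj ≤ G.val a₀ obj) {π π₀ : I.Schedule}
    (hopt : I.opt obj = π₀.value obj)
    (hlo : π₀.cmin ≤ G.lo a₀ + β) (hup : G.up a₀ + β ≤ π₀.cmax)
    (hπ : ∀ i, G.lo a + β ≤ π.load i + G.w ∧ π.load i ≤ G.up a + β + G.w) :
    π.HasAdditiveError obj δ := by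
  have hmax : π.cmax ≤ G.up a + β + G.w := sup'_le _ _ fun i _ => (hπ i).2
  have hmin : G.lo a + β ≤ π.cmin + G.w := by
    have : G.lo a + β - G.w ≤ π.cmin := le_inf' _ _ fun i _ => by
      have := (hπ i).1
      omega
    omega
  have hw : (G.w : ℝ) ≤ δ := by linarith [Nat.cast_nonneg (α := ℝ) G.w]
  cases obj with
  | cmax =>
    have h : π.cmax ≤ I.opt .cmax + G.w := by
      simp only [Params.val] at hval
      rw [hopt, Problem.Schedule.value]
      omega
    have h' : (π.cmax : ℝ) ≤ I.opt .cmax + G.w := by exact_mod_cast h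
    exact h'.trans (by linarith)
  | cmin =>
    have h : I.opt .cmin ≤ π.cmin + G.w := by
      have h1 : G.lo a < G.B := Nat.mod_lt _ hG.B_pos
      have h2 : G.lo a₀ < G.B := Nat.mod_lt _ hG.B_pos
      simp only [Params.val] at hval
      rw [hopt, Problem.Schedule.value]
      omega
    have h' : (I.opt .cmin : ℝ) ≤ π.cmin + G.w := by exact_mod_cast h
    rw [Problem.Schedule.HasAdditiveError]
    linarith
  | cenvy =>
    have h : π.cenvy ≤ I.opt .cenvy + 2 * G.w := by
      simp only [Params.val] at hval
      rw [hopt, Problem.Schedule.value, Problem.Schedule.cenvy, Problem.Schedule.cenvy]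
      omega
    have h' : (π.cenvy : ℝ) ≤ I.opt .cenvy + 2 * G.w := by exact_mod_cast h
    exact h'.trans (by linarith)

theorem Problem.input_bounded (I : Problem) (ε : ℚ) {V : ℕ}
    (hV : I.total + ε.num.natAbs + ε.den ≤ V) : (I.input ε).Bounded V := by
  have hp : ∀ j, I.p j ≤ ∑ j, I.p j := fun j => single_le_sum (fun _ _ => Nat.zero_le _) (mem_univ j)
  have hn : ∀ j, I.n j ≤ ∑ j, I.n j := fun j => single_le_sum (fun _ _ => Nat.zero_le _) (mem_univ j)
  rw [Problem.total] at hV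
  constructor
  · intro r
    simp only [Problem.input]
    split <;> omega
  · intro a k
    simp only [Problem.input]
    split
    · split_ifs with h
      · have := hp ⟨_, h⟩
        omega
      · omega
    · split_ifs with h
      · have := hn ⟨_, h⟩
        omega
      · omega
    · omega

/-- The program computes a schedule of sufficient quality. -/
theorem wp_solve_input (obj : Objective) (I : Problem) {ε : ℚ} (hε : 0 < ε) (hε1 : ε ≤ 1) {V : ℕ} :
    WP V (I.params ε.num.natAbs ε.den).S (solve obj) (fun s => ∃ π : I.Schedule, π.IsOutput s ∧
      π.HasAdditiveError obj ((ε : ℝ) * (I.pmax : ℝ))) (I.input ε) := by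
  have hG := I.good_params ε.num.natAbs ε.den
  have hnum : 0 < ε.num := Rat.num_pos.2 hε
  have huv : ε.num.natAbs ≤ ε.den := by
    have := Rat.num_le_denom_iff.2 hε1
    omega
  have hεR : (ε : ℝ) = (ε.num.natAbs : ℝ) / ε.den := by
    rw [Rat.cast_def, Nat.cast_natAbs, abs_of_pos hnum]
  obtain ⟨π₀, hopt⟩ := I.exists_optimal obj
  obtain ⟨a₀, ha₀, hlo, hup⟩ := π₀.exists_isPath ε.num.natAbs ε.den
  refine (wp_solve obj hG le_rfl huv rfl rfl rfl rfl (fun _ _ => rfl) (fun _ _ => rfl)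
    (fun _ => rfl) ha₀).mono fun s _ ⟨G, a, x, hGe, ha, hval, hx, hload, hout⟩ => ?_
  obtain rfl : G = I.params ε.num.natAbs ε.den := hGe
  have hw : 2 * ((I.params ε.num.natAbs ε.den).w : ℝ) ≤ (ε : ℝ) * (I.pmax : ℝ) := by
    have h1 : ((I.params ε.num.natAbs ε.den).w : ℝ) ≤
        ((ε.num.natAbs * I.pmax : ℕ) : ℝ) / ((2 * ε.den : ℕ) : ℝ) := by
      rw [← Problem.sup_times]
      exact Nat.cast_div_le
    have h2 : (0 : ℝ) < ε.den := Nat.cast_pos.2 ε.den_pos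
    rw [hεR]
    refine (mul_le_mul_of_nonneg_left h1 two_pos.le).trans_eq ?_
    push_cast
    field_simp
  have hcols : ∀ j < I.d, ∑ i ∈ range I.m, (x i j + (I.params ε.num.natAbs ε.den).base j) =
      I.mults j := fun j hj => by
    rw [sum_add_distrib, sum_const, card_range, smul_eq_mul, ← I.cnt_add_mul_base, ← hx.cols j hj]
    rfl
  refine ⟨.ofJobs _ hcols, fun i j => hout i i.2 j j.2, Problem.Schedule.hasAdditiveError hG hw hval
    hopt hlo hup fun i => ?_⟩
  have := hload i i.2
  rw [Problem.Schedule.load_ofJobs, Problem.sum_add_base]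
  omega

/-- Bounds on the time and on the words in terms of the number of codes. -/
theorem le_mul_rpow {M S T e c C₁ D C : ℕ} {ε : ℝ} (hM : 1 ≤ M) (hε : 0 < ε) (hT : 1 ≤ T)
    (hS : (S : ℝ) ≤ c * (M : ℝ) ^ ((e : ℝ) / ε))
    (hC : C = C₁ * (c + 1) ^ C₁ + e * C₁ + (c + 3) ^ D + D + e * D) :
    ((C₁ * (S + 1) ^ C₁ : ℕ) : ℝ) ≤ C * (M : ℝ) ^ ((C : ℝ) / ε) ∧
      (((S + T + 2) ^ D : ℕ) : ℝ) ≤ C * (T : ℝ) ^ C * (M : ℝ) ^ ((C : ℝ) / ε) := by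
  have hMR : (1 : ℝ) ≤ M := by exact_mod_cast hM
  have hTR : (1 : ℝ) ≤ T := by exact_mod_cast hT
  set X : ℝ := (M : ℝ) ^ ((e : ℝ) / ε) with hX
  have hX1 : 1 ≤ X := Real.one_le_rpow hMR (by positivity)
  have hpow : ∀ k : ℕ, X ^ k = (M : ℝ) ^ (((e * k : ℕ) : ℝ) / ε) := fun k => by
    rw [hX, ← Real.rpow_natCast, ← Real.rpow_mul (by positivity)]
    congr 1
    push_cast
    ring
  have hexp : ∀ {k C : ℕ}, e * k ≤ C → X ^ k ≤ (M : ℝ) ^ ((C : ℝ) / ε) := fun {k C} h => by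
    rw [hpow]
    exact Real.rpow_le_rpow_of_exponent_le hMR
      (div_le_div_of_nonneg_right (Nat.cast_le.2 h) hε.le)
  constructor
  · calc ((C₁ * (S + 1) ^ C₁ : ℕ) : ℝ) = C₁ * (S + 1) ^ C₁ := by push_cast; rfl
      _ ≤ C₁ * ((c + 1) * X) ^ C₁ := by gcongr; nlinarith
      _ = ((C₁ * (c + 1) ^ C₁ : ℕ) : ℝ) * X ^ C₁ := by rw [mul_pow]; push_cast; ring
      _ ≤ _ := mul_le_mul (Nat.cast_le.2 (by omega)) (hexp (by omega)) (by positivity)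
        (by positivity)
  · calc (((S + T + 2) ^ D : ℕ) : ℝ) = (S + T + 2) ^ D := by push_cast; rfl
      _ ≤ ((c + 3) * T * X) ^ D := by
        gcongr
        have h1 : (c : ℝ) * X ≤ c * T * X := by
          rw [mul_right_comm]
          exact le_mul_of_one_le_right (by positivity) hTR
        have h2 : (T : ℝ) ≤ T * X := le_mul_of_one_le_right (by positivity) hX1
        nlinarith
      _ = ((c + 3) ^ D : ℕ) * (T : ℝ) ^ D * X ^ D := by
        rw [mul_pow, mul_pow]
        push_cast
        rfl
      _ ≤ _ := by
        refine mul_le_mul (mul_le_mul (Nat.cast_le.2 (by omega))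
          (pow_le_pow_right₀ hTR (by omega)) (by positivity) (by positivity)) (hexp (by omega))
          (by positivity) (by positivity)

end Scheduling

theorem theorem3 (obj : Scheduling.Objective) :
    ∃ (P : WordRAM.Program) (C : ℕ), ∀ (I : Scheduling.Problem) (ε : ℚ), 0 < ε → ε ≤ 1 →
      ∃ (W t : ℕ) (s : WordRAM.State) (π : I.Schedule),
        WordRAM.Exec W P (I.input ε) t s ∧
        π.IsOutput s ∧
        π.HasAdditiveError obj ((ε : ℝ) * (I.pmax : ℝ)) ∧
        (t : ℝ) ≤ C * ((I.m : ℝ) * (I.pmax : ℝ)) ^ ((C : ℝ) / (ε : ℝ)) ∧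
        (W : ℝ) ≤ C * ((I.total + ε.num.natAbs + ε.den : ℕ) : ℝ) ^ C *
          ((I.m : ℝ) * (I.pmax : ℝ)) ^ ((C : ℝ) / (ε : ℝ)) := by
  obtain ⟨C₁, hC₁⟩ := WordRAM.Program.exists_time_le (Scheduling.solve obj)
  obtain ⟨D, hD⟩ : ∃ D, (Scheduling.solve obj).deg = D := ⟨_, rfl⟩
  obtain ⟨C, hC⟩ : ∃ C, C = C₁ * (10 ^ 8 + 1) ^ C₁ + 121 * C₁ + (10 ^ 8 + 3) ^ D + D + 121 * D :=
    ⟨_, rfl⟩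
  refine ⟨Scheduling.solve obj, C, fun I ε hε hε1 => ?_⟩
  have hpm : 0 < I.pmax := Scheduling.Problem.sup_times ▸
    (I.good_params ε.num.natAbs ε.den).pm_pos
  have hnum : 0 < ε.num := Rat.num_pos.2 hε
  have huv : ε.num.natAbs ≤ ε.den := by
    have := Rat.num_le_denom_iff.2 hε1
    omega
  have hεR : (ε : ℝ) = (ε.num.natAbs : ℝ) / ε.den := by
    rw [Rat.cast_def, Nat.cast_natAbs, abs_of_pos hnum]
  have hS := Scheduling.Params.S_le_rpow (n := I.mults) I.m_pos
    (Scheduling.Problem.sup_times.symm ▸ hpm) (by omega) huv hεR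
  rw [Scheduling.Problem.sup_times] at hS
  set S := (Scheduling.Params.ofInput I.d I.m ε.num.natAbs ε.den I.times I.mults).S
  set T := I.total + ε.num.natAbs + ε.den with hT
  obtain ⟨t, s, h1, h2, -, π, h3, h4⟩ := Scheduling.wp_solve_input obj I hε hε1 (V := S + T)
    (Nat.le_add_right _ _) (I.input_bounded ε (Nat.le_add_left _ _)) _ le_rfl
  obtain ⟨h5, h6⟩ := Scheduling.le_mul_rpow (M := I.m * I.pmax) (S := S) (T := T)
    (ε := (ε : ℝ)) (Nat.mul_pos I.m_pos hpm) (by exact_mod_cast hε) (by have := ε.den_pos; omega)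
    (by exact_mod_cast hS) hC
  rw [Nat.cast_mul I.m] at h5 h6
  rw [← hD] at h6
  exact ⟨_, t, s, π, h1, h3, h4, (Nat.cast_le.2 (h2.trans (hC₁ _))).trans h5, h6⟩
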